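/- Let $\Omega\subset\mathbb R^3$ be a simply connected bounded domain with $C^2$ boundary and exterior unit normal $\nu$, and let $n\in L^\infty(\Omega)$ be real valued such that, for some constants $r_0,r_1,c>0$, either $n>1+r_0$ a.e. in $\Omega$, or $c<n<1-r_1$ a.e. in $\Omega$. Let $\sup n$ be the essential supremum of $n$ on $\Omega$, and let $\lambda_1(\Omega)$ be the smallest Dirichlet eigenvalue of $-\Delta$ in $\Omega$. Let $$\mathcal U(\Omega)=\{u\in L^2(\Omega)^3:\ \operatorname{curl}u\in L^2(\Omega)^3,\ \operatorname{curl}\operatorname{curl}u\in L^2(\Omega)^3\},$$ $$\|u\|_{\mathcal U(\Omega)}^2=\|u\|_{L^2}^2+2\|\operatorname{curl}u\|_{L^2}^2+\|\operatorname{curl}\operatorname{curl}u\|_{L^2}^2 ,$$ for complex vector fields and distributional curls. Tangential traces on $\partial\Omega$ are understood in the weak sense: for $u,\operatorname{curl}u\in L^2(\Omega)^3$, $$\langle u\times\nu,\psi\rangle=\int_\Omega\big(u\cdot\operatorname{curl}\psi-\operatorname{curl}u\cdot\psi\big)\,dx,\qquad \psi\in C_c^\infty(\mathbb R^3)^3 .$$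 Let $\tau(\partial\Omega)$ be the set of all pairs $(h_1,h_2)=(w\times\nu,\ \operatorname{curl}w\times\nu)$ with $w\in\mathcal U(\Omega)$, with the norm $$\|(h_1,h_2)\|_{\tau(\partial\Omega)}=\inf\{\|w\|_{\mathcal U(\Omega)}:\ w\in\mathcal U(\Omega),\ w\times\nu=h_1,\ \operatorname{curl}w\times\nu=h_2\}.$$ For $k>0$ and $(h_1,h_2)\in\tau(\partial\Omega)$, a weak solution of the interior transmission problem $$\operatorname{curl}\operatorname{curl}E_0-k^2E_0=0,\qquad \operatorname{curl}\operatorname{curl}F_0-k^2nF_0=0\qquad\text{in }\Omega,$$ $$F_0\times\nu-E_0\times\nu=h_1,\qquad \operatorname{curl}F_0\times\nu-\operatorname{curl}E_0\times\nu=h_2\qquad\text{on }\partial\Omega$$ is a pair $(E_0,F_0)\in L^2(\Omega)^3\times L^2(\Omega)^3$ that satisfies the two differential equations in the sense of distributions and is such that $u:=F_0-E_0\in\mathcal U(\Omega)$, $u\times\nu=h_1$ and $\operatorname{curl}u\times\nu=h_2$ on $\partial\Omega$. Fix $k>0$. Then: (i) For every real $N$ there is $\delta>0$, depending only on $k$ and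 $N$, such that for all $\Omega$ and $n$ as above with $\sup n\le N$ and $\operatorname{diam}\Omega<\delta$, $$k^2<\min\{\lambda_1(\Omega),\ \lambda_1(\Omega)/\sup n\}.\qquad(*)$$ (ii) Whenever $\Omega$ and $n$ are as above and $(*)$ holds, there is a constant $C>0$ (depending on $k$, $\Omega$, $n$ only) such that for every $(h_1,h_2)\in\tau(\partial\Omega)$ the interior transmission problem has a unique weak solution $(E_0,F_0)\in L^2(\Omega)^3\times L^2(\Omega)^3$, and $$\|E_0\|_{L^2(\Omega)^3}+\|F_0\|_{L^2(\Omega)^3}\le C\,\|(h_1,h_2)\|_{\tau(\partial\Omega)} .$$ -/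

import Mathlib

open MeasureTheory TopologicalSpace
open scoped Distributions ContDiff

/-- Physical space `ℝ³`. -/
abbrev R3 : Type := EuclideanSpace ℝ (Fin 3)

/-- Values of complex vector fields. -/
abbrev C3 : Type := EuclideanSpace ℂ (Fin 3)

/-- The space `L²(Ω)³` of complex vector fields, with Lebesgue measure on `Ω`. -/
abbrev L2Field (Ω : Opens R3) : Type := Lp C3 2 (volume.restrict (Ω : Set R3))

/-- The boundary of `Ω` is of class `C²`: near each boundary point, `Ω` is the negativity set of a
`C²` function whose derivative does not vanish at that point (so `Ω` lies locally on one side of a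
`C²` surface). -/
def HasC2Boundary (Ω : Opens R3) : Prop :=
  ∀ x ∈ frontier (Ω : Set R3), ∃ U : Set R3, IsOpen U ∧ x ∈ U ∧
    ∃ ρ : R3 → ℝ, ContDiffOn ℝ 2 ρ U ∧ fderiv ℝ ρ x ≠ 0 ∧ ∀ y ∈ U, (y ∈ Ω ↔ ρ y < 0)

/-- Simply connected (hence nonempty and connected) bounded domains with `C²` boundary. -/
structure IsC2Domain (Ω : Opens R3) : Prop where
  simplyConnected : SimplyConnectedSpace Ω
  bounded : Bornology.IsBounded (Ω : Set R3)
  boundary : HasC2Boundary Ω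

/-- A real refractive index `n ∈ L^∞(Ω)`, positive and bounded away from `0`, that stays
on one side of `1`, at a positive distance from it. -/
def IsAdmissibleIndex (Ω : Opens R3) (n : R3 → ℝ) : Prop :=
  MemLp n ⊤ (volume.restrict (Ω : Set R3)) ∧
    ((∃ r₀ > 0, ∀ᵐ x ∂(volume.restrict (Ω : Set R3)), 1 + r₀ < n x) ∨
     (∃ c > 0, ∃ r₁ > 0, ∀ᵐ x ∂(volume.restrict (Ω : Set R3)), c < n x ∧ n x < 1 - r₁))

/-- `sup n` for `n ∈ L^∞(Ω)`. -/
noncomputable def indexSup (Ω : Opens R3) (n : R3 → ℝ) : ℝ :=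
  essSup n (volume.restrict (Ω : Set R3))

/-! ### The first Dirichlet eigenvalue -/

/-- The space `H¹₀(Ω)`, realised as the set of pairs `(u, ∇u)`: the closure in `L² × L²` of the
pairs `(φ, ∇φ)` with `φ ∈ C_c^∞(Ω)`. -/
def sobolevH10 (Ω : Opens R3) :
    Set (Lp ℝ 2 (volume.restrict (Ω : Set R3)) × Lp R3 2 (volume.restrict (Ω : Set R3))) :=
  closure {p | ∃ φ : 𝓓(Ω, ℝ), p.1 =ᵐ[volume.restrict (Ω : Set R3)] (fun x => φ x) ∧
    p.2 =ᵐ[volume.restrict (Ω : Set R3)] (fun x => gradient φ x)}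

/-- `l` is a Dirichlet eigenvalue of `-Δ` in `Ω`: there is `0 ≠ u ∈ H¹₀(Ω)` with
`∫ ∇u · ∇v = l ∫ u v` for all `v ∈ H¹₀(Ω)`. -/
def IsDirichletEigenvalue (Ω : Opens R3) (l : ℝ) : Prop :=
  ∃ u ∈ sobolevH10 Ω, u.1 ≠ 0 ∧
    ∀ v ∈ sobolevH10 Ω, inner ℝ u.2 v.2 = l * inner ℝ u.1 v.1

/-- The smallest Dirichlet eigenvalue `λ₁(Ω)` of `-Δ` in `Ω`. -/
noncomputable def firstDirichletEigenvalue (Ω : Opens R3) : ℝ :=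
  sInf {l | IsDirichletEigenvalue Ω l}

/-! ### Curl, the spaces of the problem, and tangential traces -/

/-- The partial derivative `∂ᵢψⱼ(x)`. -/
noncomputable def partialDeriv (ψ : R3 → R3) (i j : Fin 3) (x : R3) : ℝ :=
  fderiv ℝ ψ x (EuclideanSpace.single i 1) j

/-- The classical curl of a smooth vector field. -/
noncomputable def curl (ψ : R3 → R3) (x : R3) : R3 :=
  !₂[partialDeriv ψ 1 2 x - partialDeriv ψ 2 1 x,
     partialDeriv ψ 2 0 x - partialDeriv ψ 0 2 x,
     partialDeriv ψ 0 1 x - partialDeriv ψ 1 0 x]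

/-- The bilinear product `a · b = ∑ⱼ aⱼ bⱼ`. -/
noncomputable def dotC (a : C3) (b : R3) : ℂ := ∑ j, a j * (b j : ℂ)

/-- `c ∈ L²(Ω)³` is the distributional curl of `u ∈ L²(Ω)³` in `Ω`. -/
def IsWeakCurl (Ω : Opens R3) (u c : L2Field Ω) : Prop :=
  ∀ ψ : 𝓓(Ω, R3), ∫ x in (Ω : Set R3), dotC (c x) (ψ x) =
    ∫ x in (Ω : Set R3), dotC (u x) (curl ψ x)

/-- Boundary data: complex distributions on `ℝ³` acting on vector test fields. A tangential trace
on `∂Ω` is identified with the distribution `ψ ↦ ∫_{∂Ω} (w × ν) · ψ ds`, carried by `∂Ω`. -/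
abbrev VectorDistribution : Type := 𝓓((⊤ : Opens R3), R3) →L[ℝ] ℂ

/-- `u × ν = h` on `∂Ω` for `u ∈ H(curl, Ω)` with `curl u = c`, where `ν` is the exterior unit
normal. The tangential trace is defined by Green's formula
`∫_{∂Ω} (u × ν) · ψ ds = ∫_Ω (u · curl ψ - curl u · ψ) dx`
for all smooth `ψ` on `ℝ³` with compact support (no condition on `ψ` at `∂Ω`). -/
def HasTangentialTrace (Ω : Opens R3) (u c : L2Field Ω) (h : VectorDistribution) : Prop :=
  ∀ ψ : 𝓓((⊤ : Opens R3), R3),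
    h ψ = ∫ x in (Ω : Set R3), (dotC (u x) (curl ψ x) - dotC (c x) (ψ x))

/-- The space `𝒰(Ω) = {u ∈ H(curl, Ω) : curl u ∈ H(curl, Ω)}`, an element being given together with
its (unique) curl and curl curl. -/
structure UField (Ω : Opens R3) where
  field : L2Field Ω
  curlField : L2Field Ω
  curlCurlField : L2Field Ω
  isCurl : IsWeakCurl Ω field curlField
  isCurlCurl : IsWeakCurl Ω curlField curlCurlField

/-- The norm of `𝒰(Ω)`:
`‖u‖² = (‖u‖² + ‖curl u‖²) + (‖curl u‖² + ‖curl curl u‖²)`, with `L²` norms on the right. -/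
noncomputable def UField.norm {Ω : Opens R3} (w : UField Ω) : ℝ :=
  Real.sqrt ((‖w.field‖ ^ 2 + ‖w.curlField‖ ^ 2) + (‖w.curlField‖ ^ 2 + ‖w.curlCurlField‖ ^ 2))

/-- `w × ν = h₁` and `curl w × ν = h₂` on `∂Ω`. -/
def UField.HasTraces {Ω : Opens R3} (w : UField Ω)
    (h : VectorDistribution × VectorDistribution) : Prop :=
  HasTangentialTrace Ω w.field w.curlField h.1 ∧
    HasTangentialTrace Ω w.curlField w.curlCurlField h.2

/-- The set `τ(∂Ω)` of pairs `(h₁, h₂)` of the form `(w × ν, curl w × ν)` with `w ∈ 𝒰(Ω)`. -/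
def traceSpace (Ω : Opens R3) : Set (VectorDistribution × VectorDistribution) :=
  {h | ∃ w : UField Ω, w.HasTraces h}

/-- The norm of `τ(∂Ω)`. -/
noncomputable def traceNorm (Ω : Opens R3) (h : VectorDistribution × VectorDistribution) : ℝ :=
  sInf {r | ∃ w : UField Ω, w.HasTraces h ∧ r = w.norm}

/-! ### The interior transmission problem -/

/-- `curl curl E - k² m E = 0` in `Ω` in the sense of distributions. -/
def SolvesMaxwell (Ω : Opens R3) (k : ℝ) (m : R3 → ℝ) (E : L2Field Ω) : Prop :=
  ∀ ψ : 𝓓(Ω, R3),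
    ∫ x in (Ω : Set R3), (dotC (E x) (curl (curl ψ) x)
      - (k : ℂ) ^ 2 * (m x : ℂ) * dotC (E x) (ψ x)) = 0

/-- `(E₀, F₀) = p` is a weak solution of the interior transmission problem with index `n` and data
`h = (h₁, h₂)`: both equations hold in the sense of distributions, `F₀ - E₀ ∈ 𝒰(Ω)`, and
`(F₀ - E₀) × ν = h₁`, `curl (F₀ - E₀) × ν = h₂` on `∂Ω`. -/
def IsWeakSolution (Ω : Opens R3) (k : ℝ) (n : R3 → ℝ)
    (h : VectorDistribution × VectorDistribution) (p : L2Field Ω × L2Field Ω) : Prop :=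
  SolvesMaxwell Ω k (fun _ => 1) p.1 ∧ SolvesMaxwell Ω k n p.2 ∧
    ∃ u : UField Ω, u.field = p.2 - p.1 ∧ u.HasTraces h

/-! Put `u = F₀ - E₀`. Subtracting the two equations gives `curl curl u - k² u = k² (n - 1) F₀`.
Since `n` stays away from `1`, the function `m = 1/(n - 1)` is bounded and `F₀ = k⁻² m (curl curl u
- k² u)` is determined by `u`. What remains is the equation for `F₀`, a fourth order problem for `u`
with both traces prescribed: `⟨m (curl curl u - k² u), curl curl v⟩ - k² ⟨n m (curl curl u - k² u),
v⟩ = 0` for all test fields `v`. After a lift of the data is subtracted the unknown has vanishing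
traces, and Lax-Milgram applies as soon as the form, up to sign, is coercive on such fields.

Because `n m = 1 + m`, the diagonal value is `⟨m (t - k² u), t - k² u⟩ - k² ⟨u, t⟩ + k⁴ ‖u‖²` with
`t = curl curl u`. The dangerous term is `k² ⟨u, t⟩ = k² ‖curl u‖²`, and it is controlled by `λ₁
‖curl u‖² ≤ ‖t‖²`. For a test field this holds because `curl u` is solenoidal: its Dirichlet
integral is exactly `‖curl curl u‖²` (`sum_integral_pd_sq_curl`), and each component obeys the
Rayleigh bound. The condition `(*)` then makes the form positive when `n > 1` and negative when `n <
1` (`exists_coercive_gt`, `exists_coercive_lt`).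

The estimates pass from test fields to all fields with vanishing traces by density
(`exists_test_approx`). Such a field, extended by zero, has square integrable weak curls on `ℝ³`. It
is mollified and then pulled back, as a 1-form, along `x ↦ x + ε X(x)`, where `X` pushes the
complement of `Ω` off its closure; the pullback is therefore compactly supported in `Ω`.

That `λ₁` is attained and gives the Rayleigh bound comes from a Fourier proof of Rellich's theorem
(`rellich`, `exists_min_rayleigh`). Poincaré's inequality with constant `4 diam²` bounds `λ₁` below
and yields (i). All data of the equations except the fields are real, so complex fields are treated
through their real and imaginary parts. -/

/-! ### Smooth compactly supported functions on `ℝ³` -/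

/-- The standard basis vectors of `ℝ³`. -/
noncomputable abbrev basisVec (i : Fin 3) : R3 := EuclideanSpace.single i 1

/-- The partial derivative `∂ᵢ f` of a scalar function. -/
noncomputable def pd (i : Fin 3) (f : R3 → ℝ) (x : R3) : ℝ := fderiv ℝ f x (basisVec i)

/-- Smooth functions with compact support. -/
structure IsTest {F : Type*} [NormedAddCommGroup F] [NormedSpace ℝ F] (f : R3 → F) : Prop where
  smooth : ContDiff ℝ ∞ f
  compact : HasCompactSupport f

section Calculus

variable {F : Type*} [NormedAddCommGroup F] [NormedSpace ℝ F]

/-! ### Partial derivatives and the curl in coordinates -/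

lemma ContDiff.differentiable_infty {f : R3 → F} (hf : ContDiff ℝ ∞ f) : Differentiable ℝ f :=
  hf.differentiable (by simp)

lemma ContDiff.coord {f : R3 → R3} (hf : ContDiff ℝ ∞ f) (j : Fin 3) :
    ContDiff ℝ ∞ (fun x => f x j) :=
  (EuclideanSpace.proj j : R3 →L[ℝ] ℝ).contDiff.comp hf

lemma contDiff_of_coord {f : R3 → R3} (hf : ∀ j, ContDiff ℝ ∞ (fun x => f x j)) :
    ContDiff ℝ ∞ f := contDiff_euclidean.2 hf

lemma ContDiff.pd {f : R3 → ℝ} (hf : ContDiff ℝ ∞ f) (i : Fin 3) : ContDiff ℝ ∞ (pd i f) :=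
  (hf.fderiv_right (m := ∞) (by simp)).clm_apply contDiff_const

lemma pd_add {f g : R3 → ℝ} (hf : Differentiable ℝ f) (hg : Differentiable ℝ g) (i : Fin 3) :
    pd i (fun x => f x + g x) = fun x => pd i f x + pd i g x := by
  ext x
  simp [pd, fderiv_fun_add (hf x) (hg x)]

lemma pd_sub {f g : R3 → ℝ} (hf : Differentiable ℝ f) (hg : Differentiable ℝ g) (i : Fin 3) :
    pd i (fun x => f x - g x) = fun x => pd i f x - pd i g x := by
  ext x
  simp [pd, fderiv_fun_sub (hf x) (hg x)]

lemma pd_const_mul {f : R3 → ℝ} (c : ℝ) (hf : Differentiable ℝ f) (i : Fin 3) :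
    pd i (fun x => c * f x) = fun x => c * pd i f x := by
  ext x
  simp [pd, fderiv_const_mul (hf x) c]

lemma pd_mul {f g : R3 → ℝ} (hf : Differentiable ℝ f) (hg : Differentiable ℝ g) (i : Fin 3) :
    pd i (fun x => f x * g x) = fun x => pd i f x * g x + f x * pd i g x := by
  ext x
  simp [pd, fderiv_fun_mul (hf x) (hg x)]
  ring

lemma pd_comm {f : R3 → ℝ} (hf : ContDiff ℝ ∞ f) (i j : Fin 3) :
    pd i (pd j f) = pd j (pd i f) := by
  ext x
  have hd : DifferentiableAt ℝ (fderiv ℝ f) x :=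
    (hf.fderiv_right (m := ∞) (by simp)).differentiable_infty x
  have h (a b : Fin 3) : pd a (pd b f) x = fderiv ℝ (fderiv ℝ f) x (basisVec a) (basisVec b) := by
    change fderiv ℝ (fun y => fderiv ℝ f y (basisVec b)) x (basisVec a) = _
    rw [fderiv_clm_apply hd (by fun_prop)]
    simp
  rw [h, h]
  have hs : IsSymmSndFDerivAt ℝ f x := hf.contDiffAt.isSymmSndFDerivAt (by simp; exact WithTop.coe_le_coe.2 le_top)
  exact hs _ _

lemma fderiv_apply_coord {f : R3 → R3} {x : R3} (hf : DifferentiableAt ℝ f x) (v : R3)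
    (j : Fin 3) : fderiv ℝ f x v j = fderiv ℝ (fun y => f y j) x v := by
  have := ((EuclideanSpace.proj j : R3 →L[ℝ] ℝ).hasFDerivAt.comp x hf.hasFDerivAt).fderiv
  change _ = fderiv ℝ ((EuclideanSpace.proj j : R3 →L[ℝ] ℝ) ∘ f) x v
  rw [this]; rfl

lemma partialDeriv_eq {f : R3 → R3} {x : R3} (hf : DifferentiableAt ℝ f x) (i j : Fin 3) :
    partialDeriv f i j x = pd i (fun y => f y j) x := fderiv_apply_coord hf _ _

lemma R3.eq_sum (v : R3) : v = ∑ i, v i • basisVec i := by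
  ext j
  fin_cases j <;> simp [Fin.sum_univ_three]

lemma fderiv_eq_sum_pd (f : R3 → ℝ) (x v : R3) : fderiv ℝ f x v = ∑ i, v i * pd i f x := by
  conv_lhs => rw [R3.eq_sum v]
  simp [pd]

lemma curl_zero_apply (f : R3 → R3) (x : R3) :
    curl f x 0 = partialDeriv f 1 2 x - partialDeriv f 2 1 x := rfl
lemma curl_one_apply (f : R3 → R3) (x : R3) :
    curl f x 1 = partialDeriv f 2 0 x - partialDeriv f 0 2 x := rfl
lemma curl_two_apply (f : R3 → R3) (x : R3) :
    curl f x 2 = partialDeriv f 0 1 x - partialDeriv f 1 0 x := rfl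

lemma ContDiff.curl {f : R3 → R3} (hf : ContDiff ℝ ∞ f) : ContDiff ℝ ∞ (curl f) := by
  have h (i j : Fin 3) : ContDiff ℝ ∞ (fun x => partialDeriv f i j x) := by
    have : (fun x => partialDeriv f i j x) = _root_.pd i (fun y => f y j) :=
      funext fun x => partialDeriv_eq (hf.differentiable_infty x) i j
    rw [this]
    exact (hf.coord j).pd i
  refine contDiff_of_coord fun j => ?_
  fin_cases j
  · exact (h 1 2).sub (h 2 1)
  · exact (h 2 0).sub (h 0 2)
  · exact (h 0 1).sub (h 1 0)

lemma curl_eq_zero_of_fderiv {f : R3 → R3} {x : R3} (h : fderiv ℝ f x = 0) : curl f x = 0 := by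
  ext j
  fin_cases j <;> simp [curl, partialDeriv, h]

lemma support_curl_subset (f : R3 → R3) : Function.support (curl f) ⊆ tsupport f := by
  intro x hx
  by_contra h
  exact hx (curl_eq_zero_of_fderiv (by
    by_contra h'
    exact h (support_fderiv_subset ℝ h')))

lemma tsupport_curl_subset (f : R3 → R3) : tsupport (curl f) ⊆ tsupport f :=
  closure_minimal (support_curl_subset f) (isClosed_tsupport f)

lemma support_pd_subset (i : Fin 3) (f : R3 → ℝ) : Function.support (pd i f) ⊆ tsupport f := by
  intro x hx
  by_contra h
  refine hx ?_
  have : fderiv ℝ f x = 0 := by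
    by_contra h'
    exact h (support_fderiv_subset ℝ h')
  simp [pd, this]

lemma tsupport_coord_subset (f : R3 → R3) (j : Fin 3) : tsupport (fun x => f x j) ⊆ tsupport f := by
  refine closure_mono fun x hx => ?_
  contrapose! hx
  simp only [Function.mem_support, not_not] at hx ⊢
  simp [hx]

/-! ### Test functions, integration by parts and Green's formula -/

lemma IsTest.curl {f : R3 → R3} (hf : IsTest f) : IsTest (curl f) :=
  ⟨hf.smooth.curl, hf.compact.mono' (support_curl_subset f)⟩

lemma IsTest.pd {f : R3 → ℝ} (hf : IsTest f) (i : Fin 3) : IsTest (pd i f) :=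
  ⟨hf.smooth.pd i, hf.compact.mono' (support_pd_subset i f)⟩

lemma IsTest.coord {f : R3 → R3} (hf : IsTest f) (j : Fin 3) : IsTest (fun x => f x j) :=
  ⟨hf.smooth.coord j, hf.compact.mono' (subset_tsupport _ |>.trans (tsupport_coord_subset f j))⟩

lemma IsTest.mul {f g : R3 → ℝ} (hf : IsTest f) (hg : IsTest g) : IsTest (fun x => f x * g x) :=
  ⟨hf.smooth.mul hg.smooth, hf.compact.mul_right⟩

lemma IsTest.integrable {f : R3 → F} (hf : IsTest f) (μ : Measure R3)
    [IsFiniteMeasureOnCompacts μ] : Integrable f μ :=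
  hf.smooth.continuous.integrable_of_hasCompactSupport hf.compact

lemma IsTest.memLp {f : R3 → F} (hf : IsTest f) (p : ENNReal) (μ : Measure R3)
    [IsFiniteMeasureOnCompacts μ] : MemLp f p μ :=
  hf.smooth.continuous.memLp_of_hasCompactSupport hf.compact

lemma integral_pd_mul {f g : R3 → ℝ} (hf : IsTest f) (hg : IsTest g) (i : Fin 3) :
    ∫ x, pd i f x * g x = - ∫ x, f x * pd i g x := by
  have := integral_mul_fderiv_eq_neg_fderiv_mul_of_integrable (𝕜 := ℝ) (μ := (volume : Measure R3))
    (f := g) (g := f) (v := basisVec i)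
    ((hg.pd i).mul hf |>.integrable _) (hg.mul (hf.pd i) |>.integrable _)
    (hg.mul hf |>.integrable _) (fun x _ => hg.smooth.differentiable_infty x)
    (fun x _ => hf.smooth.differentiable_infty x)
  simp only [pd]
  simpa only [mul_comm] using this

lemma inner_eq_sum (a b : R3) : inner ℝ a b = a 0 * b 0 + a 1 * b 1 + a 2 * b 2 := by
  simp [PiLp.inner_apply, Fin.sum_univ_three, mul_comm]

lemma norm_sq_eq_sum (a : R3) : ‖a‖ ^ 2 = a 0 ^ 2 + a 1 ^ 2 + a 2 ^ 2 := by
  simp [EuclideanSpace.real_norm_sq_eq, Fin.sum_univ_three]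

lemma IsTest.curl_zero {f : R3 → R3} (hf : ContDiff ℝ ∞ f) (x : R3) :
    _root_.curl f x 0 = _root_.pd 1 (fun y => f y 2) x - _root_.pd 2 (fun y => f y 1) x := by
  rw [curl_zero_apply, partialDeriv_eq (hf.differentiable_infty x),
    partialDeriv_eq (hf.differentiable_infty x)]

lemma IsTest.curl_one {f : R3 → R3} (hf : ContDiff ℝ ∞ f) (x : R3) :
    _root_.curl f x 1 = _root_.pd 2 (fun y => f y 0) x - _root_.pd 0 (fun y => f y 2) x := by
  rw [curl_one_apply, partialDeriv_eq (hf.differentiable_infty x),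
    partialDeriv_eq (hf.differentiable_infty x)]

lemma IsTest.curl_two {f : R3 → R3} (hf : ContDiff ℝ ∞ f) (x : R3) :
    _root_.curl f x 2 = _root_.pd 0 (fun y => f y 1) x - _root_.pd 1 (fun y => f y 0) x := by
  rw [curl_two_apply, partialDeriv_eq (hf.differentiable_infty x),
    partialDeriv_eq (hf.differentiable_infty x)]

lemma integral_add_add {a b c : R3 → ℝ} (ha : Integrable a) (hb : Integrable b)
    (hc : Integrable c) :
    ∫ x, (a x + b x + c x) = (∫ x, a x) + (∫ x, b x) + ∫ x, c x := by
  rw [integral_add (f := fun x => a x + b x) (ha.add hb) hc, integral_add ha hb]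

lemma integral_sub_add_sub_add_sub {a a' b b' c c' : R3 → ℝ} (ha : Integrable a)
    (ha' : Integrable a') (hb : Integrable b) (hb' : Integrable b') (hc : Integrable c)
    (hc' : Integrable c') :
    ∫ x, ((a x - a' x) + (b x - b' x) + (c x - c' x)) =
      ((∫ x, a x) - ∫ x, a' x) + ((∫ x, b x) - ∫ x, b' x) + ((∫ x, c x) - ∫ x, c' x) := by
  rw [integral_add_add (a := fun x => a x - a' x) (b := fun x => b x - b' x)
    (c := fun x => c x - c' x) (ha.sub ha') (hb.sub hb') (hc.sub hc'), integral_sub ha ha',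
    integral_sub hb hb', integral_sub hc hc']

/-- Green's formula for two test fields. -/
lemma integral_inner_curl {f g : R3 → R3} (hf : IsTest f) (hg : IsTest g) :
    ∫ x, inner ℝ (f x) (curl g x) = ∫ x, inner ℝ (curl f x) (g x) := by
  have e1 : ∀ x, inner ℝ (f x) (curl g x) =
      (f x 0 * pd 1 (fun y => g y 2) x - f x 0 * pd 2 (fun y => g y 1) x) +
      (f x 1 * pd 2 (fun y => g y 0) x - f x 1 * pd 0 (fun y => g y 2) x) +
      (f x 2 * pd 0 (fun y => g y 1) x - f x 2 * pd 1 (fun y => g y 0) x) := by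
    intro x
    rw [inner_eq_sum, IsTest.curl_zero hg.smooth, IsTest.curl_one hg.smooth,
      IsTest.curl_two hg.smooth]
    ring
  have e2 : ∀ x, inner ℝ (curl f x) (g x) =
      (pd 1 (fun y => f y 2) x * g x 0 - pd 2 (fun y => f y 1) x * g x 0) +
      (pd 2 (fun y => f y 0) x * g x 1 - pd 0 (fun y => f y 2) x * g x 1) +
      (pd 0 (fun y => f y 1) x * g x 2 - pd 1 (fun y => f y 0) x * g x 2) := by
    intro x
    rw [inner_eq_sum, IsTest.curl_zero hf.smooth, IsTest.curl_one hf.smooth,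
      IsTest.curl_two hf.smooth]
    ring
  have i1 (a b c : Fin 3) : Integrable (fun x => f x a * pd b (fun y => g y c) x) :=
    ((hf.coord a).mul ((hg.coord c).pd b)).integrable _
  have i2 (a b c : Fin 3) : Integrable (fun x => pd b (fun y => f y c) x * g x a) :=
    (((hf.coord c).pd b).mul (hg.coord a)).integrable _
  simp_rw [e1, e2]
  rw [integral_sub_add_sub_add_sub (i1 _ _ _) (i1 _ _ _) (i1 _ _ _) (i1 _ _ _) (i1 _ _ _)
      (i1 _ _ _), integral_sub_add_sub_add_sub (i2 _ _ _) (i2 _ _ _) (i2 _ _ _) (i2 _ _ _)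
      (i2 _ _ _) (i2 _ _ _)]
  have h (a b c : Fin 3) := integral_pd_mul (hf.coord c) (hg.coord a) b
  simp only [h]
  ring

lemma div_curl {f : R3 → R3} (hf : ContDiff ℝ ∞ f) (x : R3) :
    pd 0 (fun y => curl f y 0) x + pd 1 (fun y => curl f y 1) x
      + pd 2 (fun y => curl f y 2) x = 0 := by
  have hd (i j : Fin 3) : Differentiable ℝ (pd i (fun y => f y j)) :=
    ((hf.coord j).pd i).differentiable_infty
  simp only [IsTest.curl_zero hf, IsTest.curl_one hf, IsTest.curl_two hf]
  rw [pd_sub (hd _ _) (hd _ _), pd_sub (hd _ _) (hd _ _), pd_sub (hd _ _) (hd _ _)]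
  simp only [pd_comm (hf.coord _) 1 0, pd_comm (hf.coord _) 2 0, pd_comm (hf.coord _) 2 1]
  ring

/-- Two integrations by parts and the symmetry of second derivatives. This turns the cross terms
`∂ᵢcⱼ ∂ⱼcᵢ` of `|curl c|²` into terms of `(div c)²`. -/
lemma integral_pd_mul_pd_swap {f g : R3 → ℝ} (hf : IsTest f) (hg : IsTest g) (i j : Fin 3) :
    ∫ x, pd i f x * pd j g x = ∫ x, pd j f x * pd i g x := by
  rw [integral_pd_mul hf (hg.pd j), integral_pd_mul hf (hg.pd i),
    pd_comm hg.smooth]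

/-- For solenoidal test fields the Dirichlet integral is the `L²` norm of the curl. -/
lemma sum_integral_pd_sq_curl {f : R3 → R3} (hf : IsTest f) :
    ∑ j, ∑ i, ∫ x, pd i (fun y => curl f y j) x ^ 2 = ∫ x, ‖curl (curl f) x‖ ^ 2 := by
  set c : R3 → R3 := curl f with hc
  have hct : IsTest c := hf.curl
  have I (i j k l : Fin 3) : Integrable
      (fun x => pd i (fun y => c y j) x * pd k (fun y => c y l) x) :=
    (((hct.coord j).pd i).mul ((hct.coord l).pd k)).integrable _
  set A : Fin 3 → Fin 3 → Fin 3 → Fin 3 → ℝ := fun i j k l =>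
    ∫ x, pd i (fun y => c y j) x * pd k (fun y => c y l) x with hA
  have e1 (i j : Fin 3) : ∫ x, pd i (fun y => c y j) x ^ 2 = A i j i j := by
    simp [hA, pow_two]
  have sq (i j : Fin 3) : ∫ x, (pd i (fun y => c y j) x - pd j (fun y => c y i) x) ^ 2 =
      A i j i j - 2 * A i j j i + A j i j i := by
    have : ∀ x, (pd i (fun y => c y j) x - pd j (fun y => c y i) x) ^ 2 =
        pd i (fun y => c y j) x * pd i (fun y => c y j) x
        - 2 * (pd i (fun y => c y j) x * pd j (fun y => c y i) x)
        + pd j (fun y => c y i) x * pd j (fun y => c y i) x := fun x => by ring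
    simp_rw [this]
    rw [integral_add (f := fun x => pd i (fun y => c y j) x * pd i (fun y => c y j) x
        - 2 * (pd i (fun y => c y j) x * pd j (fun y => c y i) x))
      ((I _ _ _ _).sub ((I _ _ _ _).const_mul 2)) (I _ _ _ _),
      integral_sub (I _ _ _ _) ((I _ _ _ _).const_mul 2), integral_const_mul]
  have Isq (i j : Fin 3) :
      Integrable (fun x => (pd i (fun y => c y j) x - pd j (fun y => c y i) x) ^ 2) := by
    have := ((I i j i j).sub ((I i j j i).const_mul 2)).add (I j i j i)
    refine this.congr (Filter.Eventually.of_forall fun x => ?_)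
    simp only [Pi.add_apply, Pi.sub_apply]
    ring
  have e2 : ∫ x, ‖curl c x‖ ^ 2 = (A 1 2 1 2 - 2 * A 1 2 2 1 + A 2 1 2 1) +
      (A 2 0 2 0 - 2 * A 2 0 0 2 + A 0 2 0 2) + (A 0 1 0 1 - 2 * A 0 1 1 0 + A 1 0 1 0) := by
    simp_rw [norm_sq_eq_sum, IsTest.curl_zero hct.smooth, IsTest.curl_one hct.smooth,
      IsTest.curl_two hct.smooth]
    rw [integral_add_add (Isq _ _) (Isq _ _) (Isq _ _), sq, sq, sq]
  -- The mixed terms in `‖curl c‖²` become products of diagonal derivatives, which the vanishing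
  -- divergence of `c` then evaluates.
  have sw (i j : Fin 3) : A i j j i = A j j i i := integral_pd_mul_pd_swap
    (hct.coord j) (hct.coord i) i j
  have sw' (i j : Fin 3) : A i i j j = A j j i i := by
    simp only [hA]
    simp only [mul_comm]
  have hdiv : A 0 0 0 0 + A 1 1 1 1 + A 2 2 2 2 + 2 * A 1 1 0 0 + 2 * A 2 2 0 0
      + 2 * A 2 2 1 1 = 0 := by
    have h0 : ∫ x, (pd 0 (fun y => c y 0) x + pd 1 (fun y => c y 1) x
        + pd 2 (fun y => c y 2) x) * (pd 0 (fun y => c y 0) x + pd 1 (fun y => c y 1) x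
        + pd 2 (fun y => c y 2) x) = 0 := by
      simp_rw [hc, div_curl hf.smooth]
      simp
    have h1 : ∀ x, (pd 0 (fun y => c y 0) x + pd 1 (fun y => c y 1) x
        + pd 2 (fun y => c y 2) x) * (pd 0 (fun y => c y 0) x + pd 1 (fun y => c y 1) x
        + pd 2 (fun y => c y 2) x) = ∑ i, ∑ j, pd i (fun y => c y i) x * pd j (fun y => c y j) x := by
      intro x
      simp only [Fin.sum_univ_three]
      ring
    simp_rw [h1] at h0
    rw [integral_finsetSum _ (fun i _ => integrable_finsetSum _ fun j _ => I i i j j)] at h0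
    simp_rw [integral_finsetSum _ (fun j _ => I _ _ j j)] at h0
    change ∑ i, ∑ j, A i i j j = 0 at h0
    simp only [Fin.sum_univ_three] at h0
    rw [sw' 0 1, sw' 0 2, sw' 1 2] at h0
    linarith
  simp_rw [e1]
  rw [e2, sw 1 2, sw 2 0, sw 0 1, sw' 0 2]
  simp only [Fin.sum_univ_three]
  linarith

end Calculus

/-! ### Compact embeddings of Hilbert spaces and their top eigenvalue -/

section Hilbert

variable {V A : Type*} [NormedAddCommGroup V] [InnerProductSpace ℝ V] [CompleteSpace V]
  [NormedAddCommGroup A] [InnerProductSpace ℝ A] [CompleteSpace A]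

/-- An operator that is small off finitely many functionals is a norm limit of finite rank
operators, and compact operators form a closed set. -/
lemma isCompactOperator_of_approx (J : V →L[ℝ] A)
    (h : ∀ ε > 0, ∃ (S : Finset A) (C : ℝ), ∀ v,
      ‖J v‖ ^ 2 ≤ ε * ‖v‖ ^ 2 + C * ∑ s ∈ S, (inner ℝ s (J v)) ^ 2) :
    IsCompactOperator J := by
  have key : J ∈ closure {T : V →L[ℝ] A | IsCompactOperator T} := by
    rw [Metric.mem_closure_iff]
    intro ε hε
    obtain ⟨S, C, hS⟩ := h ((ε / 2) ^ 2) (by positivity)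
    -- On the orthogonal complement of `J*S` every functional `⟨s, J ·⟩` vanishes, so only the `ε`
    -- term survives there. Composing `J` with the projection onto `W` gives the finite rank
    -- approximation.
    set W : Submodule ℝ V := Submodule.span ℝ (J.adjoint '' (S : Set A)) with hW
    have hfin : FiniteDimensional ℝ W := FiniteDimensional.span_of_finite ℝ (S.finite_toSet.image _)
    refine ⟨J ∘L (W.subtypeL ∘L W.orthogonalProjectionOnto), ?_, ?_⟩
    · have : ProperSpace W := FiniteDimensional.proper ℝ W
      have h1 : IsCompactOperator W.orthogonalProjectionOnto :=
        isCompactOperator_of_locallyCompactSpace_dom W.orthogonalProjectionOnto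
      exact h1.clm_comp (J ∘L W.subtypeL)
    · rw [dist_eq_norm]
      refine lt_of_le_of_lt (ContinuousLinearMap.opNorm_le_bound _ (by positivity : 0 ≤ ε / 2) ?_)
        (half_lt_self hε)
      intro v
      set w : V := v - W.orthogonalProjectionOnto v with hw
      have hwo : w ∈ Wᗮ := W.sub_starProjection_mem_orthogonal v
      have e : (J - J ∘L (W.subtypeL ∘L W.orthogonalProjectionOnto)) v = J w := by
        simp [hw]
      rw [e]
      have h0 : ∀ s ∈ S, inner ℝ s (J w) = 0 := by
        intro s hs
        rw [← ContinuousLinearMap.adjoint_inner_left]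
        exact hwo _ (Submodule.subset_span ⟨s, hs, rfl⟩)
      have h1 := hS w
      rw [Finset.sum_eq_zero fun s hs => by rw [h0 s hs]; simp] at h1
      have h2 : ‖w‖ ≤ ‖v‖ := by
        have hpyth := W.norm_sq_eq_add_norm_sq_starProjection v
        have : W.starProjection v = (W.orthogonalProjectionOnto v : V) := rfl
        have h3 : Wᗮ.starProjection v = w := by
          rw [Submodule.starProjection_orthogonal_val]; rfl
        rw [h3] at hpyth
        exact (pow_le_pow_iff_left₀ (norm_nonneg _) (norm_nonneg _) two_ne_zero).1
            (by nlinarith [sq_nonneg ‖W.starProjection v‖])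
      have h4 : ‖J w‖ ^ 2 ≤ (ε / 2 * ‖v‖) ^ 2 := by
        calc ‖J w‖ ^ 2 ≤ (ε / 2) ^ 2 * ‖w‖ ^ 2 := by linarith
          _ ≤ (ε / 2) ^ 2 * ‖v‖ ^ 2 := by gcongr
          _ = _ := by ring
      exact (pow_le_pow_iff_left₀ (norm_nonneg _) (by positivity) two_ne_zero).1 h4
  exact (isClosed_setOfPred_isCompactOperator (σ₁₂ := RingHom.id ℝ)).closure_subset key

/-- The squared norm of a compact operator is attained as an eigenvalue of `J* J`. -/
lemma IsCompactOperator.exists_norm_sq_eigenvector {J : V →L[ℝ] A} (hJ : IsCompactOperator J)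
    (h0 : J ≠ 0) :
    ∃ κ > 0, (∀ v, ‖J v‖ ^ 2 ≤ κ * ‖v‖ ^ 2) ∧
      ∃ g, J g ≠ 0 ∧ ∀ v, inner ℝ (J g) (J v) = κ * inner ℝ g v := by
  set T : V →L[ℝ] V := J.adjoint ∘L J with hT
  have hTc : IsCompactOperator T := hJ.clm_comp J.adjoint
  have hTs : IsSelfAdjoint T := by
    rw [hT, ContinuousLinearMap.isSelfAdjoint_iff_isSymmetric]
    intro x y
    simp [ContinuousLinearMap.adjoint_inner_left, ContinuousLinearMap.adjoint_inner_right]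
  have hTn : ‖T‖ = ‖J‖ ^ 2 := by
    rw [hT, pow_two]; exact ContinuousLinearMap.norm_adjoint_comp_self J
  have hT0 : T ≠ 0 := by
    intro h
    rw [h, norm_zero] at hTn
    exact h0 (norm_eq_zero.1 (pow_eq_zero_iff two_ne_zero |>.1 hTn.symm))
  have hTpos : 0 < ‖T‖ := norm_pos_iff.2 hT0
  -- For self-adjoint `T` the spectral radius is `‖T‖`, so a real spectral value `k` with `|k| =
  -- ‖T‖` exists. Compactness makes a nonzero spectral value an eigenvalue.
  have hr := T.spectralRadius_eq_nnnorm hTs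
  have hne : (spectrum ℝ T).Nonempty := by
    by_contra h
    rw [Set.not_nonempty_iff_eq_empty] at h
    rw [spectralRadius, h] at hr
    simp only [Set.mem_empty_iff_false, not_false_eq_true, iSup_neg, iSup_const,
      bot_eq_zero'] at hr
    exact hT0 (by simpa using hr.symm)
  obtain ⟨k, hk, hkr⟩ := spectrum.exists_nnnorm_eq_spectralRadius_of_nonempty hne
  rw [hr, ENNReal.coe_inj] at hkr
  have hkn : |k| = ‖T‖ := by simpa using congrArg NNReal.toReal hkr
  have hk0 : k ≠ 0 := by rintro rfl; simp at hkn; exact hTpos.ne hkn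
  obtain ⟨g, hg⟩ := ((hTc.hasEigenvalue_iff_mem_spectrum hk0).2 hk).exists_hasEigenvector
  have hgT : T g = k • g := hg.apply_eq_smul
  have hg0 : g ≠ 0 := hg.2
  have hin : ∀ v, inner ℝ (J g) (J v) = k * inner ℝ g v := by
    intro v
    rw [← ContinuousLinearMap.adjoint_inner_left]
    change inner ℝ (T g) v = _
    rw [hgT, real_inner_smul_left]
  have hself := hin g
  rw [real_inner_self_eq_norm_sq, real_inner_self_eq_norm_sq] at hself
  have hgn : 0 < ‖g‖ ^ 2 := by positivity
  have hkpos : 0 < k := by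
    rcases lt_or_gt_of_ne hk0 with h | h
    · nlinarith [sq_nonneg ‖J g‖]
    · exact h
  rw [abs_of_pos hkpos] at hkn
  refine ⟨k, hkpos, fun v => ?_, g, ?_, hin⟩
  · rw [hkn, hTn, ← mul_pow]
    gcongr
    exact J.le_opNorm v
  · intro h
    rw [h] at hself
    simp at hself
    rcases hself with h | h
    · exact hk0 h
    · exact hg0 h

/-- A closed subspace of `A × B` on which the first projection is compact: the Rayleigh quotient
`‖p.2‖² / ‖p.1‖²` attains its minimum, and the minimum is an eigenvalue. -/
lemma exists_min_rayleigh {B : Type*} [NormedAddCommGroup B] [InnerProductSpace ℝ B]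
    [CompleteSpace B] (W : Submodule ℝ (A × B)) (hW : IsClosed (W : Set (A × B)))
    (hcpt : ∀ ε > 0, ∃ (S : Finset A) (C : ℝ), ∀ p ∈ W,
      ‖p.1‖ ^ 2 ≤ ε * (‖p.1‖ ^ 2 + ‖p.2‖ ^ 2) + C * ∑ s ∈ S, (inner ℝ s p.1) ^ 2)
    (h0 : ∃ p ∈ W, p.1 ≠ 0) :
    ∃ l : ℝ, (∀ p ∈ W, l * ‖p.1‖ ^ 2 ≤ ‖p.2‖ ^ 2) ∧
      ∃ u ∈ W, u.1 ≠ 0 ∧ ∀ v ∈ W, inner ℝ u.2 v.2 = l * inner ℝ u.1 v.1 := by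
  -- The plain product carries the sup norm; `WithLp 2` supplies the Hilbert structure with `‖p‖² =
  -- ‖p.1‖² + ‖p.2‖²`.
  let e : WithLp 2 (A × B) ≃L[ℝ] A × B := WithLp.prodContinuousLinearEquiv 2 ℝ A B
  let V : Submodule ℝ (WithLp 2 (A × B)) := W.comap e.toLinearEquiv.toLinearMap
  have hVc : IsClosed (V : Set (WithLp 2 (A × B))) := hW.preimage e.continuous
  have : CompleteSpace V := hVc.completeSpace_coe
  let J : V →L[ℝ] A := (ContinuousLinearMap.fst ℝ A B) ∘L e.toContinuousLinearMap ∘L V.subtypeL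
  have hJ (v : V) : J v = (e v).1 := rfl
  have hmem (v : V) : e v ∈ W := v.2
  have hnorm (v : V) : ‖v‖ ^ 2 = ‖(e v).1‖ ^ 2 + ‖(e v).2‖ ^ 2 :=
    WithLp.prod_norm_sq_eq_of_L2 (v : WithLp 2 (A × B))
  have hinner (v w : V) : inner ℝ v w = inner ℝ (e v).1 (e w).1 + inner ℝ (e v).2 (e w).2 :=
    WithLp.prod_inner_apply (v : WithLp 2 (A × B)) w
  have hmk (p : A × B) (hp : p ∈ W) : ∃ v : V, e v = p := ⟨⟨e.symm p, hp⟩, rfl⟩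
  have hJc : IsCompactOperator J := by
    refine isCompactOperator_of_approx J fun ε hε => ?_
    obtain ⟨S, C, h⟩ := hcpt ε hε
    refine ⟨S, C, fun v => ?_⟩
    rw [hnorm]
    exact h _ (hmem v)
  have hJ0 : J ≠ 0 := by
    obtain ⟨p, hp, hp0⟩ := h0
    obtain ⟨v, rfl⟩ := hmk p hp
    intro h0
    exact hp0 (by rw [← hJ, h0]; rfl)
  obtain ⟨κ, hκ, hray, g, hg0, hg⟩ := hJc.exists_norm_sq_eigenvector hJ0
  -- `κ` is the maximum of `‖p.1‖² / (‖p.1‖² + ‖p.2‖²)`; solving for `‖p.2‖² / ‖p.1‖²` gives `κ⁻¹ -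
  -- 1`.
  refine ⟨κ⁻¹ - 1, fun p hp => ?_, e g, hmem g, hg0, fun p hp => ?_⟩
  · obtain ⟨v, rfl⟩ := hmk p hp
    have h2 := hray v
    rw [hJ, hnorm] at h2
    have h3 : κ⁻¹ * ‖(e v).1‖ ^ 2 ≤ κ⁻¹ * (κ * (‖(e v).1‖ ^ 2 + ‖(e v).2‖ ^ 2)) := by gcongr
    rw [inv_mul_cancel_left₀ hκ.ne'] at h3
    linarith
  · obtain ⟨v, rfl⟩ := hmk p hp
    have := hg v
    rw [hinner, hJ, hJ] at this
    have h2 : inner ℝ (e g).2 (e v).2 = κ⁻¹ * (κ * (inner ℝ (e g).1 (e v).1 +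
        inner ℝ (e g).2 (e v).2)) - inner ℝ (e g).1 (e v).1 := by
      rw [inv_mul_cancel_left₀ hκ.ne']; ring
    rw [← this] at h2
    rw [h2]; ring

end Hilbert

/-! ### Poincaré and Rellich inequalities for test functions -/

lemma gradient_coord {f : R3 → ℝ} (x : R3) (i : Fin 3) : gradient f x i = pd i f x := by
  have h : inner ℝ (gradient f x) (basisVec i) = fderiv ℝ f x (basisVec i) := by
    simp [gradient]
  have h' (v : R3) : inner ℝ v (basisVec i) = v i := by
    simp [basisVec, EuclideanSpace.inner_single_right]
  rw [pd, ← h, h']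

lemma norm_sq_gradient (f : R3 → ℝ) (x : R3) :
    ‖gradient f x‖ ^ 2 = pd 0 f x ^ 2 + pd 1 f x ^ 2 + pd 2 f x ^ 2 := by
  rw [norm_sq_eq_sum, gradient_coord, gradient_coord, gradient_coord]

lemma IsTest.gradient {f : R3 → ℝ} (hf : IsTest f) : IsTest (gradient f) := by
  refine ⟨contDiff_of_coord fun j => ?_, hf.compact.mono' fun x hx => ?_⟩
  · simp_rw [gradient_coord]
    exact hf.smooth.pd j
  · by_contra h
    have : fderiv ℝ f x = 0 := by
      by_contra h'
      exact h (support_fderiv_subset ℝ h')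
    exact hx (by simp [_root_.gradient, this])

lemma IsTest.integrable_sq {f : R3 → ℝ} (hf : IsTest f) : Integrable (fun x => f x ^ 2) := by
  simpa [pow_two] using (hf.mul hf).integrable volume

lemma IsTest.integral_norm_sq_gradient {f : R3 → ℝ} (hf : IsTest f) :
    ∫ x, ‖_root_.gradient f x‖ ^ 2 =
      (∫ x, _root_.pd 0 f x ^ 2) + (∫ x, _root_.pd 1 f x ^ 2) + ∫ x, _root_.pd 2 f x ^ 2 := by
  simp_rw [norm_sq_gradient]
  exact integral_add_add (hf.pd 0).integrable_sq (hf.pd 1).integrable_sq (hf.pd 2).integrable_sq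

/-- The Poincaré inequality, with a constant that is explicit in the diameter. -/
lemma poincare {f : R3 → ℝ} (hf : IsTest f) {s : Set R3} (hs : tsupport f ⊆ s)
    (hb : Bornology.IsBounded s) :
    ∫ x, f x ^ 2 ≤ 4 * Metric.diam s ^ 2 * ∫ x, ‖gradient f x‖ ^ 2 := by
  rcases s.eq_empty_or_nonempty with rfl | ⟨a, ha⟩
  · have : f = 0 := tsupport_eq_empty_iff.1 (Set.subset_empty_iff.1 hs)
    simp [this]
  set d := Metric.diam s
  -- Since `∂₀ℓ = 1`, integrating `ℓ ∂₀(f²)` by parts gives `-∫ f²`, while `|ℓ|` is at most the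
  -- diameter on the support of `f`.
  set ℓ : R3 → ℝ := fun x => x 0 - a 0 with hℓ
  have hℓs : ContDiff ℝ ∞ ℓ := (contDiff_id.coord 0).sub contDiff_const
  have hℓd : pd 0 ℓ = fun _ => 1 := by
    ext x
    have : fderiv ℝ ℓ x = (EuclideanSpace.proj 0 : R3 →L[ℝ] ℝ) := by
      have := ((EuclideanSpace.proj 0 : R3 →L[ℝ] ℝ).hasFDerivAt (x := x)).sub_const (a 0)
      exact this.fderiv
    simp [pd, this]
  have hℓb : ∀ x ∈ s, |ℓ x| ≤ d := by
    intro x hx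
    have h1 : ‖(x - a) 0‖ ≤ ‖x - a‖ := PiLp.norm_apply_le _ _
    have h2 : dist x a ≤ d := Metric.dist_le_diam_of_mem hb hx ha
    rw [dist_eq_norm] at h2
    simpa [hℓ] using h1.trans h2
  have hff := hf.mul hf
  have hIBP : ∫ x, ℓ x * pd 0 (fun y => f y * f y) x = - ∫ x, 1 * (f x * f x) := by
    have hT1 : IsTest (fun x => ℓ x * pd 0 (fun y => f y * f y) x) :=
      ⟨hℓs.mul (hff.pd 0).smooth, (hff.pd 0).compact.mul_left⟩
    have hT2 : IsTest (fun x => ℓ x * (f x * f x)) :=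
      ⟨hℓs.mul hff.smooth, hff.compact.mul_left⟩
    have hT3 : Integrable (fun x => pd 0 ℓ x * (f x * f x)) := by
      rw [hℓd]; simpa using hff.integrable volume
    have := integral_mul_fderiv_eq_neg_fderiv_mul_of_integrable (𝕜 := ℝ)
      (μ := (volume : Measure R3)) (f := ℓ) (g := fun y => f y * f y) (v := basisVec 0)
      hT3 (hT1.integrable _) (hT2.integrable _)
      (fun x _ => hℓs.differentiable_infty x) (fun x _ => hff.smooth.differentiable_infty x)
    have h2 : ∀ x, fderiv ℝ ℓ x (basisVec 0) = 1 := fun x => congrFun hℓd x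
    simp_rw [h2] at this
    exact this
  rw [pd_mul hf.smooth.differentiable_infty hf.smooth.differentiable_infty] at hIBP
  -- Young's inequality. The part `1/2 ∫ f²` is absorbed on the left, which doubles `2 d²` to the
  -- constant `4 d²`.
  have hpt : ∀ x, -(ℓ x * (pd 0 f x * f x + f x * pd 0 f x)) ≤
      1 / 2 * f x ^ 2 + 2 * d ^ 2 * pd 0 f x ^ 2 := by
    intro x
    by_cases hx : x ∈ s
    · have h1 := hℓb x hx
      have h2 : ℓ x ^ 2 ≤ d ^ 2 := by rw [← sq_abs]; gcongr
      nlinarith [sq_nonneg (f x + 2 * ℓ x * pd 0 f x), sq_nonneg (pd 0 f x),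
        mul_le_mul_of_nonneg_right h2 (sq_nonneg (pd 0 f x))]
    · have : f x = 0 := image_eq_zero_of_notMem_tsupport fun h => hx (hs h)
      rw [this]
      have : 0 ≤ 2 * d ^ 2 * pd 0 f x ^ 2 := by positivity
      simpa using this
  have hI1 : Integrable (fun x => 1 / 2 * f x ^ 2) := hf.integrable_sq.const_mul _
  have hI2 : Integrable (fun x => 2 * d ^ 2 * pd 0 f x ^ 2) := (hf.pd 0).integrable_sq.const_mul _
  have hT : IsTest (fun x => ℓ x * (pd 0 f x * f x + f x * pd 0 f x)) :=
    ⟨hℓs.mul (((hf.pd 0).smooth.mul hf.smooth).add (hf.smooth.mul (hf.pd 0).smooth)),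
      (((hf.pd 0).mul hf).compact.add (hf.mul (hf.pd 0)).compact).mul_left⟩
  have hle := integral_mono (hT.integrable volume).neg (hI1.add hI2) hpt
  have e1 : ∫ x, (-fun x => ℓ x * (pd 0 f x * f x + f x * pd 0 f x)) x = ∫ x, f x ^ 2 := by
    simp only [Pi.neg_apply]
    rw [integral_neg, hIBP]
    simp [pow_two]
  have e2 : ∫ x, ((fun x => 1 / 2 * f x ^ 2) + fun x => 2 * d ^ 2 * pd 0 f x ^ 2 : R3 → ℝ) x
      = 1 / 2 * (∫ x, f x ^ 2) + 2 * d ^ 2 * ∫ x, pd 0 f x ^ 2 := by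
    simp only [Pi.add_apply]
    rw [integral_add hI1 hI2, integral_const_mul, integral_const_mul]
  rw [e1, e2] at hle
  have hg : ∫ x, pd 0 f x ^ 2 ≤ ∫ x, ‖gradient f x‖ ^ 2 := by
    rw [hf.integral_norm_sq_gradient]
    have h1 : 0 ≤ ∫ x, pd 1 f x ^ 2 := integral_nonneg fun x => sq_nonneg _
    have h2 : 0 ≤ ∫ x, pd 2 f x ^ 2 := integral_nonneg fun x => sq_nonneg _
    linarith
  nlinarith [mul_le_mul_of_nonneg_left hg (by positivity : 0 ≤ 4 * d ^ 2)]

section Fourier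

open scoped FourierTransform RealInnerProductSpace LineDeriv

lemma norm_sq_fourier_lineDeriv (Φ : SchwartzMap R3 ℂ) (i : Fin 3) (ξ : R3) :
    ‖𝓕 (∂_{basisVec i} Φ) ξ‖ ^ 2 = (2 * Real.pi) ^ 2 * (ξ i ^ 2 * ‖𝓕 Φ ξ‖ ^ 2) := by
  rw [SchwartzMap.fourier_lineDerivOp_eq]
  have hT : (inner ℝ · (basisVec i) : R3 → ℝ).HasTemperateGrowth :=
    ((innerSL ℝ).flip (basisVec i)).hasTemperateGrowth
  rw [smul_apply, SchwartzMap.smulLeftCLM_apply_apply hT]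
  have h' : inner ℝ ξ (basisVec i) = ξ i := by
    simp [basisVec, EuclideanSpace.inner_single_right]
  rw [h', norm_smul, norm_smul, mul_pow, mul_pow]
  simp [abs_of_pos Real.pi_pos]

lemma integrable_norm_sq_schwartz (Ψ : SchwartzMap R3 ℂ) : Integrable (fun ξ => ‖Ψ ξ‖ ^ 2) :=
  (Ψ.memLp 2).integrable_norm_pow (by norm_num)

/-- Splitting the exponential into cosine and sine expresses the transform through pairings of `f`
with real plane waves, which are bounded functionals on the real space `L²(Ω)`. -/
lemma fourier_ofReal_eq {f : R3 → ℝ} (hint : Integrable f) (ξ : R3) :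
    𝓕 (fun x => (f x : ℂ)) ξ = ((∫ x, Real.cos (2 * Real.pi * inner ℝ x ξ) * f x : ℝ) : ℂ)
        - ((∫ x, Real.sin (2 * Real.pi * inner ℝ x ξ) * f x : ℝ) : ℂ) * Complex.I := by
  have hc : Integrable (fun x : R3 => Real.cos (2 * Real.pi * inner ℝ x ξ) * f x) := by
    refine hint.bdd_mul (c := 1) (by fun_prop) (Filter.Eventually.of_forall fun x => ?_)
    simpa using Real.abs_cos_le_one _
  have hs : Integrable (fun x : R3 => Real.sin (2 * Real.pi * inner ℝ x ξ) * f x) := by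
    refine hint.bdd_mul (c := 1) (by fun_prop) (Filter.Eventually.of_forall fun x => ?_)
    simpa using Real.abs_sin_le_one _
  rw [Real.fourier_eq', ← integral_complex_ofReal, ← integral_complex_ofReal,
    ← integral_mul_const, ← integral_sub hc.ofReal (hs.ofReal.mul_const _)]
  congr 1
  ext x
  rw [Complex.exp_mul_I, ← Complex.ofReal_cos, ← Complex.ofReal_sin,
    show (-2 * Real.pi * inner ℝ x ξ : ℝ) = -(2 * Real.pi * inner ℝ x ξ) by ring,
    Real.cos_neg, Real.sin_neg, smul_eq_mul]
  push_cast
  ring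

lemma norm_sq_fourier_ofReal {f : R3 → ℝ} (hint : Integrable f) (ξ : R3) :
    ‖𝓕 (fun x => (f x : ℂ)) ξ‖ ^ 2 =
      (∫ x, Real.cos (2 * Real.pi * inner ℝ x ξ) * f x) ^ 2 +
        (∫ x, Real.sin (2 * Real.pi * inner ℝ x ξ) * f x) ^ 2 := by
  rw [fourier_ofReal_eq hint, ← Complex.normSq_eq_norm_sq, Complex.normSq_apply]
  simp only [Complex.sub_re, Complex.ofReal_re, Complex.mul_re, Complex.I_re, mul_zero,
    Complex.ofReal_im, Complex.I_im, mul_one, sub_self, sub_zero, Complex.sub_im, Complex.mul_im,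
    add_zero, zero_sub]
  ring

lemma lineDeriv_ofReal {f : R3 → ℝ} (hf : ContDiff ℝ ∞ f) {Φ : SchwartzMap R3 ℂ}
    (hΦ : ∀ x, Φ x = (f x : ℂ)) (i : Fin 3) (x : R3) :
    (∂_{basisVec i} Φ) x = (pd i f x : ℂ) := by
  have h : (Φ : R3 → ℂ) = fun x => (f x : ℂ) := funext hΦ
  rw [SchwartzMap.lineDerivOp_apply_eq_fderiv, h]
  have : fderiv ℝ (fun x => (f x : ℂ)) x = Complex.ofRealCLM ∘L fderiv ℝ f x :=
    (Complex.ofRealCLM.hasFDerivAt.comp x (hf.differentiable_infty x).hasFDerivAt).fderiv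
  rw [this]; rfl

lemma integral_sq_mul_fourier {f : R3 → ℝ} (hf : ContDiff ℝ ∞ f) {Φ : SchwartzMap R3 ℂ}
    (hΦ : ∀ x, Φ x = (f x : ℂ)) (i : Fin 3) :
    ∫ ξ : R3, (2 * Real.pi) ^ 2 * (ξ i ^ 2 * ‖𝓕 Φ ξ‖ ^ 2) = ∫ x, pd i f x ^ 2 := by
  have := SchwartzMap.integral_norm_sq_fourier (∂_{basisVec i} Φ)
  simp_rw [norm_sq_fourier_lineDeriv, lineDeriv_ofReal hf hΦ, Complex.norm_real,
    Real.norm_eq_abs, sq_abs] at this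
  exact this

lemma integrable_sq_mul_fourier (Φ : SchwartzMap R3 ℂ) (i : Fin 3) :
    Integrable (fun ξ : R3 => (2 * Real.pi) ^ 2 * (ξ i ^ 2 * ‖𝓕 Φ ξ‖ ^ 2)) := by
  have := integrable_norm_sq_schwartz (𝓕 (∂_{basisVec i} Φ))
  simp_rw [norm_sq_fourier_lineDeriv] at this
  exact this

lemma norm_sq_mul_eq (ξ : R3) (r : ℝ) : ‖ξ‖ ^ 2 * r = ((2 * Real.pi) ^ 2)⁻¹ *
      ((2 * Real.pi) ^ 2 * (ξ 0 ^ 2 * r) + (2 * Real.pi) ^ 2 * (ξ 1 ^ 2 * r)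
        + (2 * Real.pi) ^ 2 * (ξ 2 ^ 2 * r)) := by
  rw [norm_sq_eq_sum, ← mul_add, ← mul_add, inv_mul_cancel_left₀ (by positivity)]
  ring

lemma integrable_norm_sq_mul_fourier (Φ : SchwartzMap R3 ℂ) :
    Integrable (fun ξ : R3 => ‖ξ‖ ^ 2 * ‖𝓕 Φ ξ‖ ^ 2) := by
  simp_rw [norm_sq_mul_eq]
  exact (((integrable_sq_mul_fourier Φ 0).add (integrable_sq_mul_fourier Φ 1)).add
    (integrable_sq_mul_fourier Φ 2)).const_mul _

/-- Plancherel for each partial derivative; the factor `(2π)⁻² ≤ 1` is discarded. -/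
lemma integral_norm_sq_mul_fourier_le {f : R3 → ℝ} (hf : IsTest f) {Φ : SchwartzMap R3 ℂ}
    (hΦ : ∀ x, Φ x = (f x : ℂ)) :
    ∫ ξ, ‖ξ‖ ^ 2 * ‖𝓕 Φ ξ‖ ^ 2 ≤ ∫ x, ‖gradient f x‖ ^ 2 := by
  have hpi : 1 ≤ (2 * Real.pi) ^ 2 := by nlinarith [Real.pi_gt_three]
  simp_rw [norm_sq_mul_eq]
  rw [integral_const_mul, integral_add_add (integrable_sq_mul_fourier Φ 0)
    (integrable_sq_mul_fourier Φ 1) (integrable_sq_mul_fourier Φ 2),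
    integral_sq_mul_fourier hf.smooth hΦ, integral_sq_mul_fourier hf.smooth hΦ,
    integral_sq_mul_fourier hf.smooth hΦ, ← hf.integral_norm_sq_gradient]
  exact mul_le_of_le_one_left (integral_nonneg fun x => by positivity) (inv_le_one_of_one_le₀ hpi)

/-- The properties of the Fourier transform of a test function used for Rellich's theorem. -/
lemma exists_fourier_transform {f : R3 → ℝ} (hf : IsTest f) :
    ∃ F : R3 → ℂ, Integrable (fun ξ => ‖F ξ‖ ^ 2) ∧ Integrable (fun ξ => ‖ξ‖ ^ 2 * ‖F ξ‖ ^ 2) ∧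
      (∫ ξ, ‖F ξ‖ ^ 2 = ∫ x, f x ^ 2) ∧
      (∫ ξ, ‖ξ‖ ^ 2 * ‖F ξ‖ ^ 2 ≤ ∫ x, ‖gradient f x‖ ^ 2) ∧
      ∀ ξ, ‖F ξ‖ ^ 2 = (∫ x, Real.cos (2 * Real.pi * inner ℝ x ξ) * f x) ^ 2 +
        (∫ x, Real.sin (2 * Real.pi * inner ℝ x ξ) * f x) ^ 2 := by
  have hcs : HasCompactSupport (fun x => (f x : ℂ)) :=
    hf.compact.comp_left (g := fun r : ℝ => (r : ℂ)) (by simp)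
  have hsm : ContDiff ℝ ∞ (fun x => (f x : ℂ)) := Complex.ofRealCLM.contDiff.comp hf.smooth
  obtain ⟨Φ, hΦ⟩ : ∃ Φ : SchwartzMap R3 ℂ, ∀ x, Φ x = (f x : ℂ) :=
    ⟨hcs.toSchwartzMap hsm, fun x => hcs.toSchwartzMap_toFun hsm x⟩
  refine ⟨fun ξ => 𝓕 Φ ξ, integrable_norm_sq_schwartz (𝓕 Φ), integrable_norm_sq_mul_fourier Φ, ?_,
    integral_norm_sq_mul_fourier_le hf hΦ, fun ξ => ?_⟩
  · rw [SchwartzMap.integral_norm_sq_fourier]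
    simp_rw [hΦ, Complex.norm_real, Real.norm_eq_abs, sq_abs]
  · rw [SchwartzMap.fourier_coe, show (Φ : R3 → ℂ) = fun x => (f x : ℂ) from funext hΦ]
    exact norm_sq_fourier_ofReal (hf.integrable _) ξ

end Fourier

/-! ### Rellich's theorem and the first Dirichlet eigenvalue -/

section Dirichlet

lemma isFiniteMeasure_restrict_of_isBounded {s : Set R3} (hb : Bornology.IsBounded s) :
    IsFiniteMeasure ((volume : Measure R3).restrict s) :=
  ⟨by simpa using hb.measure_lt_top⟩

/-- A family of plane waves in `L²(Ω)` depends continuously on the frequency. -/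
lemma exists_planeWave {Ω : Opens R3} (hb : Bornology.IsBounded (Ω : Set R3)) {h : ℝ → ℝ}
    (h1 : ∀ a, |h a| ≤ 1) (hl : ∀ a b, |h a - h b| ≤ |a - b|) :
    ∃ w : R3 → Lp ℝ 2 (volume.restrict (Ω : Set R3)), Continuous w ∧
      ∀ ξ, w ξ =ᵐ[volume.restrict (Ω : Set R3)] fun x => h (2 * Real.pi * inner ℝ x ξ) := by
  have := isFiniteMeasure_restrict_of_isBounded hb
  have hc : Continuous h := by
    refine LipschitzWith.continuous (K := 1) (LipschitzWith.of_dist_le_mul fun a b => ?_)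
    simpa [Real.dist_eq] using hl a b
  have hm (ξ : R3) : MemLp (fun x : R3 => h (2 * Real.pi * inner ℝ x ξ)) 2
      (volume.restrict (Ω : Set R3)) :=
    MemLp.of_bound (by fun_prop) 1 (Filter.Eventually.of_forall fun x => h1 _)
  refine ⟨fun ξ => (hm ξ).toLp, ?_, fun ξ => (hm ξ).coeFn_toLp⟩
  obtain ⟨M, hM⟩ := hb.exists_norm_le
  -- `K` is the square root of the volume of `Ω`, the price of passing from a uniform bound to the
  -- `L²` norm.
  set K : ℝ := (measureUnivNNReal (volume.restrict (Ω : Set R3)) : ℝ) ^ (2 : ENNReal).toReal⁻¹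
  have hK : 0 ≤ K := by positivity
  have hbd (ξ η : R3) : dist ((hm ξ).toLp) ((hm η).toLp) ≤
      K * (2 * Real.pi * |M| * dist ξ η) := by
    rw [dist_eq_norm]
    refine Lp.norm_le_of_ae_bound (by positivity) ?_
    filter_upwards [Lp.coeFn_sub (hm ξ).toLp (hm η).toLp, (hm ξ).coeFn_toLp, (hm η).coeFn_toLp,
      ae_restrict_mem Ω.2.measurableSet] with x e1 e2 e3 hx
    rw [e1, Pi.sub_apply, e2, e3, Real.norm_eq_abs]
    refine (hl _ _).trans ?_
    rw [← mul_sub, ← inner_sub_right, abs_mul, abs_of_pos (by positivity : 0 < 2 * Real.pi),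
      mul_assoc (2 * Real.pi)]
    refine mul_le_mul_of_nonneg_left ((abs_real_inner_le_norm _ _).trans ?_) (by positivity)
    rw [dist_eq_norm]
    gcongr
    exact (hM x hx).trans (le_abs_self _)
  refine LipschitzWith.continuous (K := ⟨K * (2 * Real.pi * |M|), by positivity⟩)
    (LipschitzWith.of_dist_le_mul fun ξ η => ?_)
  exact (hbd ξ η).trans_eq (by rw [← mul_assoc]; rfl)

/-- Compactness replaces the continuum of frequencies in a ball by finitely many plane waves. -/
lemma exists_finset_net {α X : Type*} [PseudoMetricSpace α] [PseudoMetricSpace X] {w : α → X}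
    (hw : Continuous w) {K : Set α} (hK : IsCompact K) {η : ℝ} (hη : 0 < η) :
    ∃ S : Finset X, ∀ ξ ∈ K, ∃ s ∈ S, dist (w ξ) s < η := by
  obtain ⟨t, -, htf, ht⟩ := (hK.image hw).finite_cover_balls hη
  refine ⟨htf.toFinset, fun ξ hξ => ?_⟩
  obtain ⟨s, hs, h⟩ := Set.mem_iUnion₂.1 (ht (Set.mem_image_of_mem w hξ))
  exact ⟨s, by simpa using hs, h⟩

/-- Write `v = s + (v - s)`, use `(a + b)² ≤ 2a² + 2b²` and apply Cauchy-Schwarz to the small part.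
-/
lemma inner_sq_le_of_net {H : Type*} [NormedAddCommGroup H] [InnerProductSpace ℝ H]
    {S T : Finset H} {u v : H} {η : ℝ} (hT : T ⊆ S) (h : ∃ s ∈ T, dist v s < η) :
    inner ℝ v u ^ 2 ≤ 2 * ∑ s ∈ S, inner ℝ s u ^ 2 + 2 * η ^ 2 * ‖u‖ ^ 2 := by
  obtain ⟨s, hs, hd⟩ := h
  have h1 : inner ℝ s u ^ 2 ≤ ∑ s ∈ S, inner ℝ s u ^ 2 :=
    Finset.single_le_sum (f := fun s => inner ℝ s u ^ 2) (fun s _ => sq_nonneg _) (hT hs)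
  have h2 : |inner ℝ (v - s) u| ≤ η * ‖u‖ := by
    refine (abs_real_inner_le_norm _ _).trans ?_
    rw [dist_eq_norm] at hd
    gcongr
  have h3 : inner ℝ (v - s) u ^ 2 ≤ (η * ‖u‖) ^ 2 := by
    rw [← sq_abs]
    gcongr
  have h4 : inner ℝ v u = inner ℝ s u + inner ℝ (v - s) u := by
    rw [← inner_add_left]; simp
  rw [h4]
  nlinarith [sq_nonneg (inner ℝ s u - inner ℝ (v - s) u)]

/-- An interpolation form of Rellich's theorem: up to a small part of the `H¹` norm, the `L²` norm
is controlled by finitely many bounded functionals. -/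
lemma rellich {Ω : Opens R3} (hb : Bornology.IsBounded (Ω : Set R3)) {ε : ℝ} (hε : 0 < ε) :
    ∃ (S : Finset (Lp ℝ 2 (volume.restrict (Ω : Set R3)))) (C : ℝ), ∀ f : R3 → ℝ, IsTest f →
      tsupport f ⊆ Ω → ∀ u : Lp ℝ 2 (volume.restrict (Ω : Set R3)),
      u =ᵐ[volume.restrict (Ω : Set R3)] f →
      ∫ x, f x ^ 2 ≤ ε * (‖u‖ ^ 2 + ∫ x, ‖gradient f x‖ ^ 2) + C * ∑ s ∈ S, inner ℝ s u ^ 2 := by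
  classical
  obtain ⟨wc, hwc, hwce⟩ := exists_planeWave hb (h := Real.cos) Real.abs_cos_le_one
    Real.abs_cos_sub_cos_le
  obtain ⟨ws, hws, hwse⟩ := exists_planeWave hb (h := Real.sin) Real.abs_sin_le_one
    Real.abs_sin_sub_sin_le
  -- Outside the ball of radius `R` one has `1 ≤ ε ‖ξ‖²`, so the gradient term absorbs the high
  -- frequencies.
  obtain ⟨R, hR0, hR⟩ : ∃ R : ℝ, 0 < R ∧ 1 ≤ ε * R ^ 2 := by
    refine ⟨(Real.sqrt ε)⁻¹, by positivity, ?_⟩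
    rw [inv_pow, Real.sq_sqrt hε.le, mul_inv_cancel₀ hε.ne']
  set B : Set R3 := Metric.closedBall 0 R with hB
  have hBc : IsCompact B := isCompact_closedBall _ _
  set m : ℝ := (volume : Measure R3).real B
  have hm : 0 ≤ m := measureReal_nonneg
  -- The net costs `4 η² ‖u‖²` at each low frequency: `2 η² ‖u‖²` for the cosine and as much for the
  -- sine. Integrated over the ball of volume `m`, this must not exceed `ε ‖u‖²`.
  obtain ⟨η, hη0, hη⟩ : ∃ η : ℝ, 0 < η ∧ 4 * m * η ^ 2 ≤ ε := by
    refine ⟨Real.sqrt (ε / (4 * m + 1)), by positivity, ?_⟩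
    rw [Real.sq_sqrt (by positivity), mul_div_assoc', div_le_iff₀ (by positivity)]
    nlinarith
  obtain ⟨Sc, hSc⟩ := exists_finset_net hwc hBc hη0
  obtain ⟨Ss, hSs⟩ := exists_finset_net hws hBc hη0
  refine ⟨Sc ∪ Ss, 4 * m, fun f hf hfs u hu => ?_⟩
  obtain ⟨F, hF1, hF2, hF3, hF4, hF5⟩ := exists_fourier_transform hf
  have hin (h : ℝ → ℝ) (w : R3 → Lp ℝ 2 (volume.restrict (Ω : Set R3)))
      (hw : ∀ ξ, w ξ =ᵐ[volume.restrict (Ω : Set R3)] fun x => h (2 * Real.pi * inner ℝ x ξ))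
      (ξ : R3) : ∫ x, h (2 * Real.pi * inner ℝ x ξ) * f x = inner ℝ (w ξ) u := by
    rw [L2.inner_def, ← setIntegral_eq_integral_of_forall_compl_eq_zero (s := (Ω : Set R3))]
    · refine integral_congr_ae ?_
      filter_upwards [hw ξ, hu] with x h1 h2
      rw [h1, h2]
      simp [mul_comm]
    · intro x hx
      rw [image_eq_zero_of_notMem_tsupport fun h => hx (hfs h), mul_zero]
  set q := ∑ s ∈ Sc ∪ Ss, inner ℝ s u ^ 2
  have hpt : ∀ ξ, ‖F ξ‖ ^ 2 ≤ B.indicator (fun _ => 4 * q + 4 * η ^ 2 * ‖u‖ ^ 2) ξ +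
      ε * (‖ξ‖ ^ 2 * ‖F ξ‖ ^ 2) := by
    intro ξ
    by_cases hξ : ξ ∈ B
    · rw [Set.indicator_of_mem hξ]
      have hc := inner_sq_le_of_net (u := u) (v := wc ξ) (η := η)
        (Finset.subset_union_left : Sc ⊆ Sc ∪ Ss) (hSc ξ hξ)
      have hs := inner_sq_le_of_net (u := u) (v := ws ξ) (η := η)
        (Finset.subset_union_right : Ss ⊆ Sc ∪ Ss) (hSs ξ hξ)
      have : ‖F ξ‖ ^ 2 = inner ℝ (wc ξ) u ^ 2 + inner ℝ (ws ξ) u ^ 2 := by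
        rw [hF5, hin Real.cos wc hwce, hin Real.sin ws hwse]
      have h0 : 0 ≤ ε * (‖ξ‖ ^ 2 * ‖F ξ‖ ^ 2) := by positivity
      linarith
    · rw [Set.indicator_of_notMem hξ, zero_add, ← mul_assoc]
      have h1 : R < ‖ξ‖ := by simpa [hB] using hξ
      have h2 : 1 ≤ ε * ‖ξ‖ ^ 2 := hR.trans (by gcongr)
      exact le_mul_of_one_le_left (by positivity) h2
  have hI : Integrable (B.indicator (fun _ : R3 => 4 * q + 4 * η ^ 2 * ‖u‖ ^ 2)) :=
    (integrable_indicator_iff hBc.measurableSet).2 (integrableOn_const hBc.measure_lt_top.ne)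
  have hle := integral_mono hF1 (hI.add (hF2.const_mul ε)) hpt
  have e : ∫ ξ, (B.indicator (fun _ : R3 => 4 * q + 4 * η ^ 2 * ‖u‖ ^ 2) +
      fun ξ => ε * (‖ξ‖ ^ 2 * ‖F ξ‖ ^ 2) : R3 → ℝ) ξ = m * (4 * q + 4 * η ^ 2 * ‖u‖ ^ 2) +
      ε * ∫ ξ, ‖ξ‖ ^ 2 * ‖F ξ‖ ^ 2 := by
    simp only [Pi.add_apply]
    rw [integral_add hI (hF2.const_mul ε), integral_indicator hBc.measurableSet,
      setIntegral_const, integral_const_mul, smul_eq_mul]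
  rw [e, hF3] at hle
  have h1 : ε * ∫ ξ, ‖ξ‖ ^ 2 * ‖F ξ‖ ^ 2 ≤ ε * ∫ x, ‖gradient f x‖ ^ 2 := by gcongr
  have h2 : 4 * m * η ^ 2 * ‖u‖ ^ 2 ≤ ε * ‖u‖ ^ 2 := by gcongr
  linarith

lemma norm_sq_eq_integral_of_ae_eq {E : Type*} [NormedAddCommGroup E] [InnerProductSpace ℝ E]
    {Ω : Opens R3} {f : R3 → E} (hfs : tsupport f ⊆ Ω)
    {u : Lp E 2 (volume.restrict (Ω : Set R3))} (hu : u =ᵐ[volume.restrict (Ω : Set R3)] f) :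
    ‖u‖ ^ 2 = ∫ x, ‖f x‖ ^ 2 := by
  rw [← real_inner_self_eq_norm_sq, L2.inner_def,
    ← setIntegral_eq_integral_of_forall_compl_eq_zero (s := (Ω : Set R3)) (f := fun x => ‖f x‖ ^ 2)]
  · refine integral_congr_ae ?_
    filter_upwards [hu] with x h
    rw [h, real_inner_self_eq_norm_sq]
  · intro x hx
    rw [image_eq_zero_of_notMem_tsupport fun h => hx (hfs h)]
    simp

lemma TestFunction.isTest {Ω : Opens R3} {F : Type*} [NormedAddCommGroup F] [NormedSpace ℝ F]
    (φ : 𝓓(Ω, F)) : IsTest (F := F) φ := ⟨φ.contDiff, φ.hasCompactSupport⟩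

/-- A closed property that holds for test functions holds on `H¹₀(Ω)`. -/
lemma sobolevH10_induction {Ω : Opens R3}
    {P : Lp ℝ 2 (volume.restrict (Ω : Set R3)) × Lp R3 2 (volume.restrict (Ω : Set R3)) → Prop}
    (hP : IsClosed {p | P p})
    (h : ∀ f : R3 → ℝ, IsTest f → tsupport f ⊆ Ω → ∀ p : Lp ℝ 2 (volume.restrict (Ω : Set R3)) ×
      Lp R3 2 (volume.restrict (Ω : Set R3)), p.1 =ᵐ[volume.restrict (Ω : Set R3)] f →
      p.2 =ᵐ[volume.restrict (Ω : Set R3)] gradient f → P p) :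
    ∀ p ∈ sobolevH10 Ω, P p := by
  refine fun p hp => closure_minimal (fun q hq => ?_) hP hp
  obtain ⟨φ, h1, h2⟩ := hq
  exact h φ φ.isTest φ.tsupport_subset q h1 h2

lemma tsupport_gradient_subset (f : R3 → ℝ) : tsupport (gradient f) ⊆ tsupport f := by
  refine closure_minimal (fun x hx => ?_) (isClosed_tsupport f)
  by_contra h
  have : fderiv ℝ f x = 0 := by
    by_contra h'
    exact h (support_fderiv_subset ℝ h')
  exact hx (by simp [gradient, this])

/-- `S` and `C` do not depend on the function and both sides are continuous, so the inequality
survives the closure defining `H¹₀`. It is the compactness hypothesis of `exists_min_rayleigh`. -/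
lemma rellich_sobolevH10 {Ω : Opens R3} (hb : Bornology.IsBounded (Ω : Set R3)) {ε : ℝ}
    (hε : 0 < ε) :
    ∃ (S : Finset (Lp ℝ 2 (volume.restrict (Ω : Set R3)))) (C : ℝ), ∀ p ∈ sobolevH10 Ω,
      ‖p.1‖ ^ 2 ≤ ε * (‖p.1‖ ^ 2 + ‖p.2‖ ^ 2) + C * ∑ s ∈ S, inner ℝ s p.1 ^ 2 := by
  obtain ⟨S, C, h⟩ := rellich hb hε
  refine ⟨S, C, sobolevH10_induction (isClosed_le (by fun_prop) (by fun_prop)) ?_⟩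
  intro f hf hfs p h1 h2
  have := h f hf hfs p.1 h1
  rw [norm_sq_eq_integral_of_ae_eq ((tsupport_gradient_subset f).trans hfs) h2]
  rw [norm_sq_eq_integral_of_ae_eq hfs h1] at this ⊢
  simpa using this

lemma poincare_sobolevH10 {Ω : Opens R3} (hb : Bornology.IsBounded (Ω : Set R3)) :
    ∀ p ∈ sobolevH10 Ω, ‖p.1‖ ^ 2 ≤ 4 * Metric.diam (Ω : Set R3) ^ 2 * ‖p.2‖ ^ 2 := by
  refine sobolevH10_induction (isClosed_le (by fun_prop) (by fun_prop)) ?_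
  intro f hf hfs p h1 h2
  rw [norm_sq_eq_integral_of_ae_eq ((tsupport_gradient_subset f).trans hfs) h2,
    norm_sq_eq_integral_of_ae_eq hfs h1]
  simpa using poincare hf hfs hb

/-- The set `sobolevH10 Ω` as a subspace. -/
noncomputable def sobolevH10Submodule (Ω : Opens R3) :
    Submodule ℝ (Lp ℝ 2 (volume.restrict (Ω : Set R3)) × Lp R3 2 (volume.restrict (Ω : Set R3))) :=
  Submodule.topologicalClosure
    { carrier := {p | ∃ φ : 𝓓(Ω, ℝ), p.1 =ᵐ[volume.restrict (Ω : Set R3)] (fun x => φ x) ∧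
        p.2 =ᵐ[volume.restrict (Ω : Set R3)] (fun x => gradient φ x)}
      add_mem' := by
        rintro p q ⟨φ, h1, h2⟩ ⟨ψ, h3, h4⟩
        refine ⟨φ + ψ, ?_, ?_⟩
        · filter_upwards [h1, h3, Lp.coeFn_add p.1 q.1] with x e1 e3 e
          rw [Prod.fst_add, e, Pi.add_apply, e1, e3]; rfl
        · filter_upwards [h2, h4, Lp.coeFn_add p.2 q.2] with x e1 e3 e
          rw [Prod.snd_add, e, Pi.add_apply, e1, e3]
          change _ = gradient (fun y => φ y + ψ y) x
          rw [gradient, gradient, gradient, fderiv_fun_add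
            (φ.isTest.smooth.differentiable_infty x) (ψ.isTest.smooth.differentiable_infty x),
            map_add]
      zero_mem' := by
        refine ⟨0, ?_, ?_⟩
        · filter_upwards [Lp.coeFn_zero ℝ 2 (volume.restrict (Ω : Set R3))] with x e
          rw [Prod.fst_zero, e]; rfl
        · filter_upwards [Lp.coeFn_zero R3 2 (volume.restrict (Ω : Set R3))] with x e
          rw [Prod.snd_zero, e]
          change _ = gradient (fun y => (0 : ℝ)) x
          simp [gradient]
      smul_mem' := by
        rintro c p ⟨φ, h1, h2⟩
        refine ⟨c • φ, ?_, ?_⟩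
        · filter_upwards [h1, Lp.coeFn_smul c p.1] with x e1 e
          rw [Prod.smul_fst, e, Pi.smul_apply, e1]; rfl
        · filter_upwards [h2, Lp.coeFn_smul c p.2] with x e1 e
          rw [Prod.smul_snd, e, Pi.smul_apply, e1]
          change _ = gradient (fun y => c • φ y) x
          rw [gradient, gradient, fderiv_fun_const_smul
            (φ.isTest.smooth.differentiable_infty x) c, map_smul] }

lemma mem_sobolevH10_of_test {Ω : Opens R3} {f : R3 → ℝ} (hf : IsTest f) (hfs : tsupport f ⊆ Ω) :
    ((hf.memLp 2 (volume.restrict (Ω : Set R3))).toLp,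
      (hf.gradient.memLp 2 (volume.restrict (Ω : Set R3))).toLp) ∈ sobolevH10 Ω :=
  subset_closure ⟨⟨f, hf.smooth, hf.compact, hfs⟩, (hf.memLp 2 _).coeFn_toLp,
    (hf.gradient.memLp 2 _).coeFn_toLp⟩

lemma exists_isTest_ne_zero {Ω : Opens R3} (hne : (Ω : Set R3).Nonempty) :
    ∃ f : R3 → ℝ, IsTest f ∧ tsupport f ⊆ Ω ∧ 0 < ∫ x, ‖f x‖ ^ 2 := by
  obtain ⟨a, ha⟩ := hne
  obtain ⟨f, hfs, hfc, hf, -, hfa⟩ := exists_contDiff_tsupport_subset (n := ⊤) (x := a)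
    (Ω.2.mem_nhds ha)
  have ht : IsTest f := ⟨hf, hfc⟩
  refine ⟨f, ht, hfs, ?_⟩
  refine (Continuous.integral_pos_of_hasCompactSupport_nonneg_nonzero (x := a) (by
    have := hf.continuous; fun_prop) ?_ (fun x => by positivity) (by simp [hfa]))
  exact (ht.mul ht).compact.mono' (by
    refine (fun x hx => subset_tsupport _ ?_)
    simpa using hx)

/-- The first Dirichlet eigenvalue: the Rayleigh bound and a lower bound by the diameter. -/
lemma firstDirichletEigenvalue_spec {Ω : Opens R3} (hb : Bornology.IsBounded (Ω : Set R3))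
    (hne : (Ω : Set R3).Nonempty) :
    (∀ p ∈ sobolevH10 Ω, firstDirichletEigenvalue Ω * ‖p.1‖ ^ 2 ≤ ‖p.2‖ ^ 2) ∧
      1 ≤ firstDirichletEigenvalue Ω * (4 * Metric.diam (Ω : Set R3) ^ 2) := by
  have h0 : ∃ p ∈ sobolevH10Submodule Ω, p.1 ≠ 0 := by
    obtain ⟨f, hf, hfs, hpos⟩ := exists_isTest_ne_zero hne
    refine ⟨_, mem_sobolevH10_of_test hf hfs, fun h1 => ?_⟩
    rw [← norm_sq_eq_integral_of_ae_eq hfs (hf.memLp 2 _).coeFn_toLp] at hpos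
    simp only at h1
    rw [h1] at hpos
    simp at hpos
  obtain ⟨l, hl, u, hu, hu0, hul⟩ := exists_min_rayleigh (sobolevH10Submodule Ω)
    (Submodule.isClosed_topologicalClosure _) (fun ε hε => rellich_sobolevH10 hb hε) h0
  -- An eigenvalue is the Rayleigh quotient of its own eigenfunction, so it is at least the minimum
  -- `l` and is bounded below by Poincaré's inequality.
  have hlow : ∀ l', IsDirichletEigenvalue Ω l' → l ≤ l' ∧
      1 ≤ l' * (4 * Metric.diam (Ω : Set R3) ^ 2) := by
    rintro l' ⟨v, hv, hv0, hvl⟩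
    have h1 := hvl v hv
    rw [real_inner_self_eq_norm_sq, real_inner_self_eq_norm_sq] at h1
    have hvp : 0 < ‖v.1‖ ^ 2 := by positivity
    have h2 := hl v hv
    have h3 := poincare_sobolevH10 hb v hv
    rw [h1] at h2 h3
    refine ⟨le_of_mul_le_mul_right h2 hvp, le_of_mul_le_mul_right ?_ hvp⟩
    linarith
  have heig : IsDirichletEigenvalue Ω l := ⟨u, hu, hu0, hul⟩
  have hval : firstDirichletEigenvalue Ω = l :=
    le_antisymm (csInf_le ⟨l, fun l' hl' => (hlow l' hl').1⟩ heig)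
      (le_csInf ⟨_, heig⟩ fun l' hl' => (hlow l' hl').1)
  rw [hval]
  exact ⟨hl, (hlow _ heig).2⟩

/-- The Rayleigh bound for test functions. -/
lemma firstDirichletEigenvalue_mul_le {Ω : Opens R3} (hb : Bornology.IsBounded (Ω : Set R3))
    (hne : (Ω : Set R3).Nonempty) {f : R3 → ℝ} (hf : IsTest f) (hfs : tsupport f ⊆ Ω) :
    firstDirichletEigenvalue Ω * ∫ x, f x ^ 2 ≤ ∫ x, ‖gradient f x‖ ^ 2 := by
  have := (firstDirichletEigenvalue_spec hb hne).1 _ (mem_sobolevH10_of_test hf hfs)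
  simp only at this
  rw [norm_sq_eq_integral_of_ae_eq hfs (hf.memLp 2 _).coeFn_toLp,
    norm_sq_eq_integral_of_ae_eq ((tsupport_gradient_subset f).trans hfs)
      (hf.gradient.memLp 2 _).coeFn_toLp] at this
  simpa using this

/-- `λ₁(Ω) ‖curl ψ‖² ≤ ‖curl curl ψ‖²` for test fields. -/
lemma firstDirichletEigenvalue_mul_curl_le {Ω : Opens R3}
    (hb : Bornology.IsBounded (Ω : Set R3)) (hne : (Ω : Set R3).Nonempty) {f : R3 → R3}
    (hf : IsTest f) (hfs : tsupport f ⊆ Ω) :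
    firstDirichletEigenvalue Ω * ∫ x, ‖curl f x‖ ^ 2 ≤ ∫ x, ‖curl (curl f) x‖ ^ 2 := by
  rw [← sum_integral_pd_sq_curl hf]
  have hc : IsTest (curl f) := hf.curl
  -- Each Cartesian component of `curl f` is itself a test function in `Ω`. Summed over `j`, the
  -- right-hand sides form the Dirichlet integral already rewritten as `‖curl curl f‖²`.
  have h (j : Fin 3) : firstDirichletEigenvalue Ω * ∫ x, (curl f x j) ^ 2 ≤
      ∑ i, ∫ x, pd i (fun y => curl f y j) x ^ 2 := by
    have := firstDirichletEigenvalue_mul_le hb hne (hc.coord j)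
      ((tsupport_coord_subset _ j).trans ((tsupport_curl_subset f).trans hfs))
    rwa [(hc.coord j).integral_norm_sq_gradient, ← Fin.sum_univ_three
      (fun i => ∫ x, pd i (fun y => curl f y j) x ^ 2)] at this
  have e : ∫ x, ‖curl f x‖ ^ 2 = ∑ j, ∫ x, (curl f x j) ^ 2 := by
    simp_rw [norm_sq_eq_sum]
    rw [integral_add_add (hc.coord 0).integrable_sq (hc.coord 1).integrable_sq
      (hc.coord 2).integrable_sq, Fin.sum_univ_three]
  rw [e, Finset.mul_sum]
  exact Finset.sum_le_sum fun j _ => h j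

end Dirichlet

/-! ### Pushing the complement of a `C²` domain away from its closure -/

section Geometry

/-- Strict differentiability makes `ρ` increase along `v` at a uniform rate near `x₀`. From `ρ y ≥
0` one gets `ρ (y + t v) > 0`, an open condition that excludes even the closure of `Ω`. -/
lemma exists_outward_direction {Ω : Opens R3} (hΩ : HasC2Boundary Ω) {x₀ : R3}
    (hx₀ : x₀ ∈ frontier (Ω : Set R3)) :
    ∃ (v : R3) (r : ℝ), 0 < r ∧ ∀ y ∈ Metric.ball x₀ (2 * r), y ∉ Ω → ∀ t, 0 < t → t < r →
      y + t • v ∉ closure (Ω : Set R3) := by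
  obtain ⟨U, hU, hxU, ρ, hρ, hρ', hUΩ⟩ := hΩ x₀ hx₀
  obtain ⟨v, hv⟩ : ∃ v, 0 < fderiv ℝ ρ x₀ v := by
    obtain ⟨v, hv⟩ : ∃ v, fderiv ℝ ρ x₀ v ≠ 0 := by
      by_contra! h
      exact hρ' (ContinuousLinearMap.ext h)
    rcases lt_or_gt_of_ne hv with h | h
    · exact ⟨-v, by simpa using h⟩
    · exact ⟨v, h⟩
  have hv0 : 0 < ‖v‖ := norm_pos_iff.2 (by rintro rfl; simp at hv)
  -- With this tolerance the linearisation error along `t v` is at most half of the gain `t ρ'(x₀)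
  -- v`.
  set c : ℝ := fderiv ℝ ρ x₀ v / (2 * ‖v‖) with hc
  have hc0 : 0 < c := by positivity
  have hst : HasStrictFDerivAt ρ (fderiv ℝ ρ x₀) x₀ :=
    (hρ.contDiffAt (hU.mem_nhds hxU)).hasStrictFDerivAt (by norm_num)
  have hlo := hst.isLittleO.def hc0
  rw [Filter.eventually_iff, Metric.mem_nhds_iff] at hlo
  obtain ⟨R, hR, hball⟩ := hlo
  obtain ⟨R', hR', hball'⟩ := Metric.isOpen_iff.1 hU x₀ hxU
  set q : ℝ := min R R'
  have hq : 0 < q := lt_min hR hR'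
  -- Then `y` lies within `q/2` of `x₀` and the shift is shorter than `q/4`, so both points stay in
  -- the ball of radius `q` where the estimate holds.
  refine ⟨v, min (q / 4) (q / (4 * ‖v‖)), by positivity, fun y hy hyΩ t ht htr => ?_⟩
  set r := min (q / 4) (q / (4 * ‖v‖))
  have hr1 : r ≤ q / 4 := min_le_left _ _
  have hr2 : r ≤ q / (4 * ‖v‖) := min_le_right _ _
  have htv : t * ‖v‖ < q / 4 := by
    have : t < q / (4 * ‖v‖) := htr.trans_le hr2
    rw [lt_div_iff₀ (by positivity)] at this
    linarith
  have hyd : dist y x₀ < q / 2 := by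
    have := Metric.mem_ball.1 hy
    linarith
  set z := y + t • v with hz
  have hzd : dist z x₀ < q := by
    have h1 : dist z y = t * ‖v‖ := by simp [hz, norm_smul, abs_of_pos ht]
    have := dist_triangle z y x₀
    linarith
  have hyU : y ∈ U := hball' (by
    have : q ≤ R' := min_le_right _ _
    rw [Metric.mem_ball]; linarith)
  have hzU : z ∈ U := hball' (by
    have : q ≤ R' := min_le_right _ _
    rw [Metric.mem_ball]; linarith)
  have hρy : 0 ≤ ρ y := by
    by_contra! h
    exact hyΩ ((hUΩ y hyU).2 h)
  have hρz : 0 < ρ z := by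
    have hmem : ((z, y) : R3 × R3) ∈ Metric.ball (x₀, x₀) R := by
      have : q ≤ R := min_le_left _ _
      rw [Metric.mem_ball, Prod.dist_eq]
      exact max_lt (by simp only; linarith) (by simp only; linarith)
    have h1 := hball hmem
    simp only [Set.mem_ofPred_eq] at h1
    have h2 : z - y = t • v := by simp [hz]
    rw [h2, map_smul, smul_eq_mul, norm_smul, Real.norm_eq_abs, Real.norm_eq_abs,
      abs_of_pos ht] at h1
    have h3 : c * (t * ‖v‖) = t * fderiv ℝ ρ x₀ v / 2 := by
      rw [hc]; field_simp
    rw [h3] at h1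
    have h4 := (abs_le.1 h1).1
    have h5 : 0 < t * fderiv ℝ ρ x₀ v := by positivity
    linarith
  rw [mem_closure_iff_nhds]
  push Not
  have hcont : ContinuousAt ρ z := hρ.continuousOn.continuousAt (hU.mem_nhds hzU)
  refine ⟨{w | 0 < ρ w} ∩ U, Filter.inter_mem (hcont.eventually_const_lt hρz)
    (hU.mem_nhds hzU), ?_⟩
  rw [Set.eq_empty_iff_forall_notMem]
  rintro w ⟨⟨hw1, hw2⟩, hw3⟩
  exact absurd ((hUΩ w hw2).1 hw3) (not_lt.2 (le_of_lt hw1))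

/-- There is a smooth compactly supported vector field along which the complement of a bounded
domain with `C²` boundary is pushed off the closure of the domain. -/
lemma exists_outward_field {Ω : Opens R3} (hb : Bornology.IsBounded (Ω : Set R3))
    (hΩ : HasC2Boundary Ω) :
    ∃ X : R3 → R3, IsTest X ∧ ∃ ε₀ > 0, ∀ ε : ℝ, 0 < ε → ε < ε₀ → ∀ x ∉ Ω,
      x + ε • X x ∉ closure (Ω : Set R3) := by
  classical
  have hK : IsCompact (frontier (Ω : Set R3)) :=
    Metric.isCompact_of_isClosed_isBounded isClosed_frontier
      (hb.closure.subset frontier_subset_closure)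
  choose! v r hr hgood using fun x (hx : x ∈ frontier (Ω : Set R3)) => exists_outward_direction hΩ hx
  obtain ⟨T, hT, hcov⟩ := hK.elim_nhds_subcover (fun x => Metric.ball x (r x))
    fun x hx => Metric.ball_mem_nhds x (hr x hx)
  have hbump : ∀ x : R3, ∃ η : R3 → ℝ, IsTest η ∧ (∀ y, 0 ≤ η y) ∧ (∀ y, η y ≤ 1) ∧
      (x ∈ T → Function.support η = Metric.ball x (r x)) := by
    intro x
    by_cases hx : x ∈ T
    · have hrx := hr x (hT x hx)
      let f : ContDiffBump x := ⟨r x / 2, r x, half_pos hrx, half_lt_self hrx⟩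
      exact ⟨f, ⟨f.contDiff, f.hasCompactSupport⟩, fun y => f.nonneg, fun y => f.le_one,
        fun _ => f.support_eq⟩
    · exact ⟨fun _ => 0, ⟨contDiff_const, HasCompactSupport.zero⟩, fun _ => le_rfl,
        fun _ => zero_le_one, fun h => absurd h hx⟩
  choose η hη hη0 hη1 hηs using hbump
  set M : ℝ := ∑ x ∈ T, ‖v x‖ with hM
  have hM0 : 0 ≤ M := Finset.sum_nonneg fun _ _ => norm_nonneg _
  -- `ε M` bounds every partial displacement and `ε` bounds every single time step; both have to
  -- stay below all radii `r x`.
  obtain ⟨ε₀, hε₀, hε₀r⟩ : ∃ ε₀ > 0, ∀ x ∈ T, ε₀ * (M + 1) ≤ r x := by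
    have : ∀ S ⊆ T, ∃ ε₀ > 0, ∀ x ∈ S, ε₀ * (M + 1) ≤ r x := by
      intro S
      induction S using Finset.induction_on with
      | empty => exact fun _ => ⟨1, one_pos, by simp⟩
      | insert a S ha ih =>
        intro hS
        obtain ⟨e, he, h⟩ := ih ((Finset.subset_insert _ _).trans hS)
        have hra := hr a (hT a (hS (Finset.mem_insert_self _ _)))
        refine ⟨min e (r a / (M + 1)), by positivity, fun x hx => ?_⟩
        rcases Finset.mem_insert.1 hx with rfl | hx
        · calc _ ≤ r x / (M + 1) * (M + 1) := by gcongr; exact min_le_right _ _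
            _ = r x := by field_simp
        · exact le_trans (by gcongr; exact min_le_left _ _) (h x hx)
    exact this T subset_rfl
  have hXsum (S : Finset R3) : IsTest (fun y => ∑ x ∈ S, η x y • v x) := by
    induction S using Finset.induction_on with
    | empty => simpa using (⟨contDiff_const, HasCompactSupport.zero⟩ : IsTest fun _ : R3 => (0 : R3))
    | insert a S ha ih =>
      simp only [Finset.sum_insert ha]
      exact ⟨((hη a).smooth.smul contDiff_const).add ih.smooth,
        (hη a).compact.smul_right.add ih.compact⟩
  refine ⟨fun y => ∑ x ∈ T, η x y • v x, hXsum T, ε₀, hε₀, fun ε hε hεε y hy => ?_⟩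
  have hεr : ∀ x ∈ T, ε * M < r x ∧ ε < r x := fun x hx => by
    have h1 := hε₀r x hx
    constructor <;> nlinarith
  -- The displacement is performed one summand at a time. A partial sum leaves the point outside `Ω`
  -- and moves it by less than `r a`, hence within `2 r a` of `a` if the bump at `a` is active; that
  -- summand then pushes it off the closure. Inactive bumps change nothing.
  have key : ∀ S ⊆ T, y + ε • ∑ x ∈ S, η x y • v x ∉ Ω ∧
      ((∃ x ∈ S, η x y ≠ 0) → y + ε • ∑ x ∈ S, η x y • v x ∉ closure (Ω : Set R3)) := by
    intro S
    induction S using Finset.induction_on with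
    | empty => simpa using hy
    | insert a S ha ih =>
      intro hS
      have hST : S ⊆ T := (Finset.subset_insert _ _).trans hS
      obtain ⟨ih1, ih2⟩ := ih hST
      by_cases h0 : η a y = 0
      · simp only [Finset.sum_insert ha, h0, zero_smul, zero_add]
        refine ⟨ih1, fun ⟨x, hx, hx0⟩ => ih2 ⟨x, ?_, hx0⟩⟩
        rcases Finset.mem_insert.1 hx with rfl | hx
        · exact absurd h0 hx0
        · exact hx
      · have haT : a ∈ T := hS (Finset.mem_insert_self _ _)
        set z := y + ε • ∑ x ∈ S, η x y • v x with hz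
        have e : y + ε • ∑ x ∈ insert a S, η x y • v x = z + (ε * η a y) • v a := by
          rw [Finset.sum_insert ha, hz, smul_add, smul_smul]; abel
        have hya : dist y a < r a := by
          have : y ∈ Function.support (η a) := h0
          rwa [hηs a haT] at this
        have hzy : dist z y ≤ ε * M := by
          rw [hz, dist_eq_norm, add_sub_cancel_left, norm_smul, Real.norm_eq_abs, abs_of_pos hε]
          gcongr
          refine (norm_sum_le _ _).trans ((Finset.sum_le_sum fun x _ => ?_).trans
            (Finset.sum_le_sum_of_subset_of_nonneg hST fun _ _ _ => norm_nonneg _))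
          rw [norm_smul, Real.norm_eq_abs, abs_of_nonneg (hη0 x y)]
          exact mul_le_of_le_one_left (norm_nonneg _) (hη1 x y)
        have hza : z ∈ Metric.ball a (2 * r a) := by
          rw [Metric.mem_ball]
          have := dist_triangle z y a
          linarith [(hεr a haT).1]
        have hpos : 0 < η a y := lt_of_le_of_ne (hη0 a y) (Ne.symm h0)
        have hlt : ε * η a y < r a :=
          lt_of_le_of_lt (mul_le_of_le_one_right hε.le (hη1 a y)) (hεr a haT).2
        have hcl := hgood a (hT a haT) z hza ih1 (ε * η a y) (by positivity) hlt
        rw [e]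
        exact ⟨fun h => hcl (subset_closure h), fun _ => hcl⟩
  by_cases hex : ∃ x ∈ T, η x y ≠ 0
  · exact (key T subset_rfl).2 hex
  -- With no active bump the point does not move. It cannot lie in the closure of `Ω`, since it
  -- would then be a boundary point and the bumps cover the boundary.
  · push Not at hex
    have h0 : ∑ x ∈ T, η x y • v x = 0 := Finset.sum_eq_zero fun x hx => by rw [hex x hx, zero_smul]
    simp only [h0, smul_zero, add_zero]
    intro hcl
    have hfr : y ∈ frontier (Ω : Set R3) := ⟨hcl, by rwa [Ω.isOpen.interior_eq]⟩
    obtain ⟨x, hx, hyx⟩ := Set.mem_iUnion₂.1 (hcov hfr)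
    rw [← hηs x hx] at hyx
    exact hyx (hex x hx)

/-- Small perturbations of the identity expand distances by a factor at least `1/2`. -/
lemma antilipschitz_id_add {X : R3 → R3} {L : NNReal} (hX : LipschitzWith L X) {ε : ℝ} (hε : 0 ≤ ε)
    (hεL : ε * L ≤ 1 / 2) : AntilipschitzWith 2 (fun x => x + ε • X x) := by
  refine AntilipschitzWith.of_le_mul_dist fun x y => ?_
  have h1 : ‖ε • (X x - X y)‖ ≤ 1 / 2 * ‖x - y‖ := by
    rw [norm_smul, Real.norm_eq_abs, abs_of_nonneg hε]
    have := hX.dist_le_mul x y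
    rw [dist_eq_norm, dist_eq_norm] at this
    calc ε * ‖X x - X y‖ ≤ ε * (L * ‖x - y‖) := by gcongr
      _ = ε * L * ‖x - y‖ := by ring
      _ ≤ _ := by gcongr
  rw [dist_eq_norm, dist_eq_norm]
  have h2 : x - y = (x + ε • X x - (y + ε • X y)) - ε • (X x - X y) := by
    rw [smul_sub]; abel
  have h3 := norm_sub_le (x + ε • X x - (y + ε • X y)) (ε • (X x - X y))
  rw [← h2] at h3
  simp only [NNReal.coe_ofNat]
  linarith

/-- Lebesgue measure is a multiple of the three-dimensional Hausdorff measure, for which preimages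
grow by at most `2³ = 8`. No Jacobian is needed. -/
lemma volume_preimage_le {Φ : R3 → R3} (hΦ : AntilipschitzWith 2 Φ) (s : Set R3) :
    volume (Φ ⁻¹' s) ≤ 8 * volume s := by
  have hfr : Module.finrank ℝ R3 = 3 := by simp
  have : (Measure.hausdorffMeasure (3 : ℝ) : Measure R3).IsAddHaarMeasure := by
    have := isAddHaarMeasure_hausdorffMeasure (E := R3)
    rwa [hfr] at this
  have he := Measure.isAddLeftInvariant_eq_smul (volume : Measure R3)
    (Measure.hausdorffMeasure (3 : ℝ))
  have h := hΦ.hausdorffMeasure_preimage_le (d := 3) (by norm_num) s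
  rw [he, Measure.smul_apply, Measure.smul_apply, mul_smul_comm]
  refine smul_le_smul_of_nonneg_left (h.trans_eq ?_) zero_le
  norm_num

/-- The image of Lebesgue measure is at most `8` times Lebesgue measure. The resulting factor
`8^(1/2)` is rounded up to `8`. -/
lemma eLpNorm_comp_le {Φ : R3 → R3} (hΦ : AntilipschitzWith 2 Φ) (hc : Continuous Φ)
    {E : Type*} [NormedAddCommGroup E] {f : R3 → E} (hf : Continuous f) :
    eLpNorm (fun x => f (Φ x)) 2 volume ≤ 8 * eLpNorm f 2 volume := by
  have hmap : (volume : Measure R3).map Φ ≤ (8 : ENNReal) • volume := by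
    refine Measure.le_iff.2 fun s hs => ?_
    rw [Measure.map_apply hc.measurable hs]
    exact volume_preimage_le hΦ s
  have h1 : eLpNorm (fun x => f (Φ x)) 2 volume = eLpNorm f 2 (volume.map Φ) :=
    (eLpNorm_map_measure hf.aestronglyMeasurable hc.aemeasurable).symm
  rw [h1]
  refine (eLpNorm_mono_measure f hmap).trans ?_
  rw [eLpNorm_smul_measure_of_ne_zero (by norm_num), smul_eq_mul]
  gcongr
  calc (8 : ENNReal) ^ (1 / (2 : ENNReal)).toReal ≤ 8 ^ (1 : ℝ) :=
        ENNReal.rpow_le_rpow_of_exponent_le (by norm_num) (by norm_num)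
    _ = 8 := by simp

/-- If `Φ` maps the complement of `Ω` off the closure of `Ω`, then it maps it off a neighbourhood
of the closure. -/
lemma exists_thickening_preimage_subset {Ω : Opens R3} (hb : Bornology.IsBounded (Ω : Set R3))
    {Φ : R3 → R3} (hΦ : AntilipschitzWith 2 Φ) (hc : UniformContinuous Φ)
    (hmap : ∀ x ∉ Ω, Φ x ∉ closure (Ω : Set R3)) :
    ∃ δ > 0, Φ ⁻¹' (Metric.cthickening δ (closure (Ω : Set R3))) ⊆ Ω ∧
      IsCompact (Φ ⁻¹' (Metric.cthickening δ (closure (Ω : Set R3)))) := by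
  have hK : IsCompact (closure (Ω : Set R3)) :=
    Metric.isCompact_of_isClosed_isBounded isClosed_closure hb.closure
  -- The map is a closed embedding, so the image of the complement is closed; being disjoint from
  -- the compact closure of `Ω`, it has positive distance from it.
  have hcl : IsClosed (Φ '' (Ω : Set R3)ᶜ) :=
    (hΦ.isClosedEmbedding hc).isClosedMap _ Ω.isOpen.isClosed_compl
  obtain ⟨δ, hδ, hsub⟩ := hK.exists_cthickening_subset_open hcl.isOpen_compl (by
    rintro z hz ⟨x, hx, rfl⟩
    exact hmap x hx hz)
  refine ⟨δ, hδ, fun x hx => ?_, ?_⟩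
  · by_contra h
    exact hsub hx ⟨x, h, rfl⟩
  · exact Metric.isCompact_of_isClosed_isBounded (Metric.isClosed_cthickening.preimage hc.continuous)
      (hΦ.isBounded_preimage hb.closure.cthickening)

end Geometry

/-! ### Pullback of vector fields as differential forms -/

section Pullback

lemma curl_apply {f : R3 → R3} (hf : ContDiff ℝ ∞ f) (x : R3) (i : Fin 3) :
    curl f x i = pd (i + 1) (fun y => f y (i + 2)) x - pd (i + 2) (fun y => f y (i + 1)) x := by
  fin_cases i
  · exact IsTest.curl_zero hf x
  · exact IsTest.curl_one hf x
  · exact IsTest.curl_two hf x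

lemma norm_le_sum_abs (v : R3) : ‖v‖ ≤ ∑ j, |v j| := by
  rw [← sq_le_sq₀ (norm_nonneg _) (Finset.sum_nonneg fun _ _ => abs_nonneg _), norm_sq_eq_sum,
    Fin.sum_univ_three, ← sq_abs (v 0), ← sq_abs (v 1), ← sq_abs (v 2)]
  nlinarith [mul_nonneg (abs_nonneg (v 0)) (abs_nonneg (v 1)),
    mul_nonneg (abs_nonneg (v 0)) (abs_nonneg (v 2)),
    mul_nonneg (abs_nonneg (v 1)) (abs_nonneg (v 2))]

lemma abs_coord_le (v : R3) (j : Fin 3) : |v j| ≤ ‖v‖ := PiLp.norm_apply_le v j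

lemma sum_abs_le_norm (v : R3) : ∑ j, |v j| ≤ 3 * ‖v‖ := by
  have := abs_coord_le v
  rw [Fin.sum_univ_three]
  linarith [this 0, this 1, this 2]

lemma pd_comp {g : R3 → ℝ} {Φ : R3 → R3} (hg : Differentiable ℝ g) (hΦ : Differentiable ℝ Φ)
    (i : Fin 3) (x : R3) :
    pd i (fun y => g (Φ y)) x = ∑ m, pd i (fun y => Φ y m) x * pd m g (Φ x) := by
  have h : fderiv ℝ (fun y => g (Φ y)) x = (fderiv ℝ g (Φ x)) ∘L (fderiv ℝ Φ x) :=
    ((hg (Φ x)).hasFDerivAt.comp x (hΦ x).hasFDerivAt).fderiv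
  rw [pd, h, ContinuousLinearMap.comp_apply, fderiv_eq_sum_pd]
  simp_rw [fderiv_apply_coord (hΦ x)]
  rfl

lemma pd_sum {ι : Type*} {s : Finset ι} {f : ι → R3 → ℝ} (hf : ∀ l ∈ s, Differentiable ℝ (f l))
    (i : Fin 3) (x : R3) : pd i (fun y => ∑ l ∈ s, f l y) x = ∑ l ∈ s, pd i (f l) x := by
  rw [pd, fderiv_fun_sum fun l hl => hf l hl x]
  simp [pd]

/-- The pullback of `φ` by `Φ`, with vector fields regarded as `1`-forms. -/
noncomputable def pullback (Φ φ : R3 → R3) (x : R3) : R3 :=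
  WithLp.toLp 2 fun j => ∑ l, pd j (fun y => Φ y l) x * φ (Φ x) l

lemma pullback_apply (Φ φ : R3 → R3) (x : R3) (j : Fin 3) :
    pullback Φ φ x j = ∑ l, pd j (fun y => Φ y l) x * φ (Φ x) l := rfl

lemma pullback_sub (Φ φ χ : R3 → R3) :
    pullback Φ (fun x => φ x - χ x) = fun x => pullback Φ φ x - pullback Φ χ x := by
  ext x j
  simp [pullback_apply, mul_sub, Finset.sum_sub_distrib]

lemma ContDiff.pullback {Φ φ : R3 → R3} (hΦ : ContDiff ℝ ∞ Φ) (hφ : ContDiff ℝ ∞ φ) :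
    ContDiff ℝ ∞ (pullback Φ φ) := by
  refine contDiff_of_coord fun j => ?_
  simp only [pullback_apply]
  refine ContDiff.sum fun l _ => ?_
  exact ((hΦ.coord l).pd j).mul ((hφ.coord l).comp hΦ)

lemma support_pullback_subset (Φ φ : R3 → R3) :
    Function.support (pullback Φ φ) ⊆ Φ ⁻¹' (Function.support φ) := by
  intro x hx
  contrapose! hx
  have h : φ (Φ x) = 0 := by simpa using hx
  have : pullback Φ φ x = 0 := by
    ext j
    simp [pullback_apply, h]
  simpa using this

/-- The cofactors of the Jacobian matrix. -/
noncomputable def cofactor (Φ : R3 → R3) (i a : Fin 3) (x : R3) : ℝ :=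
  pd (i + 1) (fun y => Φ y (a + 1)) x * pd (i + 2) (fun y => Φ y (a + 2)) x -
    pd (i + 1) (fun y => Φ y (a + 2)) x * pd (i + 2) (fun y => Φ y (a + 1)) x

/-- The term with second derivatives of `Φ` is symmetric in `i` and `j`, so it cancels when the curl
antisymmetrises. -/
lemma pd_pullback {Φ φ : R3 → R3} (hΦ : ContDiff ℝ ∞ Φ) (hφ : ContDiff ℝ ∞ φ) (i j : Fin 3)
    (x : R3) : pd i (fun y => pullback Φ φ y j) x =
      ∑ l, (pd i (pd j (fun y => Φ y l)) x * φ (Φ x) l + pd j (fun y => Φ y l) x *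
        ∑ m, pd i (fun y => Φ y m) x * pd m (fun y => φ y l) (Φ x)) := by
  have hP (l : Fin 3) : Differentiable ℝ (pd j (fun y => Φ y l)) :=
    ((hΦ.coord l).pd j).differentiable_infty
  have hQ (l : Fin 3) : Differentiable ℝ (fun y => φ (Φ y) l) :=
    ((hφ.coord l).comp hΦ).differentiable_infty
  simp only [pullback_apply]
  rw [pd_sum (f := fun l y => pd j (fun z => Φ z l) y * φ (Φ y) l) fun l _ => (hP l).mul (hQ l)]
  refine Finset.sum_congr rfl fun l _ => ?_
  rw [pd_mul (hP l) (hQ l)]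
  dsimp only
  rw [pd_comp (g := fun y => φ y l) (hφ.coord l).differentiable_infty
    hΦ.differentiable_infty]

/-- The curl of a pullback is the cofactor matrix applied to the curl. -/
lemma curl_pullback {Φ φ : R3 → R3} (hΦ : ContDiff ℝ ∞ Φ) (hφ : ContDiff ℝ ∞ φ) (x : R3)
    (i : Fin 3) : curl (pullback Φ φ) x i = ∑ a, cofactor Φ i a x * curl φ (Φ x) a := by
  rw [curl_apply (hΦ.pullback hφ), pd_pullback hΦ hφ, pd_pullback hΦ hφ]
  simp only [pd_comm (hΦ.coord _) (i + 2) (i + 1), curl_apply hφ, cofactor, Fin.sum_univ_three]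
  simp only [Fin.isValue, zero_add, show (1 : Fin 3) + 1 = 2 from rfl, show (1 : Fin 3) + 2 = 0 from rfl,
    show (2 : Fin 3) + 1 = 0 from rfl, show (2 : Fin 3) + 2 = 1 from rfl]
  ring

lemma pd_curl_pullback {Φ φ : R3 → R3} (hΦ : ContDiff ℝ ∞ Φ) (hφ : ContDiff ℝ ∞ φ) (k i : Fin 3)
    (x : R3) : pd k (fun y => curl (pullback Φ φ) y i) x =
      ∑ a, (pd k (cofactor Φ i a) x * curl φ (Φ x) a + cofactor Φ i a x *
        ∑ m, pd k (fun y => Φ y m) x * pd m (fun y => curl φ y a) (Φ x)) := by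
  have hP (a : Fin 3) : Differentiable ℝ (cofactor Φ i a) :=
    ((((hΦ.coord _).pd _).mul ((hΦ.coord _).pd _)).sub
      (((hΦ.coord _).pd _).mul ((hΦ.coord _).pd _))).differentiable_infty
  have hQ (l : Fin 3) : Differentiable ℝ (fun y => curl φ (Φ y) l) :=
    ((hφ.curl.coord l).comp hΦ).differentiable_infty
  simp only [curl_pullback hΦ hφ]
  rw [pd_sum (f := fun a y => cofactor Φ i a y * curl φ (Φ y) a) fun l _ => (hP l).mul (hQ l)]
  refine Finset.sum_congr rfl fun a _ => ?_
  rw [pd_mul (hP a) (hQ a)]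
  dsimp only
  rw [pd_comp (g := fun y => curl φ y a)
    (hφ.curl.coord a).differentiable_infty hΦ.differentiable_infty]

/-- `Φ` is a smooth map with `|Φ x - Φ y| ≥ |x - y| / 2` and first and second partial derivatives
bounded by `B`. -/
structure TameMap (B : ℝ) (Φ : R3 → R3) : Prop where
  smooth : ContDiff ℝ ∞ Φ
  antilipschitz : AntilipschitzWith 2 Φ
  pd_le : ∀ i j x, |pd i (fun y => Φ y j) x| ≤ B
  pd_pd_le : ∀ i j k x, |pd i (pd j (fun y => Φ y k)) x| ≤ B

lemma TameMap.nonneg {B : ℝ} {Φ : R3 → R3} (h : TameMap B Φ) : 0 ≤ B :=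
  (abs_nonneg _).trans (h.pd_le 0 0 0)

lemma TameMap.cofactor_le {B : ℝ} {Φ : R3 → R3} (h : TameMap B Φ) (i a : Fin 3) (x : R3) :
    |cofactor Φ i a x| ≤ 2 * B ^ 2 := by
  have key (i j k l : Fin 3) : |pd i (fun y => Φ y j) x * pd k (fun y => Φ y l) x| ≤ B ^ 2 := by
    rw [abs_mul, pow_two]
    exact mul_le_mul (h.pd_le _ _ _) (h.pd_le _ _ _) (abs_nonneg _) h.nonneg
  refine (abs_sub _ _).trans ?_
  linarith [key (i + 1) (a + 1) (i + 2) (a + 2), key (i + 1) (a + 2) (i + 2) (a + 1)]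

lemma TameMap.pd_cofactor_le {B : ℝ} {Φ : R3 → R3} (h : TameMap B Φ) (k i a : Fin 3) (x : R3) :
    |pd k (cofactor Φ i a) x| ≤ 4 * B ^ 2 := by
  have hd (i j : Fin 3) : Differentiable ℝ (pd i (fun y => Φ y j)) :=
    ((h.smooth.coord j).pd i).differentiable_infty
  have key (i j i' j' : Fin 3) :
      |pd k (pd i (fun y => Φ y j)) x * pd i' (fun y => Φ y j') x| ≤ B ^ 2 := by
    rw [abs_mul, pow_two]
    exact mul_le_mul (h.pd_pd_le _ _ _ _) (h.pd_le _ _ _) (abs_nonneg _) h.nonneg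
  have e : pd k (cofactor Φ i a) x = _ :=
    congrFun (pd_sub (((hd (i + 1) (a + 1)).mul (hd (i + 2) (a + 2))))
      ((hd (i + 1) (a + 2)).mul (hd (i + 2) (a + 1))) k) x
  simp only [Pi.mul_def] at e
  rw [e, pd_mul (hd _ _) (hd _ _), pd_mul (hd _ _) (hd _ _)]
  have k1 := abs_le.1 (key (i + 1) (a + 1) (i + 2) (a + 2))
  have k2 := abs_le.1 (key (i + 2) (a + 2) (i + 1) (a + 1))
  have k3 := abs_le.1 (key (i + 1) (a + 2) (i + 2) (a + 1))
  have k4 := abs_le.1 (key (i + 2) (a + 1) (i + 1) (a + 2))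
  rw [abs_le]
  constructor <;> linarith

lemma TameMap.norm_pullback_le {B : ℝ} {Φ : R3 → R3} (h : TameMap B Φ) (φ : R3 → R3) (x : R3) :
    ‖pullback Φ φ x‖ ≤ 9 * B * ‖φ (Φ x)‖ := by
  refine (norm_le_sum_abs _).trans ?_
  have key (j : Fin 3) : |pullback Φ φ x j| ≤ B * (3 * ‖φ (Φ x)‖) := by
    rw [pullback_apply]
    refine (Finset.abs_sum_le_sum_abs _ _).trans ?_
    calc _ ≤ ∑ l, B * |φ (Φ x) l| := Finset.sum_le_sum fun l _ => by
            rw [abs_mul]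
            exact mul_le_mul_of_nonneg_right (h.pd_le _ _ _) (abs_nonneg _)
      _ ≤ _ := by
        rw [← Finset.mul_sum]
        exact mul_le_mul_of_nonneg_left (sum_abs_le_norm _) h.nonneg
  rw [Fin.sum_univ_three]
  linarith [key 0, key 1, key 2]

lemma TameMap.norm_curl_pullback_le {B : ℝ} {Φ : R3 → R3} (h : TameMap B Φ) {φ : R3 → R3}
    (hφ : ContDiff ℝ ∞ φ) (x : R3) :
    ‖curl (pullback Φ φ) x‖ ≤ 18 * B ^ 2 * ‖curl φ (Φ x)‖ := by
  refine (norm_le_sum_abs _).trans ?_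
  have key (j : Fin 3) : |curl (pullback Φ φ) x j| ≤ 2 * B ^ 2 * (3 * ‖curl φ (Φ x)‖) := by
    rw [curl_pullback h.smooth hφ]
    refine (Finset.abs_sum_le_sum_abs _ _).trans ?_
    calc _ ≤ ∑ l, 2 * B ^ 2 * |curl φ (Φ x) l| := Finset.sum_le_sum fun l _ => by
            rw [abs_mul]
            exact mul_le_mul_of_nonneg_right (h.cofactor_le _ _ _) (abs_nonneg _)
      _ ≤ _ := by
        rw [← Finset.mul_sum]
        exact mul_le_mul_of_nonneg_left (sum_abs_le_norm _) (by positivity)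
  rw [Fin.sum_univ_three]
  linarith [key 0, key 1, key 2]

/-- In the cofactor formula a derivative falls either on a cofactor, leaving `curl φ`, or on `curl
φ`. The second kind produces all first derivatives of `curl φ`, which `curl curl φ` does not control
pointwise; they are handled later in `L²`. -/
lemma TameMap.norm_curl_curl_pullback_le {B : ℝ} {Φ : R3 → R3} (h : TameMap B Φ) {φ : R3 → R3}
    (hφ : ContDiff ℝ ∞ φ) (x : R3) :
    ‖curl (curl (pullback Φ φ)) x‖ ≤ 72 * B ^ 2 * ‖curl φ (Φ x)‖ +
      12 * B ^ 3 * ∑ a, ∑ m, |pd m (fun y => curl φ y a) (Φ x)| := by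
  refine (norm_le_sum_abs _).trans ?_
  set D := ∑ a, ∑ m, |pd m (fun y => curl φ y a) (Φ x)|
  have key (k i : Fin 3) : |pd k (fun y => curl (pullback Φ φ) y i) x| ≤
      12 * B ^ 2 * ‖curl φ (Φ x)‖ + 2 * B ^ 3 * D := by
    rw [pd_curl_pullback h.smooth hφ]
    refine (Finset.abs_sum_le_sum_abs _ _).trans ?_
    calc _ ≤ ∑ a, (4 * B ^ 2 * |curl φ (Φ x) a| + 2 * B ^ 2 *
              ∑ m, B * |pd m (fun y => curl φ y a) (Φ x)|) := Finset.sum_le_sum fun a _ => by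
            refine (abs_add_le _ _).trans (add_le_add ?_ ?_)
            · rw [abs_mul]
              exact mul_le_mul_of_nonneg_right (h.pd_cofactor_le _ _ _ _) (abs_nonneg _)
            · rw [abs_mul]
              refine mul_le_mul (h.cofactor_le _ _ _) ?_ (abs_nonneg _) (by positivity)
              refine (Finset.abs_sum_le_sum_abs _ _).trans (Finset.sum_le_sum fun m _ => ?_)
              rw [abs_mul]
              exact mul_le_mul_of_nonneg_right (h.pd_le _ _ _) (abs_nonneg _)
      _ = 4 * B ^ 2 * (∑ a, |curl φ (Φ x) a|) + 2 * B ^ 3 * D := by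
          simp only [Finset.sum_add_distrib, ← Finset.mul_sum]
          ring
      _ ≤ _ := by
        have := mul_le_mul_of_nonneg_left (sum_abs_le_norm (curl φ (Φ x)))
          (by positivity : 0 ≤ 4 * B ^ 2)
        linarith
  have key' (i : Fin 3) : |curl (curl (pullback Φ φ)) x i| ≤
      2 * (12 * B ^ 2 * ‖curl φ (Φ x)‖ + 2 * B ^ 3 * D) := by
    rw [curl_apply (h.smooth.pullback hφ).curl]
    refine (abs_sub _ _).trans ?_
    linarith [key (i + 1) (i + 2), key (i + 2) (i + 1)]
  rw [Fin.sum_univ_three]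
  linarith [key' 0, key' 1, key' 2]

/-! ### `L²` bounds for pullbacks -/

lemma eLpNorm_sq_eq_integral {E : Type*} [NormedAddCommGroup E] {f : R3 → E}
    (hf : MemLp f 2 volume) :
    eLpNorm f 2 volume = ENNReal.ofReal (Real.sqrt (∫ x, ‖f x‖ ^ 2)) := by
  rw [hf.eLpNorm_eq_integral_rpow_norm (by norm_num) (by norm_num), Real.sqrt_eq_rpow]
  norm_num

lemma eLpNorm_le_of_integral_le {E F : Type*} [NormedAddCommGroup E] [NormedAddCommGroup F]
    {f : R3 → E} {g : R3 → F} (hf : MemLp f 2 volume) (hg : MemLp g 2 volume) {K : ℝ} (hK : 0 ≤ K)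
    (h : ∫ x, ‖f x‖ ^ 2 ≤ K ^ 2 * ∫ x, ‖g x‖ ^ 2) :
    eLpNorm f 2 volume ≤ ENNReal.ofReal K * eLpNorm g 2 volume := by
  rw [eLpNorm_sq_eq_integral hf, eLpNorm_sq_eq_integral hg, ← ENNReal.ofReal_mul hK]
  refine ENNReal.ofReal_le_ofReal ?_
  calc _ ≤ Real.sqrt (K ^ 2 * ∫ x, ‖g x‖ ^ 2) := Real.sqrt_le_sqrt h
    _ = _ := by rw [Real.sqrt_mul (sq_nonneg _), Real.sqrt_sq hK]

/-- For a test field, the `L²` norm of all derivatives of the curl is controlled by that of the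
curl of the curl. -/
lemma eLpNorm_sum_pd_curl_le {φ : R3 → R3} (hφ : IsTest φ) :
    eLpNorm (fun x => ∑ a, ∑ m, |pd m (fun y => curl φ y a) x|) 2 volume ≤
      3 * eLpNorm (curl (curl φ)) 2 volume := by
  have hI (a m : Fin 3) : Integrable (fun x => pd m (fun y => curl φ y a) x ^ 2) :=
    ((hφ.curl.coord a).pd m).integrable_sq
  have hcont : Continuous (fun x => ∑ a, ∑ m, |pd m (fun y => curl φ y a) x|) :=
    continuous_finsetSum _ fun a _ => continuous_finsetSum _ fun m _ =>
      ((hφ.curl.coord a).pd m).smooth.continuous.abs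
  -- Cauchy-Schwarz over nine entries; the constant `9` is the square of the final factor `3`.
  have hpt (x : R3) : ‖∑ a, ∑ m, |pd m (fun y => curl φ y a) x|‖ ^ 2 ≤
      9 * ∑ a, ∑ m, pd m (fun y => curl φ y a) x ^ 2 := by
    rw [Real.norm_eq_abs, sq_abs, ← Finset.sum_product', ← Finset.sum_product']
    have := sq_sum_le_card_mul_sum_sq (s := (Finset.univ : Finset (Fin 3)) ×ˢ Finset.univ)
      (f := fun p : Fin 3 × Fin 3 => |pd p.2 (fun y => curl φ y p.1) x|)
    simpa using this
  have hIs : Integrable (fun x => 9 * ∑ a, ∑ m, pd m (fun y => curl φ y a) x ^ 2) :=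
    (integrable_finsetSum _ fun a _ => integrable_finsetSum _ fun m _ => hI a m).const_mul 9
  have hmem : MemLp (fun x => ∑ a, ∑ m, |pd m (fun y => curl φ y a) x|) 2 volume := by
    refine (memLp_two_iff_integrable_sq_norm hcont.aestronglyMeasurable).2 ?_
    refine hIs.mono' (hcont.norm.pow 2).aestronglyMeasurable (Filter.Eventually.of_forall fun x => ?_)
    rw [Real.norm_eq_abs, abs_of_nonneg (by positivity)]
    exact hpt x
  have := eLpNorm_le_of_integral_le hmem (hφ.curl.curl.memLp 2 volume) (K := 3) (by norm_num) (by
    refine (integral_mono_of_nonneg (Filter.Eventually.of_forall fun x => by positivity) hIs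
      (Filter.Eventually.of_forall hpt)).trans ?_
    rw [integral_const_mul, integral_finsetSum _ fun a _ => integrable_finsetSum _ fun m _ => hI a m,
      ← sum_integral_pd_sq_curl hφ]
    simp_rw [integral_finsetSum _ fun m _ => hI _ m]
    norm_num)
  simpa using this

lemma eLpNorm_norm_comp_le {B : ℝ} {Φ : R3 → R3} (h : TameMap B Φ) {E : Type*}
    [NormedAddCommGroup E] {g : R3 → E} (hg : Continuous g) {K : ℝ} (hK : 0 ≤ K) :
    eLpNorm (fun x => K * ‖g (Φ x)‖) 2 volume ≤ ENNReal.ofReal K * (8 * eLpNorm g 2 volume) := by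
  have h1 : eLpNorm (fun x => K * ‖g (Φ x)‖) 2 volume ≤
      ENNReal.ofReal K * eLpNorm (fun x => g (Φ x)) 2 volume :=
    eLpNorm_le_mul_eLpNorm_of_ae_le_mul (Filter.Eventually.of_forall fun x => by
      rw [norm_mul, norm_norm, Real.norm_of_nonneg hK]) 2
  exact h1.trans (mul_le_mul_right (eLpNorm_comp_le h.antilipschitz h.smooth.continuous hg) _)

lemma TameMap.eLpNorm_pullback_le {B : ℝ} {Φ : R3 → R3} (h : TameMap B Φ) {φ : R3 → R3}
    (hφ : Continuous φ) :
    eLpNorm (pullback Φ φ) 2 volume ≤ ENNReal.ofReal (9 * B) * (8 * eLpNorm φ 2 volume) :=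
  (eLpNorm_mono_real (h.norm_pullback_le φ)).trans
    (eLpNorm_norm_comp_le h hφ (mul_nonneg (by norm_num) h.nonneg))

lemma TameMap.eLpNorm_curl_pullback_le {B : ℝ} {Φ : R3 → R3} (h : TameMap B Φ) {φ : R3 → R3}
    (hφ : ContDiff ℝ ∞ φ) :
    eLpNorm (curl (pullback Φ φ)) 2 volume ≤
      ENNReal.ofReal (18 * B ^ 2) * (8 * eLpNorm (curl φ) 2 volume) :=
  (eLpNorm_mono_real (h.norm_curl_pullback_le hφ)).trans
    (eLpNorm_norm_comp_le h hφ.curl.continuous (by positivity))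

/-- The full gradient of `curl φ` is bounded in `L²` by `curl curl φ` because `curl φ` is
solenoidal. The constants depend on `B` alone, so they are uniform over a family of tame maps. -/
lemma TameMap.eLpNorm_curl_curl_pullback_le {B : ℝ} {Φ : R3 → R3} (h : TameMap B Φ) {φ : R3 → R3}
    (hφ : IsTest φ) :
    eLpNorm (curl (curl (pullback Φ φ))) 2 volume ≤
      ENNReal.ofReal (72 * B ^ 2) * (8 * eLpNorm (curl φ) 2 volume) +
      ENNReal.ofReal (12 * B ^ 3) * (8 * (3 * eLpNorm (curl (curl φ)) 2 volume)) := by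
  have hB := h.nonneg
  obtain ⟨D, hD⟩ : ∃ D : R3 → ℝ, D = fun x => ∑ a, ∑ m, |pd m (fun y => curl φ y a) x| := ⟨_, rfl⟩
  have hDc : Continuous D := by
    rw [hD]
    exact continuous_finsetSum _ fun a _ => continuous_finsetSum _ fun m _ =>
      ((hφ.curl.coord a).pd m).smooth.continuous.abs
  have hD0 : ∀ x, 0 ≤ D x := fun x => by rw [hD]; positivity
  have hcc : Continuous (fun x => curl φ (Φ x)) :=
    hφ.curl.smooth.continuous.comp h.smooth.continuous
  have h1 : eLpNorm (curl (curl (pullback Φ φ))) 2 volume ≤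
      eLpNorm (fun x => 72 * B ^ 2 * ‖curl φ (Φ x)‖ + 12 * B ^ 3 * ‖D (Φ x)‖) 2 volume := by
    refine eLpNorm_mono_real fun x => ?_
    rw [Real.norm_of_nonneg (hD0 _), hD]
    exact h.norm_curl_curl_pullback_le hφ.smooth x
  have hm1 : AEStronglyMeasurable (fun x => 72 * B ^ 2 * ‖curl φ (Φ x)‖) volume :=
    (continuous_const.mul hcc.norm).aestronglyMeasurable
  have hm2 : AEStronglyMeasurable (fun x => 12 * B ^ 3 * ‖D (Φ x)‖) volume :=
    (continuous_const.mul (hDc.comp h.smooth.continuous).norm).aestronglyMeasurable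
  refine h1.trans ((eLpNorm_add_le hm1 hm2 (by norm_num)).trans (add_le_add ?_ ?_))
  · exact eLpNorm_norm_comp_le h hφ.curl.smooth.continuous (by positivity)
  · refine (eLpNorm_norm_comp_le h hDc (by positivity)).trans ?_
    rw [hD]
    gcongr
    exact eLpNorm_sum_pd_curl_le hφ

end Pullback

/-! ### Pullback along small perturbations of the identity -/

section Perturbation

open Filter Topology

/-- The map `x ↦ x + ε X(x)`. -/
noncomputable def shift (X : R3 → R3) (ε : ℝ) (x : R3) : R3 := x + ε • X x

lemma contDiff_shift {X : R3 → R3} (hX : ContDiff ℝ ∞ X) (ε : ℝ) : ContDiff ℝ ∞ (shift X ε) :=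
  contDiff_id.add (hX.const_smul ε)

lemma pd_shift {X : R3 → R3} (hX : ContDiff ℝ ∞ X) (ε : ℝ) (i j : Fin 3) :
    pd i (fun y => shift X ε y j) =
      fun x => (if i = j then 1 else 0) + ε * pd i (fun y => X y j) x := by
  have h1 : (fun y => shift X ε y j) = fun y => y j + ε * X y j := by
    ext y; simp [shift]
  have h2 (x : R3) : pd i (fun y : R3 => y j) x = if i = j then 1 else 0 := by
    have : fderiv ℝ (fun y : R3 => y j) x = (EuclideanSpace.proj j : R3 →L[ℝ] ℝ) :=
      (EuclideanSpace.proj j : R3 →L[ℝ] ℝ).fderiv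
    rw [pd, this]
    simp [eq_comm]
  rw [h1, pd_add (f := fun y : R3 => y j) (contDiff_id.coord j).differentiable_infty
    ((hX.coord j).differentiable_infty.const_mul ε),
    pd_const_mul ε (hX.coord j).differentiable_infty]
  simp_rw [h2]

lemma IsTest.exists_bound {f : R3 → ℝ} (hf : IsTest f) : ∃ C, 0 ≤ C ∧ ∀ x, |f x| ≤ C := by
  obtain ⟨C, hC⟩ := hf.compact.exists_bound_of_continuous hf.smooth.continuous
  exact ⟨C, (norm_nonneg _).trans (hC 0), hC⟩

lemma exists_common_bound {ι : Type*} [Fintype ι] {f : ι → R3 → ℝ} (hf : ∀ i, IsTest (f i)) :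
    ∃ C, 0 ≤ C ∧ ∀ i x, |f i x| ≤ C := by
  choose C hC0 hC using fun i => (hf i).exists_bound
  exact ⟨∑ i, C i, Finset.sum_nonneg fun i _ => hC0 i, fun i x => (hC i x).trans
    (Finset.single_le_sum (fun i _ => hC0 i) (Finset.mem_univ i))⟩

/-- The point is that `B` does not depend on `ε`: pullbacks along these maps are uniformly bounded
in the norm of `u`, `curl u` and `curl curl u` as `ε → 0`. -/
lemma exists_tameMap_shift {X : R3 → R3} (hX : IsTest X) :
    ∃ B : ℝ, ∀ᶠ ε in 𝓝[>] (0 : ℝ), TameMap B (shift X ε) ∧ UniformContinuous (shift X ε) := by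
  obtain ⟨L, hL⟩ := (hX.smooth.of_le (by simp)).lipschitzWith_of_hasCompactSupport hX.compact
    (n := 1) (by simp)
  obtain ⟨C, hC0, hC⟩ := exists_common_bound (ι := Fin 3 × Fin 3)
    (f := fun p => pd p.1 (fun y => X y p.2)) fun p => (hX.coord p.2).pd p.1
  obtain ⟨C', hC'0, hC'⟩ := exists_common_bound (ι := Fin 3 × Fin 3 × Fin 3)
    (f := fun p => pd p.1 (pd p.2.1 (fun y => X y p.2.2))) fun p => ((hX.coord _).pd _).pd _
  refine ⟨1 + C + C', ?_⟩
  have h1 : ∀ᶠ ε in 𝓝[>] (0 : ℝ), ε < 1 :=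
    eventually_nhdsWithin_of_eventually_nhds (eventually_lt_nhds one_pos)
  have h2 : ∀ᶠ ε : ℝ in 𝓝[>] (0 : ℝ), ε * L < 1 / 2 := by
    refine eventually_nhdsWithin_of_eventually_nhds ?_
    have : Tendsto (fun ε : ℝ => ε * L) (𝓝 0) (𝓝 (0 * L)) := tendsto_id.mul_const _
    rw [zero_mul] at this
    exact this.eventually_lt_const (u := 1 / 2) (by norm_num)
  filter_upwards [h1, h2, self_mem_nhdsWithin] with ε hε1 hε2 hε0
  have hε0' : 0 < ε := hε0
  refine ⟨⟨contDiff_shift hX.smooth ε, antilipschitz_id_add hL hε0'.le hε2.le, fun i j x => ?_,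
    fun i j k x => ?_⟩, ?_⟩
  · rw [pd_shift hX.smooth]
    have h3 := hC (i, j) x
    refine (abs_add_le _ _).trans ?_
    have h4 : |ε * pd i (fun y => X y j) x| ≤ C := by
      rw [abs_mul, abs_of_pos hε0']
      exact (mul_le_of_le_one_left (abs_nonneg _) hε1.le).trans h3
    have h5 : |if i = j then (1 : ℝ) else 0| ≤ 1 := by split_ifs <;> simp
    linarith
  · rw [pd_shift hX.smooth]
    have hd : Differentiable ℝ (pd j (fun y => X y k)) :=
      ((hX.smooth.coord k).pd j).differentiable_infty
    rw [pd_add (differentiable_const _) (hd.const_mul ε), pd_const_mul ε hd]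
    have h3 := hC' (i, j, k) x
    have h4 : |ε * pd i (pd j (fun y => X y k)) x| ≤ C' := by
      rw [abs_mul, abs_of_pos hε0']
      exact (mul_le_of_le_one_left (abs_nonneg _) hε1.le).trans h3
    have h5 : pd i (fun _ => if j = k then (1 : ℝ) else 0) x = 0 := by simp [pd]
    dsimp only
    rw [h5, zero_add]
    linarith
  · exact uniformContinuous_id.add (hL.uniformContinuous.const_smul ε)

/-- Joint smoothness in `(ε, x)` gives continuity at `ε = 0` of the curls of a pulled back field
without computing them. -/
lemma contDiff_uncurry_curl {g : ℝ → R3 → R3} (hg : ContDiff ℝ ∞ (Function.uncurry g)) :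
    ContDiff ℝ ∞ (Function.uncurry fun ε => curl (g ε)) := by
  have h (i j : Fin 3) : ContDiff ℝ ∞ fun p : ℝ × R3 => partialDeriv (g p.1) i j p.2 := by
    have h1 : ContDiff ℝ ∞ fun p : ℝ × R3 => fderiv ℝ (g p.1) p.2 := by
      refine ContDiff.fderiv (m := ∞) (f := fun p : ℝ × R3 => g p.1) ?_ contDiff_snd (by simp)
      exact hg.comp (contDiff_fst.fst.prodMk contDiff_snd)
    exact (EuclideanSpace.proj j : R3 →L[ℝ] ℝ).contDiff.comp (h1.clm_apply contDiff_const)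
  refine contDiff_euclidean.2 fun j => ?_
  fin_cases j
  · exact (h 1 2).sub (h 2 1)
  · exact (h 2 0).sub (h 0 2)
  · exact (h 0 1).sub (h 1 0)

/-- With all supports in one compact set, the squared norm is an integral depending continuously on
the parameter and vanishing at `0`. -/
lemma tendsto_eLpNorm_zero_of_continuous {h : ℝ → R3 → R3} (hc : Continuous (Function.uncurry h))
    {K : Set R3} (hK : IsCompact K) (hs : ∀ᶠ ε in 𝓝[>] (0 : ℝ), ∀ x ∉ K, h ε x = 0)
    (h0 : ∀ x, h 0 x = 0) :
    Tendsto (fun ε => eLpNorm (h ε) 2 volume) (𝓝[>] 0) (𝓝 0) := by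
  have h1 : Continuous fun ε => ∫ x in K, ‖h ε x‖ ^ 2 := by
    refine continuous_parametric_integral_of_continuous (f := fun ε x => ‖h ε x‖ ^ 2) ?_ hK
    exact hc.norm.pow 2
  have h2 : Tendsto (fun ε => ENNReal.ofReal (Real.sqrt (∫ x in K, ‖h ε x‖ ^ 2))) (𝓝[>] 0) (𝓝 0) := by
    have := (ENNReal.continuous_ofReal.comp (Real.continuous_sqrt.comp h1)).tendsto 0
    simp only [Function.comp_apply, h0, norm_zero, ne_eq, OfNat.ofNat_ne_zero, not_false_eq_true,
      zero_pow, integral_zero, Real.sqrt_zero, ENNReal.ofReal_zero] at this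
    exact this.mono_left nhdsWithin_le_nhds
  refine h2.congr' ?_
  filter_upwards [hs] with ε hε
  have hcε : Continuous (h ε) := hc.comp (Continuous.prodMk_right ε)
  have hcs : HasCompactSupport (h ε) := HasCompactSupport.intro hK hε
  rw [eLpNorm_sq_eq_integral (hcε.memLp_of_hasCompactSupport hcs),
    setIntegral_eq_integral_of_forall_compl_eq_zero fun x hx => by rw [hε x hx]; simp]

lemma contDiff_uncurry_pullback_shift {X φ : R3 → R3} (hX : ContDiff ℝ ∞ X)
    (hφ : ContDiff ℝ ∞ φ) :
    ContDiff ℝ ∞ (Function.uncurry fun ε => pullback (shift X ε) φ) := by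
  refine contDiff_euclidean.2 fun j => ?_
  have hs : ContDiff ℝ ∞ fun p : ℝ × R3 => shift X p.1 p.2 :=
    contDiff_snd.add (contDiff_fst.smul (hX.comp contDiff_snd))
  have e : (fun p : ℝ × R3 => (Function.uncurry fun ε => pullback (shift X ε) φ) p j) =
      fun p => ∑ l, ((if j = l then 1 else 0) + p.1 * pd j (fun y => X y l) p.2) *
        φ (shift X p.1 p.2) l := by
    ext p
    simp only [Function.uncurry, pullback_apply, pd_shift hX]
  rw [e]
  exact ContDiff.sum fun l _ => (contDiff_const.add (contDiff_fst.mul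
    (((hX.coord l).pd j).comp contDiff_snd))).mul ((hφ.coord l).comp hs)

lemma pullback_shift_zero {X φ : R3 → R3} (hX : ContDiff ℝ ∞ X) :
    pullback (shift X 0) φ = φ := by
  ext x j
  simp only [pullback_apply, pd_shift hX]
  simp [shift]

/-- For `ε < 1` no point moves farther than `sup ‖X‖`, so the closed neighbourhood of `tsupport φ`
of that width serves all `ε`. -/
lemma exists_compact_support_pullback_shift {X φ : R3 → R3} (hX : IsTest X) (hφ : IsTest φ) :
    ∃ K : Set R3, IsCompact K ∧ tsupport φ ⊆ K ∧
      ∀ᶠ ε in 𝓝[>] (0 : ℝ), tsupport (pullback (shift X ε) φ) ⊆ K := by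
  obtain ⟨M, hM⟩ := hX.compact.exists_bound_of_continuous hX.smooth.continuous
  have hM0 : 0 ≤ M := (norm_nonneg _).trans (hM 0)
  refine ⟨Metric.cthickening M (tsupport φ), hφ.compact.isCompact.cthickening,
    Metric.self_subset_cthickening _, ?_⟩
  have h1 : ∀ᶠ ε in 𝓝[>] (0 : ℝ), ε < 1 :=
    eventually_nhdsWithin_of_eventually_nhds (eventually_lt_nhds one_pos)
  filter_upwards [h1, self_mem_nhdsWithin] with ε hε1 hε0
  have hε0' : 0 < ε := hε0
  refine closure_minimal (fun x hx => ?_) Metric.isClosed_cthickening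
  have hx' : shift X ε x ∈ tsupport φ := subset_tsupport _ (support_pullback_subset (shift X ε) _ hx)
  refine Metric.mem_cthickening_of_dist_le _ _ _ _ hx' ?_
  rw [dist_eq_norm, shift, sub_add_cancel_left, norm_neg, norm_smul, Real.norm_eq_abs,
    abs_of_pos hε0']
  exact (mul_le_of_le_one_left (norm_nonneg _) hε1.le).trans (hM x)

/-- Convergence of the pullbacks along `id + ε X` to the identity, on test fields. -/
lemma tendsto_pullback_shift {X φ : R3 → R3} (hX : IsTest X) (hφ : IsTest φ) :
    Tendsto (fun ε => eLpNorm (fun x => pullback (shift X ε) φ x - φ x) 2 volume) (𝓝[>] 0) (𝓝 0) ∧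
    Tendsto (fun ε => eLpNorm (fun x => curl (pullback (shift X ε) φ) x - curl φ x) 2 volume)
      (𝓝[>] 0) (𝓝 0) ∧
    Tendsto (fun ε => eLpNorm (fun x => curl (curl (pullback (shift X ε) φ)) x
      - curl (curl φ) x) 2 volume) (𝓝[>] 0) (𝓝 0) := by
  obtain ⟨K, hK, hφK, hsup⟩ := exists_compact_support_pullback_shift hX hφ
  have g0 := contDiff_uncurry_pullback_shift hX.smooth hφ.smooth
  have g1 := contDiff_uncurry_curl g0
  have g2 := contDiff_uncurry_curl g1
  have z0 := pullback_shift_zero (φ := φ) hX.smooth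
  have key (F G : R3 → R3) (hFG : tsupport G ⊆ tsupport F) (hF : tsupport F ⊆ K) :
      ∀ x ∉ K, G x = 0 := fun x hx => image_eq_zero_of_notMem_tsupport fun h => hx (hF (hFG h))
  refine ⟨?_, ?_, ?_⟩
  · refine tendsto_eLpNorm_zero_of_continuous
      (g0.continuous.sub (hφ.smooth.continuous.comp continuous_snd)) hK ?_ fun x => by simp [z0]
    filter_upwards [hsup] with ε hε x hx
    rw [key _ _ subset_rfl hε x hx, key _ _ subset_rfl hφK x hx, sub_zero]
  · refine tendsto_eLpNorm_zero_of_continuous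
      (g1.continuous.sub (hφ.curl.smooth.continuous.comp continuous_snd)) hK ?_
      fun x => by simp [z0]
    filter_upwards [hsup] with ε hε x hx
    rw [key _ _ (tsupport_curl_subset _) hε x hx, key _ _ (tsupport_curl_subset _) hφK x hx,
      sub_zero]
  · refine tendsto_eLpNorm_zero_of_continuous
      (g2.continuous.sub (hφ.curl.curl.smooth.continuous.comp continuous_snd)) hK ?_
      fun x => by simp [z0]
    filter_upwards [hsup] with ε hε x hx
    rw [key _ _ ((tsupport_curl_subset _).trans (tsupport_curl_subset _)) hε x hx,
      key _ _ ((tsupport_curl_subset _).trans (tsupport_curl_subset _)) hφK x hx, sub_zero]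

end Perturbation

/-! ### Mollification -/

section Mollify

open Filter Topology ContinuousLinearMap

/-- Continuity of translations in `L²`. -/
lemma exists_translation_bound {g : R3 → ℝ} (hg : MemLp g 2 volume) {η : ENNReal} (hη : 0 < η) :
    ∃ δ > 0, ∀ t : R3, ‖t‖ < δ → eLpNorm (fun x => g (x - t) - g x) 2 volume ≤ η := by
  let T : R3 → C(R3, R3) := fun t => ⟨fun x => x - t, by fun_prop⟩
  have hT : Continuous T :=
    (ContinuousMap.curry ⟨fun p : R3 × R3 => p.2 - p.1, by fun_prop⟩).continuous
  have hmp (t : R3) : MeasurePreserving (T t) volume volume := measurePreserving_sub_right volume t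
  have hc : Continuous fun t => Lp.compMeasurePreserving (T t) (hmp t) hg.toLp :=
    Continuous.compMeasurePreservingLp continuous_const hT hmp (by norm_num)
  have he (t : R3) : Lp.compMeasurePreserving (T t) (hmp t) hg.toLp =
      (hg.comp_measurePreserving (hmp t)).toLp := Lp.toLp_compMeasurePreserving hg (hmp t)
  have h0 : Lp.compMeasurePreserving (T 0) (hmp 0) hg.toLp = hg.toLp := by
    rw [he]
    congr 1
    ext x
    simp [T]
  have hev := (EMetric.tendsto_nhds.1 (hc.tendsto 0)) η hη
  rw [Metric.eventually_nhds_iff] at hev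
  obtain ⟨δ, hδ, h⟩ := hev
  refine ⟨δ, hδ, fun t ht => ?_⟩
  have := (h (by simpa using ht)).le
  rw [h0, he, Lp.edist_toLp_toLp] at this
  exact this

/-- An average of functions that are `L²`-close to `g` is `L²`-close to `g`. -/
lemma eLpNorm_average_sub_le {g ρ : R3 → ℝ} (hg : StronglyMeasurable g) (hg2 : MemLp g 2 volume)
    (hρ : Continuous ρ) (hρc : HasCompactSupport ρ) (hρ0 : ∀ t, 0 ≤ ρ t) (hρ1 : ∫ t, ρ t = 1)
    {η : ENNReal}
    (h : ∀ t ∈ Function.support ρ, eLpNorm (fun x => g (x - t) - g x) 2 volume ≤ η) :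
    eLpNorm (fun x => (∫ t, g (x - t) * ρ t) - g x) 2 volume ≤ η := by
  have hρi : Integrable ρ := hρ.integrable_of_hasCompactSupport hρc
  set w : R3 → ENNReal := fun t => ENNReal.ofReal (ρ t) with hw
  have hwm : Measurable w := hρ.measurable.ennreal_ofReal
  -- Under the probability measure `ρ dt` the average is an expectation. The inequality between the
  -- `L¹` and `L²` norms bounds its square pointwise, and Tonelli exchanges the integrals.
  set ν : Measure R3 := volume.withDensity w with hν
  have hνp : IsProbabilityMeasure ν := ⟨by
    rw [hν, withDensity_apply _ MeasurableSet.univ, Measure.restrict_univ,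
      ← ofReal_integral_eq_lintegral_ofReal hρi (Eventually.of_forall hρ0), hρ1, ENNReal.ofReal_one]⟩
  have hint (x : R3) : Integrable fun t => g (x - t) * ρ t := by
    have hl : LocallyIntegrable g := hg2.locallyIntegrable (by norm_num)
    have := (hρc.convolutionExists_right (mul ℝ ℝ) hl hρ x).integrable_swap
    simpa using this
  have hmeas (x : R3) : StronglyMeasurable fun t => g (x - t) - g x :=
    (hg.comp_measurable (by fun_prop)).sub stronglyMeasurable_const
  have hmeas2 : StronglyMeasurable fun p : R3 × R3 => g (p.1 - p.2) - g p.1 :=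
    (hg.comp_measurable (by fun_prop)).sub (hg.comp_measurable measurable_fst)
  have hpt (x : R3) : ‖(∫ t, g (x - t) * ρ t) - g x‖ₑ ^ (2 : ℝ) ≤
      ∫⁻ t, ‖g (x - t) - g x‖ₑ ^ (2 : ℝ) ∂ν := by
    have e1 : (∫ t, g (x - t) * ρ t) - g x = ∫ t, (g (x - t) - g x) * ρ t := by
      simp_rw [sub_mul]
      rw [integral_sub (hint x) (hρi.const_mul _), integral_const_mul, hρ1, mul_one]
    have e2 : ‖∫ t, (g (x - t) - g x) * ρ t‖ₑ ≤ eLpNorm (fun t => g (x - t) - g x) 1 ν := by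
      refine (enorm_integral_le_lintegral_enorm _).trans_eq ?_
      rw [eLpNorm_one_eq_lintegral_enorm, hν, lintegral_withDensity_eq_lintegral_mul _ hwm
        (hmeas x).enorm]
      refine lintegral_congr fun t => ?_
      rw [enorm_mul, Pi.mul_apply, hw, mul_comm, Real.enorm_eq_ofReal (hρ0 t)]
    have e3 : eLpNorm (fun t => g (x - t) - g x) 1 ν ≤ eLpNorm (fun t => g (x - t) - g x) 2 ν :=
      eLpNorm_le_eLpNorm_of_exponent_le (by norm_num) (hmeas x).aestronglyMeasurable
    rw [e1]
    refine (ENNReal.rpow_le_rpow (e2.trans e3) (by norm_num)).trans_eq ?_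
    rw [eLpNorm_eq_lintegral_rpow_enorm_toReal (by norm_num) (by norm_num), ← ENNReal.rpow_mul]
    simp
  have hsq (F : R3 → ℝ) : eLpNorm F 2 volume = (∫⁻ x, ‖F x‖ₑ ^ (2 : ℝ)) ^ (1 / (2 : ℝ)) := by
    rw [eLpNorm_eq_lintegral_rpow_enorm_toReal (by norm_num) (by norm_num)]
    simp
  have hsw : ∫⁻ x, ‖(∫ t, g (x - t) * ρ t) - g x‖ₑ ^ (2 : ℝ) ≤ η ^ (2 : ℝ) := by
    refine (lintegral_mono hpt).trans ?_
    rw [lintegral_lintegral_swap (hmeas2.enorm.pow_const _).aemeasurable]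
    have hb : ∀ᵐ t ∂ν, ∫⁻ x, ‖g (x - t) - g x‖ₑ ^ (2 : ℝ) ≤ η ^ (2 : ℝ) := by
      rw [hν, ae_withDensity_iff hwm]
      refine Eventually.of_forall fun t ht => ?_
      have ht' : t ∈ Function.support ρ := by
        intro h0
        exact ht (by rw [hw]; simp [h0])
      have h1 := ENNReal.rpow_le_rpow (h t ht') (by norm_num : (0 : ℝ) ≤ 2)
      rw [hsq, ← ENNReal.rpow_mul] at h1
      simpa using h1
    refine (lintegral_mono_ae hb).trans ?_
    simp
  rw [hsq]
  refine (ENNReal.rpow_le_rpow hsw (by norm_num)).trans_eq ?_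
  rw [← ENNReal.rpow_mul]
  simp

/-- The mollification of a scalar function by the kernel `ρ`. -/
noncomputable def moll (ρ g : R3 → ℝ) : R3 → ℝ := convolution g ρ (mul ℝ ℝ) volume

lemma moll_apply (ρ g : R3 → ℝ) (x : R3) : moll ρ g x = ∫ t, g t * ρ (x - t) := rfl

lemma moll_apply_swap (ρ g : R3 → ℝ) (x : R3) : moll ρ g x = ∫ t, g (x - t) * ρ t :=
  convolution_eq_swap (f := g) (g := ρ) (mul ℝ ℝ)

lemma contDiff_moll {ρ g : R3 → ℝ} (hρ : IsTest ρ) (hg : LocallyIntegrable g) :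
    ContDiff ℝ ∞ (moll ρ g) :=
  hρ.compact.contDiff_convolution_right (n := ⊤) (mul ℝ ℝ) hg hρ.smooth

lemma pd_moll {ρ g : R3 → ℝ} (hρ : IsTest ρ) (hg : LocallyIntegrable g) (i : Fin 3) (x : R3) :
    pd i (moll ρ g) x = moll (pd i ρ) g x := by
  have h := (hρ.compact.hasFDerivAt_convolution_right (mul ℝ ℝ) hg
    (hρ.smooth.of_le (by simp)) x).fderiv
  rw [pd, moll, h, convolution_precompR_apply _ hg (hρ.compact.fderiv ℝ)
    (hρ.smooth.continuous_fderiv (by simp))]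
  rfl

lemma IsTest.comp_sub {ρ : R3 → ℝ} (hρ : IsTest ρ) (x : R3) : IsTest (fun y => ρ (x - y)) :=
  ⟨hρ.smooth.comp (contDiff_const.sub contDiff_id),
    hρ.compact.comp_homeomorph (Homeomorph.subLeft x)⟩

lemma pd_comp_sub {ρ : R3 → ℝ} (hρ : IsTest ρ) (x : R3) (i : Fin 3) :
    pd i (fun y => ρ (x - y)) = fun y => - pd i ρ (x - y) := by
  ext y
  have h1 : HasFDerivAt (fun y : R3 => x - y) (-ContinuousLinearMap.id ℝ R3) y := by
    simpa using (hasFDerivAt_id y).const_sub x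
  have := ((hρ.smooth.differentiable_infty (x - y)).hasFDerivAt.comp y h1).fderiv
  simp only [pd]
  change fderiv ℝ (ρ ∘ fun y => x - y) y _ = _
  rw [this]
  simp

end Mollify

/-! ### Density of test fields among fields with vanishing traces -/

section Density

open Filter Topology ContinuousLinearMap

/-- `b` is the distributional curl of `a` on `ℝ³`. -/
def HasWeakCurl (a b : R3 → R3) : Prop :=
  ∀ ψ : R3 → R3, IsTest ψ → ∫ x, inner ℝ (b x) (ψ x) = ∫ x, inner ℝ (a x) (curl ψ x)

/-- Smooth averaging kernels supported in the ball of radius `δ`. -/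
structure IsKernel (δ : ℝ) (ρ : R3 → ℝ) : Prop where
  isTest : IsTest ρ
  nonneg : ∀ t, 0 ≤ ρ t
  integral_eq_one : ∫ t, ρ t = 1
  support_subset : Function.support ρ ⊆ Metric.ball 0 δ

lemma exists_isKernel {δ : ℝ} (hδ : 0 < δ) : ∃ ρ, IsKernel δ ρ := by
  let f : ContDiffBump (0 : R3) := ⟨δ / 2, δ, half_pos hδ, half_lt_self hδ⟩
  exact ⟨f.normed volume, ⟨f.contDiff_normed, f.hasCompactSupport_normed⟩, f.nonneg_normed,
    f.integral_normed, (f.support_normed_eq (μ := volume)).subset⟩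

/-- Componentwise mollification of a vector field. -/
noncomputable def mollField (ρ : R3 → ℝ) (a : R3 → R3) (x : R3) : R3 :=
  WithLp.toLp 2 fun j => moll ρ (fun y => a y j) x

lemma mollField_apply (ρ : R3 → ℝ) (a : R3 → R3) (x : R3) (j : Fin 3) :
    mollField ρ a x j = moll ρ (fun y => a y j) x := rfl

lemma MemLp.coord {a : R3 → R3} {μ : Measure R3} (ha : MemLp a 2 μ) (j : Fin 3) :
    MemLp (fun y => a y j) 2 μ :=
  ha.of_le ((EuclideanSpace.proj j : R3 →L[ℝ] ℝ).continuous.comp_aestronglyMeasurable ha.1)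
    (Eventually.of_forall fun x => abs_coord_le (a x) j)

lemma contDiff_mollField {ρ : R3 → ℝ} {a : R3 → R3} (hρ : IsTest ρ) (ha : MemLp a 2 volume) :
    ContDiff ℝ ∞ (mollField ρ a) :=
  contDiff_of_coord fun j => contDiff_moll hρ ((MemLp.coord ha j).locallyIntegrable (by norm_num))

/-- The derivatives fall on the kernel, and component `i` at `x` is the weak curl identity tested
with `ρ(x - ·) eᵢ`. -/
lemma curl_mollField {ρ : R3 → ℝ} {a b : R3 → R3} (hρ : IsTest ρ) (ha : MemLp a 2 volume)
    (hab : HasWeakCurl a b) : curl (mollField ρ a) = mollField ρ b := by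
  have hl (j : Fin 3) : LocallyIntegrable (fun y => a y j) :=
    (MemLp.coord ha j).locallyIntegrable (by norm_num)
  have hI (x : R3) (i j : Fin 3) : Integrable fun t => a t j * pd i ρ (x - t) :=
    ((hρ.pd i).compact.convolutionExists_right (mul ℝ ℝ) (hl j) (hρ.pd i).smooth.continuous) x
  ext x i
  rw [curl_apply (contDiff_mollField hρ ha)]
  simp only [mollField_apply]
  rw [pd_moll hρ (hl _), pd_moll hρ (hl _), moll_apply, moll_apply, moll_apply,
    ← integral_sub (hI _ _ _) (hI _ _ _)]
  set σ : R3 → ℝ := fun y => ρ (x - y) with hσdef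
  have hσ : IsTest σ := hρ.comp_sub x
  set ψ : R3 → R3 := fun y => σ y • basisVec i with hψ
  have hψt : IsTest ψ := ⟨hσ.smooth.smul contDiff_const, hσ.compact.smul_right⟩
  have h := hab ψ hψt
  have e1 (y : R3) : inner ℝ (b y) (ψ y) = b y i * ρ (x - y) := by
    rw [hψ, inner_smul_right]
    simp [hσdef, EuclideanSpace.inner_single_right, mul_comm]
  have hz (k : Fin 3) : pd k (fun _ : R3 => (0 : ℝ)) = fun _ => 0 := by ext; simp [pd]
  have hp (k : Fin 3) (y : R3) : pd k σ y = - pd k ρ (x - y) := congrFun (pd_comp_sub hρ x k) y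
  have e2 (y : R3) : inner ℝ (a y) (curl ψ y) =
      a y (i + 2) * pd (i + 1) ρ (x - y) - a y (i + 1) * pd (i + 2) ρ (x - y) := by
    have hc (k : Fin 3) : (fun y => ψ y k) = if k = i then σ else fun _ => 0 := by
      ext y
      by_cases hk : k = i
      · subst hk; simp [hψ]
      · simp [hψ, hk]
    rw [inner_eq_sum, curl_apply hψt.smooth, curl_apply hψt.smooth, curl_apply hψt.smooth]
    simp only [hc]
    fin_cases i <;> simp [hz, hp] <;> ring
  simp_rw [e1, e2] at h
  exact h.symm

lemma eLpNorm_le_sum_coord {f : R3 → R3} (hf : AEStronglyMeasurable f volume) {η : ENNReal}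
    (h : ∀ j, eLpNorm (fun x => f x j) 2 volume ≤ η) : eLpNorm f 2 volume ≤ 3 * η := by
  have hm (j : Fin 3) : AEStronglyMeasurable (fun x => |f x j|) volume :=
    ((EuclideanSpace.proj j : R3 →L[ℝ] ℝ).continuous.comp_aestronglyMeasurable hf).norm
  have h' (j : Fin 3) : eLpNorm (fun x => |f x j|) 2 volume ≤ η := by
    refine le_trans (le_of_eq ?_) (h j)
    exact eLpNorm_norm (fun x => f x j)
  have h1 : eLpNorm f 2 volume ≤ eLpNorm ((fun x => |f x 0|) + (fun x => |f x 1|)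
      + (fun x => |f x 2|)) 2 volume := by
    refine eLpNorm_mono_real fun x => ?_
    have := norm_le_sum_abs (f x)
    rw [Fin.sum_univ_three] at this
    exact this
  refine h1.trans ((eLpNorm_add_le ((hm 0).add (hm 1)) (hm 2) (by norm_num)).trans ?_)
  have h2 := eLpNorm_add_le (hm 0) (hm 1) (p := 2) (by norm_num)
  calc _ ≤ (η + η) + η := add_le_add (h2.trans (add_le_add (h' 0) (h' 1))) (h' 2)
    _ = 3 * η := by ring

/-- A kernel of small support averages translates that are all `L²` close to `a`; each coordinate
receives `η/3`. All smaller radii are admitted because the radius is shrunk again afterwards. -/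
lemma exists_mollField_close {a : R3 → R3} (ha : MemLp a 2 volume) (ham : StronglyMeasurable a)
    {η : ENNReal} (hη : 0 < η) :
    ∃ δ > 0, ∀ δ' ≤ δ, ∀ ρ, IsKernel δ' ρ →
      eLpNorm (fun x => mollField ρ a x - a x) 2 volume ≤ η := by
  have hη3 : 0 < η / 3 := ENNReal.div_pos hη.ne' (by norm_num)
  choose δ hδ h using fun j => exists_translation_bound (MemLp.coord ha j) hη3
  refine ⟨min (δ 0) (min (δ 1) (δ 2)), lt_min (hδ 0) (lt_min (hδ 1) (hδ 2)),
    fun δ' hδ' ρ hρ => ?_⟩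
  have hle (j : Fin 3) : δ' ≤ δ j := by
    refine hδ'.trans ?_
    fin_cases j
    · exact min_le_left _ _
    · exact (min_le_right _ _).trans (min_le_left _ _)
    · exact (min_le_right _ _).trans (min_le_right _ _)
  have hm : AEStronglyMeasurable (fun x => mollField ρ a x - a x) volume :=
    (contDiff_mollField hρ.isTest ha).continuous.aestronglyMeasurable.sub ha.1
  refine (eLpNorm_le_sum_coord hm (η := η / 3) fun j => ?_).trans_eq ?_
  · have := eLpNorm_average_sub_le (g := fun y => a y j)
      ((EuclideanSpace.proj j : R3 →L[ℝ] ℝ).continuous.comp_stronglyMeasurable ham)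
      (MemLp.coord ha j) hρ.isTest.smooth.continuous hρ.isTest.compact hρ.nonneg
      hρ.integral_eq_one (η := η / 3) fun t ht => h j t (by
        have := hρ.support_subset ht
        rw [mem_ball_zero_iff] at this
        exact this.trans_le (hle j))
    refine le_trans (le_of_eq ?_) this
    congr 1
    ext x
    change moll ρ (fun y => a y j) x - a x j = _
    rw [moll_apply_swap]
  · exact ENNReal.mul_div_cancel (by norm_num) (by norm_num)

lemma mollField_eq_zero {a : R3 → R3} {S : Set R3} (ha : ∀ x ∉ S, a x = 0) {δ : ℝ} {ρ : R3 → ℝ}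
    (hρ : IsKernel δ ρ) {x : R3} (hx : x ∉ Metric.cthickening δ S) : mollField ρ a x = 0 := by
  ext j
  rw [mollField_apply, moll_apply]
  refine integral_eq_zero_of_ae (Eventually.of_forall fun t => ?_)
  by_cases ht : t ∈ S
  · have : ρ (x - t) = 0 := by
      by_contra h
      have h1 := hρ.support_subset h
      rw [mem_ball_zero_iff, ← dist_eq_norm] at h1
      exact hx (Metric.mem_cthickening_of_dist_le _ _ _ _ ht h1.le)
    simp [this]
  · simp [ha t ht]

lemma tsupport_mollField_subset {a : R3 → R3} {S : Set R3} (ha : ∀ x ∉ S, a x = 0) {δ : ℝ}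
    {ρ : R3 → ℝ} (hρ : IsKernel δ ρ) : tsupport (mollField ρ a) ⊆ Metric.cthickening δ S := by
  refine closure_minimal (fun x hx => ?_) Metric.isClosed_cthickening
  by_contra h
  exact hx (mollField_eq_zero ha hρ h)

lemma eLpNorm_triangle {f g h a : R3 → R3} (hf : Continuous f) (hg : Continuous g)
    (hh : Continuous h) (ha : AEStronglyMeasurable a volume) :
    eLpNorm (fun x => f x - a x) 2 volume ≤ eLpNorm (fun x => f x - g x) 2 volume +
      eLpNorm (fun x => g x - h x) 2 volume + eLpNorm (fun x => h x - a x) 2 volume := by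
  have e : (fun x => f x - a x) =
      ((fun x => f x - g x) + fun x => g x - h x) + fun x => h x - a x := by
    ext1 x
    simp only [Pi.add_apply]
    abel
  rw [e]
  refine (eLpNorm_add_le ((hf.sub hg).add (hg.sub hh)).aestronglyMeasurable
    (hh.aestronglyMeasurable.sub ha) (by norm_num)).trans ?_
  exact add_le_add (eLpNorm_add_le (hf.sub hg).aestronglyMeasurable
    (hg.sub hh).aestronglyMeasurable (by norm_num)) le_rfl

lemma curl_sub {f g : R3 → R3} (hf : ContDiff ℝ ∞ f) (hg : ContDiff ℝ ∞ g) :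
    curl (fun x => f x - g x) = fun x => curl f x - curl g x := by
  have hfg : ContDiff ℝ ∞ fun x => f x - g x := hf.sub hg
  ext x i
  have hd (j : Fin 3) : Differentiable ℝ (fun y => f y j) := (hf.coord j).differentiable_infty
  have hd' (j : Fin 3) : Differentiable ℝ (fun y => g y j) := (hg.coord j).differentiable_infty
  rw [PiLp.sub_apply, curl_apply hfg, curl_apply hf, curl_apply hg]
  simp only [PiLp.sub_apply]
  rw [pd_sub (hd _) (hd' _), pd_sub (hd _) (hd' _)]
  ring

/-- A field that vanishes outside a `C²` domain and whose iterated weak curls on all of `ℝ³` are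
square integrable is approximated, together with these curls, by test fields in the domain. -/
theorem exists_test_approx {Ω : Opens R3} (hb : Bornology.IsBounded (Ω : Set R3))
    (hΩ : HasC2Boundary Ω) {a b t : R3 → R3} (ha : MemLp a 2 volume) (hb2 : MemLp b 2 volume)
    (ht : MemLp t 2 volume) (ham : StronglyMeasurable a) (hbm : StronglyMeasurable b)
    (htm : StronglyMeasurable t) (hab : HasWeakCurl a b) (hbt : HasWeakCurl b t)
    (ha0 : ∀ x ∉ Ω, a x = 0) {η : ENNReal} (hη : 0 < η) :
    ∃ ψ : R3 → R3, IsTest ψ ∧ tsupport ψ ⊆ Ω ∧ eLpNorm (fun x => ψ x - a x) 2 volume ≤ η ∧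
      eLpNorm (fun x => curl ψ x - b x) 2 volume ≤ η ∧
      eLpNorm (fun x => curl (curl ψ) x - t x) 2 volume ≤ η := by
  obtain ⟨X, hX, ε₀, hε₀, hout⟩ := exists_outward_field hb hΩ
  obtain ⟨B, hB⟩ := exists_tameMap_shift hX
  -- `K` dominates the pullback bounds for the field, its curl and its iterated curl. It is fixed
  -- before `ε`; the factor `24` is `8 · 3`, and the summand `1` keeps `K` positive.
  set K : ENNReal := ENNReal.ofReal (9 * B) * 8 + ENNReal.ofReal (18 * B ^ 2) * 8 +
    ENNReal.ofReal (72 * B ^ 2) * 8 + ENNReal.ofReal (12 * B ^ 3) * 24 + 1 with hK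
  have hKtop : K ≠ ⊤ := by
    rw [hK]
    simp [ENNReal.mul_eq_top]
  have hK1 : 1 ≤ 4 * K := by
    calc (1 : ENNReal) ≤ K := le_add_self
      _ = 1 * K := (one_mul K).symm
      _ ≤ 4 * K := by gcongr; norm_num
  have hK0 : 4 * K ≠ 0 := (zero_lt_one.trans_le hK1).ne'
  have hK4 : 4 * K ≠ ⊤ := ENNReal.mul_ne_top (by norm_num) hKtop
  have hη3 : 0 < η / 3 := ENNReal.div_pos hη.ne' (by norm_num)
  -- Two mollifications differ by at most `2 η₁` and the pullback multiplies this by at most `K`, so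
  -- `4 K η₁ = η/3` leaves room.
  set η₁ : ENNReal := η / 3 / (4 * K) with hη₁
  have hη₁0 : 0 < η₁ := ENNReal.div_pos hη3.ne' hK4
  have hη₁K : 4 * K * η₁ = η / 3 := ENNReal.mul_div_cancel hK0 hK4
  have hη₁3 : η₁ ≤ η / 3 := by
    rw [← hη₁K]
    exact le_mul_of_one_le_left zero_le hK1
  obtain ⟨δa, hδa, Ha⟩ := exists_mollField_close ha ham hη₁0
  obtain ⟨δb, hδb, Hb⟩ := exists_mollField_close hb2 hbm hη₁0
  obtain ⟨δt, hδt, Ht⟩ := exists_mollField_close ht htm hη₁0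
  have hbK : IsCompact (closure (Ω : Set R3)) :=
    Metric.isCompact_of_isClosed_isBounded isClosed_closure hb.closure
  have ha0' : ∀ x ∉ closure (Ω : Set R3), a x = 0 := fun x hx => ha0 x fun h => hx (subset_closure h)
  have hmt {δ : ℝ} {ρ : R3 → ℝ} (hρ : IsKernel δ ρ) : IsTest (mollField ρ a) :=
    ⟨contDiff_mollField hρ.isTest ha, HasCompactSupport.of_support_subset_isCompact
      (hbK.cthickening (r := δ)) ((subset_tsupport _).trans (tsupport_mollField_subset ha0' hρ))⟩
  have hc1 {δ : ℝ} {ρ : R3 → ℝ} (hρ : IsKernel δ ρ) : curl (mollField ρ a) = mollField ρ b :=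
    curl_mollField hρ.isTest ha hab
  have hc2 {δ : ℝ} {ρ : R3 → ℝ} (hρ : IsKernel δ ρ) : curl (curl (mollField ρ a)) =
      mollField ρ t := by rw [hc1 hρ, curl_mollField hρ.isTest hb2 hbt]
  set δ₀ : ℝ := min δa (min δb δt) with hδ₀
  have hδ₀pos : 0 < δ₀ := lt_min hδa (lt_min hδb hδt)
  have hδ₀a : δ₀ ≤ δa := min_le_left _ _
  have hδ₀b : δ₀ ≤ δb := (min_le_right _ _).trans (min_le_left _ _)
  have hδ₀t : δ₀ ≤ δt := (min_le_right _ _).trans (min_le_right _ _)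
  -- Two mollifications are needed. Convergence of pullbacks as `ε → 0` requires a fixed smooth
  -- field, whereas the mollification scale that keeps the pullback supported in `Ω` depends on `ε`.
  -- Hence `φ₁` determines `ε`, a finer `φ` is chosen afterwards, and the uniform pullback bound
  -- controls `φ - φ₁`.
  obtain ⟨ρ₁, hρ₁⟩ := exists_isKernel hδ₀pos
  set φ₁ := mollField ρ₁ a with hφ₁
  have hφ₁t : IsTest φ₁ := hmt hρ₁
  obtain ⟨T0, T1, T2⟩ := tendsto_pullback_shift hX hφ₁t
  have hpos : ∀ᶠ ε in 𝓝[>] (0 : ℝ), 0 < ε := eventually_mem_nhdsWithin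
  obtain ⟨ε, ⟨hεB, hεu⟩, hε0, hεε, c0, c1, c2⟩ := (hB.and (hpos.and
    ((eventually_nhdsWithin_of_eventually_nhds (eventually_lt_nhds hε₀)).and
    ((T0.eventually_le_const hη3).and ((T1.eventually_le_const hη3).and
    (T2.eventually_le_const hη3)))))).exists
  set Φ := shift X ε with hΦ
  obtain ⟨δ, hδ, hsub, hcpt⟩ := exists_thickening_preimage_subset hb hεB.antilipschitz hεu
    (hout ε hε0 hεε)
  obtain ⟨ρ, hρ⟩ := exists_isKernel (lt_min hδ hδ₀pos)
  have hρδ : min δ δ₀ ≤ δ := min_le_left _ _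
  have hρδ₀ : min δ δ₀ ≤ δ₀ := min_le_right _ _
  set φ := mollField ρ a with hφ
  have hφt : IsTest φ := hmt hρ
  have hsupp : tsupport (pullback Φ φ) ⊆ Φ ⁻¹' Metric.cthickening δ (closure (Ω : Set R3)) := by
    refine closure_minimal ((support_pullback_subset Φ φ).trans fun x hx => ?_) hcpt.isClosed
    have h1 : Φ x ∈ tsupport φ := subset_tsupport φ hx
    have h2 : tsupport φ ⊆ Metric.cthickening (min δ δ₀) (closure (Ω : Set R3)) :=
      tsupport_mollField_subset ha0' hρ
    exact Metric.cthickening_mono hρδ (closure (Ω : Set R3)) (h2 h1)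
  have hψs : ContDiff ℝ ∞ (pullback Φ φ) := hεB.smooth.pullback hφt.smooth
  have hψ₁s : ContDiff ℝ ∞ (pullback Φ φ₁) := hεB.smooth.pullback hφ₁t.smooth
  have hdt : IsTest (fun x => φ x - φ₁ x) :=
    ⟨hφt.smooth.sub hφ₁t.smooth, hφt.compact.sub hφ₁t.compact⟩
  have two {f g h : R3 → R3} (hf : AEStronglyMeasurable f volume)
      (hg : AEStronglyMeasurable g volume) (hh : AEStronglyMeasurable h volume)
      (h1 : eLpNorm (fun x => f x - h x) 2 volume ≤ η₁)
      (h2 : eLpNorm (fun x => g x - h x) 2 volume ≤ η₁) :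
      eLpNorm (fun x => f x - g x) 2 volume ≤ 2 * η₁ := by
    have e : (fun x => f x - g x) = (fun x => f x - h x) - fun x => g x - h x := by
      ext1 x
      simp only [Pi.sub_apply]
      abel
    rw [e, two_mul]
    exact (eLpNorm_sub_le (hf.sub hh) (hg.sub hh) (by norm_num)).trans (add_le_add h1 h2)
  have hms (f : R3 → R3) (hf : ContDiff ℝ ∞ f) : AEStronglyMeasurable f volume :=
    hf.continuous.aestronglyMeasurable
  have d0 : eLpNorm (fun x => φ x - φ₁ x) 2 volume ≤ 2 * η₁ :=
    two (hms _ hφt.smooth) (hms _ hφ₁t.smooth) ha.1 (Ha _ (hρδ₀.trans hδ₀a) ρ hρ)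
      (Ha _ hδ₀a ρ₁ hρ₁)
  have d1 : eLpNorm (curl fun x => φ x - φ₁ x) 2 volume ≤ 2 * η₁ := by
    rw [curl_sub hφt.smooth hφ₁t.smooth]
    refine two (hms _ hφt.curl.smooth) (hms _ hφ₁t.curl.smooth) hb2.1 ?_ ?_
    · rw [hφ, hc1 hρ]; exact Hb _ (hρδ₀.trans hδ₀b) ρ hρ
    · rw [hφ₁, hc1 hρ₁]; exact Hb _ hδ₀b ρ₁ hρ₁
  have d2 : eLpNorm (curl (curl fun x => φ x - φ₁ x)) 2 volume ≤ 2 * η₁ := by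
    rw [curl_sub hφt.smooth hφ₁t.smooth, curl_sub hφt.curl.smooth hφ₁t.curl.smooth]
    refine two (hms _ hφt.curl.curl.smooth) (hms _ hφ₁t.curl.curl.smooth) ht.1 ?_ ?_
    · rw [hφ, hc2 hρ]; exact Ht _ (hρδ₀.trans hδ₀t) ρ hρ
    · rw [hφ₁, hc2 hρ₁]; exact Ht _ hδ₀t ρ₁ hρ₁
  have p0 := hεB.eLpNorm_pullback_le hdt.smooth.continuous
  have p1 := hεB.eLpNorm_curl_pullback_le hdt.smooth
  have p2 := hεB.eLpNorm_curl_curl_pullback_le hdt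
  rw [pullback_sub] at p0 p1 p2
  rw [curl_sub hψs hψ₁s] at p1 p2
  rw [curl_sub hψs.curl hψ₁s.curl] at p2
  -- The three thirds are the pullback of `φ - φ₁`, the difference between `φ₁` and its pullback,
  -- and the mollification error of `φ₁`.
  have fin {x y z : ENNReal} (hx : x ≤ 4 * K * η₁) (hy : y ≤ η / 3) (hz : z ≤ η₁) :
      x + y + z ≤ η := by
    calc x + y + z ≤ η / 3 + η / 3 + η / 3 :=
          add_le_add (add_le_add (hx.trans_eq hη₁K) hy) (hz.trans hη₁3)
      _ = η := ENNReal.add_thirds η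
  have kb (c : ENNReal) (hc : c ≤ K) : c * (2 * η₁) ≤ 4 * K * η₁ := by
    calc c * (2 * η₁) ≤ K * (2 * η₁) := by gcongr
      _ = 2 * (K * η₁) := by ring
      _ ≤ 4 * (K * η₁) := by gcongr; norm_num
      _ = _ := by ring
  refine ⟨pullback Φ φ, ⟨hψs, HasCompactSupport.of_support_subset_isCompact hcpt
    ((subset_tsupport _).trans hsupp)⟩, hsupp.trans hsub, ?_, ?_, ?_⟩
  · refine (eLpNorm_triangle hψs.continuous hψ₁s.continuous hφ₁t.smooth.continuous ha.1).trans
      (fin (p0.trans ?_) c0 (Ha _ hδ₀a ρ₁ hρ₁))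
    rw [← mul_assoc]
    refine (mul_le_mul_right d0 _).trans (kb _ ?_)
    rw [hK, add_assoc, add_assoc, add_assoc]
    exact le_self_add
  · refine (eLpNorm_triangle hψs.curl.continuous hψ₁s.curl.continuous
      hφ₁t.curl.smooth.continuous hb2.1).trans (fin (p1.trans ?_) c1 ?_)
    · rw [← mul_assoc]
      refine (mul_le_mul_right d1 _).trans (kb _ ?_)
      rw [hK, add_assoc, add_assoc]
      exact le_add_right le_add_self
    · rw [hφ₁, hc1 hρ₁]; exact Hb _ hδ₀b ρ₁ hρ₁
  · refine (eLpNorm_triangle hψs.curl.curl.continuous hψ₁s.curl.curl.continuous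
      hφ₁t.curl.curl.smooth.continuous ht.1).trans (fin (p2.trans ?_) c2 ?_)
    · calc _ ≤ ENNReal.ofReal (72 * B ^ 2) * (8 * (2 * η₁)) +
            ENNReal.ofReal (12 * B ^ 3) * (8 * (3 * (2 * η₁))) := by gcongr
        _ = (ENNReal.ofReal (72 * B ^ 2) * 8 + ENNReal.ofReal (12 * B ^ 3) * 24) * (2 * η₁) := by
          ring
        _ ≤ _ := kb _ (by
          rw [hK, add_assoc (ENNReal.ofReal (9 * B) * 8 + ENNReal.ofReal (18 * B ^ 2) * 8)]
          exact le_add_right le_add_self)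
    · rw [hφ₁, hc2 hρ₁]; exact Ht _ hδ₀t ρ₁ hρ₁

end Density

/-! ### The real variational problem -/

section RealProblem

open Filter Topology

/-- Real square integrable vector fields on `Ω`. -/
abbrev RealL2 (Ω : Opens R3) : Type := Lp R3 2 (volume.restrict (Ω : Set R3))

/-- Triples `(u, c, t)` of real square integrable fields; `c` and `t` are to be the curl and the
iterated curl of `u`. -/
abbrev Triple (Ω : Opens R3) : Type := PiLp 2 fun _ : Fin 3 => RealL2 Ω

/-- The class of a test field in `L²(Ω)³`. -/
noncomputable def IsTest.toL2 {f : R3 → R3} (hf : IsTest f) (Ω : Opens R3) : RealL2 Ω :=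
  (hf.memLp 2 (volume.restrict (Ω : Set R3))).toLp

lemma IsTest.coeFn_toL2 {f : R3 → R3} (hf : IsTest f) (Ω : Opens R3) :
    hf.toL2 Ω =ᵐ[volume.restrict (Ω : Set R3)] f := (hf.memLp 2 _).coeFn_toLp

lemma inner_toL2 {Ω : Opens R3} {f : R3 → R3} (hf : IsTest f) (u : RealL2 Ω) :
    inner ℝ u (hf.toL2 Ω) = ∫ x in (Ω : Set R3), inner ℝ (u x) (f x) := by
  rw [L2.inner_def]
  refine integral_congr_ae ?_
  filter_upwards [hf.coeFn_toL2 Ω] with x hx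
  rw [hx]

/-- The triple of a test field. -/
noncomputable def IsTest.triple {f : R3 → R3} (hf : IsTest f) (Ω : Opens R3) : Triple Ω :=
  WithLp.toLp 2 ![hf.toL2 Ω, hf.curl.toL2 Ω, hf.curl.curl.toL2 Ω]

/-- `c` is the distributional curl of `u` in `Ω`. -/
def RealWeakCurl (Ω : Opens R3) (u c : RealL2 Ω) : Prop :=
  ∀ f : R3 → R3, ∀ hf : IsTest f, tsupport f ⊆ Ω →
    inner ℝ c (hf.toL2 Ω) = inner ℝ u (hf.curl.toL2 Ω)

/-- `c` is the distributional curl of `u` in `Ω` and `u × ν = 0` on `∂Ω`. -/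
def RealWeakCurlZero (Ω : Opens R3) (u c : RealL2 Ω) : Prop :=
  ∀ f : R3 → R3, ∀ hf : IsTest f, inner ℝ c (hf.toL2 Ω) = inner ℝ u (hf.curl.toL2 Ω)

lemma RealWeakCurlZero.realWeakCurl {Ω : Opens R3} {u c : RealL2 Ω} (h : RealWeakCurlZero Ω u c) :
    RealWeakCurl Ω u c := fun f hf _ => h f hf

/-- The triples with vanishing tangential traces. -/
noncomputable def zeroTrace (Ω : Opens R3) : Submodule ℝ (Triple Ω) where
  carrier := {x | RealWeakCurlZero Ω (x 0) (x 1) ∧ RealWeakCurlZero Ω (x 1) (x 2)}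
  add_mem' {x y} hx hy := by
    refine ⟨fun f hf => ?_, fun f hf => ?_⟩
    · rw [PiLp.add_apply, PiLp.add_apply, inner_add_left, inner_add_left, hx.1 f hf, hy.1 f hf]
    · rw [PiLp.add_apply, PiLp.add_apply, inner_add_left, inner_add_left, hx.2 f hf, hy.2 f hf]
  zero_mem' := by
    refine ⟨fun f hf => ?_, fun f hf => ?_⟩ <;> simp
  smul_mem' a x hx := by
    refine ⟨fun f hf => ?_, fun f hf => ?_⟩
    · rw [PiLp.smul_apply, PiLp.smul_apply, inner_smul_left, inner_smul_left, hx.1 f hf]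
    · rw [PiLp.smul_apply, PiLp.smul_apply, inner_smul_left, inner_smul_left, hx.2 f hf]

lemma mem_zeroTrace {Ω : Opens R3} {x : Triple Ω} :
    x ∈ zeroTrace Ω ↔ RealWeakCurlZero Ω (x 0) (x 1) ∧ RealWeakCurlZero Ω (x 1) (x 2) := Iff.rfl

lemma isClosed_zeroTrace (Ω : Opens R3) : IsClosed (zeroTrace Ω : Set (Triple Ω)) := by
  have : (zeroTrace Ω : Set (Triple Ω)) =
      (⋂ (f : R3 → R3) (hf : IsTest f),
        {x : Triple Ω | inner ℝ (x 1) (hf.toL2 Ω) = inner ℝ (x 0) (hf.curl.toL2 Ω)}) ∩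
      ⋂ (f : R3 → R3) (hf : IsTest f),
        {x : Triple Ω | inner ℝ (x 2) (hf.toL2 Ω) = inner ℝ (x 1) (hf.curl.toL2 Ω)} := by
    ext x
    simp only [SetLike.mem_coe, mem_zeroTrace, RealWeakCurlZero, Set.mem_inter_iff, Set.mem_iInter,
      Set.mem_ofPred_eq]
  rw [this]
  refine (isClosed_iInter fun f => isClosed_iInter fun hf => isClosed_eq ?_ ?_).inter
    (isClosed_iInter fun f => isClosed_iInter fun hf => isClosed_eq ?_ ?_) <;> fun_prop

lemma realWeakCurlZero_test {Ω : Opens R3} {f : R3 → R3} (hf : IsTest f) (hfs : tsupport f ⊆ Ω) :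
    RealWeakCurlZero Ω (hf.toL2 Ω) (hf.curl.toL2 Ω) := by
  intro g hg
  have key {p q : R3 → R3} (hp : IsTest p) (hq : IsTest q) (hps : tsupport p ⊆ Ω) :
      inner ℝ (hp.toL2 Ω) (hq.toL2 Ω) = ∫ x, inner ℝ (p x) (q x) := by
    rw [inner_toL2, ← setIntegral_eq_integral_of_forall_compl_eq_zero (s := (Ω : Set R3))
      (f := fun x => inner ℝ (p x) (q x))]
    · refine integral_congr_ae ?_
      filter_upwards [hp.coeFn_toL2 Ω] with x hx
      rw [hx]
    · intro x hx
      rw [image_eq_zero_of_notMem_tsupport fun h => hx (hps h), inner_zero_left]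
  rw [key hf.curl hg ((tsupport_curl_subset f).trans hfs), key hf hg.curl hfs,
    integral_inner_curl hf hg]

lemma IsTest.triple_mem {Ω : Opens R3} {f : R3 → R3} (hf : IsTest f) (hfs : tsupport f ⊆ Ω) :
    hf.triple Ω ∈ zeroTrace Ω :=
  ⟨realWeakCurlZero_test hf hfs,
    realWeakCurlZero_test hf.curl ((tsupport_curl_subset f).trans hfs)⟩

lemma norm_toL2_sub_le {Ω : Opens R3} {f : R3 → R3} (hf : IsTest f) (u : RealL2 Ω) {ε : ℝ}
    (hε : 0 ≤ ε) (h : eLpNorm (fun x => f x - (Ω : Set R3).indicator u x) 2 volume ≤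
      ENNReal.ofReal ε) : ‖hf.toL2 Ω - u‖ ≤ ε := by
  rw [Lp.norm_def]
  have e : eLpNorm (hf.toL2 Ω - u : RealL2 Ω) 2 (volume.restrict (Ω : Set R3)) =
      eLpNorm (fun x => f x - (Ω : Set R3).indicator u x) 2 (volume.restrict (Ω : Set R3)) := by
    refine eLpNorm_congr_ae ?_
    filter_upwards [Lp.coeFn_sub (hf.toL2 Ω) u, hf.coeFn_toL2 Ω,
      ae_restrict_mem Ω.2.measurableSet] with x h1 h2 h3
    rw [h1, Pi.sub_apply, h2, Set.indicator_of_mem h3]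
  rw [e]
  exact ENNReal.toReal_le_of_le_ofReal hε ((eLpNorm_restrict_le _ _ _ _).trans h)

lemma memLp_indicator_realL2 {Ω : Opens R3} (u : RealL2 Ω) :
    MemLp ((Ω : Set R3).indicator u) 2 volume :=
  (memLp_indicator_iff_restrict Ω.2.measurableSet).2 (Lp.memLp u)

lemma integral_inner_indicator {Ω : Opens R3} (v : RealL2 Ω) {g : R3 → R3} (hg : IsTest g) :
    ∫ x, inner ℝ ((Ω : Set R3).indicator v x) (g x) = inner ℝ v (hg.toL2 Ω) := by
  rw [inner_toL2, ← integral_indicator (s := (Ω : Set R3)) Ω.2.measurableSet]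
  refine integral_congr_ae (Eventually.of_forall fun x => ?_)
  by_cases hx : x ∈ (Ω : Set R3)
  · simp only [Set.indicator_of_mem hx]
  · simp only [Set.indicator_of_notMem hx, inner_zero_left]

/-- Testing with fields that are unrestricted at `∂Ω` leaves no boundary term, so extension by zero
creates no singular curl on the boundary. -/
lemma RealWeakCurlZero.hasWeakCurl {Ω : Opens R3} {u c : RealL2 Ω} (h : RealWeakCurlZero Ω u c) :
    HasWeakCurl ((Ω : Set R3).indicator u) ((Ω : Set R3).indicator c) := by
  intro f hf
  rw [integral_inner_indicator c hf, integral_inner_indicator u hf.curl, h f hf]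

/-- Test triples are dense among the triples with vanishing traces. -/
lemma zeroTrace_induction {Ω : Opens R3} (hb : Bornology.IsBounded (Ω : Set R3))
    (hΩ : HasC2Boundary Ω) {P : Triple Ω → Prop} (hP : IsClosed {x | P x})
    (h : ∀ f : R3 → R3, ∀ hf : IsTest f, tsupport f ⊆ Ω → P (hf.triple Ω)) {x : Triple Ω}
    (hx : x ∈ zeroTrace Ω) : P x := by
  refine hP.closure_subset (Metric.mem_closure_iff.2 fun ε hε => ?_)
  have hsm (u : RealL2 Ω) : StronglyMeasurable ((Ω : Set R3).indicator u) :=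
    (Lp.stronglyMeasurable u).indicator Ω.2.measurableSet
  obtain ⟨f, hf, hfs, h0, h1, h2⟩ := exists_test_approx hb hΩ (memLp_indicator_realL2 (x 0))
    (memLp_indicator_realL2 (x 1)) (memLp_indicator_realL2 (x 2)) (hsm _) (hsm _) (hsm _)
    hx.1.hasWeakCurl hx.2.hasWeakCurl (fun y hy => Set.indicator_of_notMem hy _)
    (η := ENNReal.ofReal (ε / 2)) (by simpa using hε)
  refine ⟨hf.triple Ω, h f hf hfs, ?_⟩
  rw [dist_comm, dist_eq_norm]
  refine lt_of_pow_lt_pow_left₀ 2 hε.le ?_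
  rw [PiLp.norm_sq_eq_of_L2, Fin.sum_univ_three]
  have e0 := norm_toL2_sub_le hf (x 0) (by positivity) h0
  have e1 := norm_toL2_sub_le hf.curl (x 1) (by positivity) h1
  have e2 := norm_toL2_sub_le hf.curl.curl (x 2) (by positivity) h2
  -- Three components within `ε/2` give a squared distance of at most `3ε²/4`.
  have b {r : ℝ} (hr : 0 ≤ r) (h : r ≤ ε / 2) : r ^ 2 ≤ (ε / 2) ^ 2 := pow_le_pow_left₀ hr h 2
  have c0 := b (norm_nonneg _) e0
  have c1 := b (norm_nonneg _) e1
  have c2 := b (norm_nonneg _) e2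
  simp only [PiLp.sub_apply]
  change ‖hf.toL2 Ω - x 0‖ ^ 2 + ‖hf.curl.toL2 Ω - x 1‖ ^ 2 + ‖hf.curl.curl.toL2 Ω - x 2‖ ^ 2 < _
  nlinarith [sq_pos_of_pos hε]

/-- Green's formula for test fields, extended by density. -/
lemma zeroTrace_norm_sq {Ω : Opens R3} {x : Triple Ω} (hb : Bornology.IsBounded (Ω : Set R3))
    (hΩ : HasC2Boundary Ω) (hx : x ∈ zeroTrace Ω) : ‖x 1‖ ^ 2 = inner ℝ (x 0) (x 2) := by
  rw [← real_inner_self_eq_norm_sq]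
  refine zeroTrace_induction hb hΩ (P := fun x => inner ℝ (x 1) (x 1) = inner ℝ (x 0) (x 2))
    (isClosed_eq (by fun_prop) (by fun_prop)) (fun f hf hfs => ?_) hx
  exact realWeakCurlZero_test hf hfs _ hf.curl

/-- The bound for curls of test fields passes to the limit. It controls the indefinite term `k² ⟨u,
curl curl u⟩` of the form. -/
lemma zeroTrace_eigenvalue_mul_le {Ω : Opens R3} {x : Triple Ω}
    (hb : Bornology.IsBounded (Ω : Set R3)) (hne : (Ω : Set R3).Nonempty)
    (hΩ : HasC2Boundary Ω) (hx : x ∈ zeroTrace Ω) :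
    firstDirichletEigenvalue Ω * ‖x 1‖ ^ 2 ≤ ‖x 2‖ ^ 2 := by
  refine zeroTrace_induction hb hΩ
    (P := fun x => firstDirichletEigenvalue Ω * ‖x 1‖ ^ 2 ≤ ‖x 2‖ ^ 2)
    (isClosed_le (by fun_prop) (by fun_prop)) (fun f hf hfs => ?_) hx
  have h1 := (tsupport_curl_subset f).trans hfs
  change _ * ‖hf.curl.toL2 Ω‖ ^ 2 ≤ ‖hf.curl.curl.toL2 Ω‖ ^ 2
  rw [norm_sq_eq_integral_of_ae_eq h1 (hf.curl.coeFn_toL2 Ω),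
    norm_sq_eq_integral_of_ae_eq ((tsupport_curl_subset _).trans h1) (hf.curl.curl.coeFn_toL2 Ω)]
  exact firstDirichletEigenvalue_mul_curl_le hb hne hf hfs

/-- Test fields are total in `L²(Ω)³`. -/
lemma realL2_eq_zero {Ω : Opens R3} {u : RealL2 Ω}
    (h : ∀ f : R3 → R3, ∀ hf : IsTest f, tsupport f ⊆ Ω → inner ℝ u (hf.toL2 Ω) = 0) : u = 0 := by
  have hloc := (memLp_indicator_realL2 u).locallyIntegrable (by norm_num)
  have h0 : ∀ᵐ x, x ∈ (Ω : Set R3) → (Ω : Set R3).indicator u x = 0 := by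
    refine Ω.2.ae_eq_zero_of_integral_contDiff_smul_eq_zero (hloc.locallyIntegrableOn _)
      fun g hg hgc hgs => ext_inner_left ℝ fun v => ?_
    have hf : IsTest fun x => g x • v := ⟨hg.smul contDiff_const, hgc.smul_right⟩
    rw [inner_zero_right, ← integral_inner (hloc.integrable_smul_left_of_hasCompactSupport
      hg.continuous hgc), ← h _ hf ((tsupport_smul_subset_left g fun _ => v).trans hgs),
      ← integral_inner_indicator]
    refine integral_congr_ae (Eventually.of_forall fun x => ?_)
    simp only [real_inner_smul_right]
    rw [real_inner_comm]
  rw [Lp.eq_zero_iff_ae_eq_zero]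
  filter_upwards [ae_restrict_of_ae h0, ae_restrict_mem Ω.2.measurableSet] with x h1 h2
  rw [← Set.indicator_of_mem h2 u, h1 h2, Pi.zero_apply]

end RealProblem

/-! ### The coercive form -/

section Form

open Filter Topology

/-- Multiplication by a bounded function on `L²(Ω)³`. -/
noncomputable def mulOp {Ω : Opens R3} {g : R3 → ℝ}
    (hg : MemLp g ⊤ (volume.restrict (Ω : Set R3))) : RealL2 Ω →L[ℝ] RealL2 Ω :=
  (ContinuousLinearMap.lsmul ℝ ℝ).holderL (volume.restrict (Ω : Set R3)) ⊤ 2 2 (hg.toLp g)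

lemma coeFn_mulOp {Ω : Opens R3} {g : R3 → ℝ} (hg : MemLp g ⊤ (volume.restrict (Ω : Set R3)))
    (u : RealL2 Ω) : mulOp hg u =ᵐ[volume.restrict (Ω : Set R3)] fun x => g x • u x := by
  have h : mulOp hg u =ᵐ[volume.restrict (Ω : Set R3)]
      fun x => ContinuousLinearMap.lsmul ℝ ℝ (hg.toLp g x) (u x) :=
    ContinuousLinearMap.coeFn_holder _ _ _
  filter_upwards [h, hg.coeFn_toLp] with x h1 h2
  rw [h1, h2, ContinuousLinearMap.lsmul_apply]

lemma mul_norm_sq_le_inner_mulOp {Ω : Opens R3} {g : R3 → ℝ}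
    (hg : MemLp g ⊤ (volume.restrict (Ω : Set R3))) {γ : ℝ}
    (h : ∀ᵐ x ∂(volume.restrict (Ω : Set R3)), γ ≤ g x) (u : RealL2 Ω) :
    γ * ‖u‖ ^ 2 ≤ inner ℝ (mulOp hg u) u := by
  rw [← real_inner_self_eq_norm_sq, ← real_inner_smul_left, L2.inner_def, L2.inner_def]
  refine integral_mono_ae (L2.integrable_inner _ _) (L2.integrable_inner _ _) ?_
  filter_upwards [coeFn_mulOp hg u, Lp.coeFn_smul γ u, h] with x h1 h2 h3
  simp only [h1, h2, Pi.smul_apply, real_inner_smul_left]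
  exact mul_le_mul_of_nonneg_right h3 real_inner_self_nonneg

lemma mulOp_one {Ω : Opens R3} (u : RealL2 Ω) :
    mulOp (memLp_top_const (μ := volume.restrict (Ω : Set R3)) (1 : ℝ)) u = u := by
  refine Lp.ext ?_
  filter_upwards [coeFn_mulOp (memLp_top_const (1 : ℝ)) u] with x hx
  rw [hx, one_smul]

/-- Young's inequality `2γtu ≤ (γ²/ε) t² + ε u²` with `ε` strictly between `γ²/(γ - κ)` and `1 + γ`;
this interval is nonempty exactly when `κ (1 + γ) < γ`. In use `t`, `u`, `p` are `‖curl curl u‖`,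
`k² ‖u‖` and `k² ⟨u, curl curl u⟩`. -/
lemma exists_coercive_gt {κ γ : ℝ} (hγ : 0 < γ) (hκ0 : 0 ≤ κ) (hκ : κ * (1 + γ) < γ) :
    ∃ α > 0, ∀ t u p : ℝ, p ≤ t * u → p ≤ κ * t ^ 2 →
      α * (t ^ 2 + u ^ 2) ≤ γ * t ^ 2 + (1 + γ) * u ^ 2 - (1 + 2 * γ) * p := by
  have h1 : 0 < γ - κ := by nlinarith
  have h2 : γ ^ 2 / (γ - κ) < 1 + γ := by
    rw [div_lt_iff₀ h1]; nlinarith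
  obtain ⟨ε, hε1, hε2⟩ := exists_between h2
  have hε : 0 < ε := lt_of_le_of_lt (by positivity) hε1
  have h3 : γ ^ 2 / ε < γ - κ := by
    rw [div_lt_iff₀ hε]
    rw [div_lt_iff₀ h1] at hε1
    linarith
  refine ⟨min (γ - κ - γ ^ 2 / ε) (1 + γ - ε), lt_min (by linarith) (by linarith),
    fun t u p hp hpκ => ?_⟩
  have h4 : 2 * γ * (t * u) ≤ γ ^ 2 / ε * t ^ 2 + ε * u ^ 2 := by
    have : γ ^ 2 / ε * t ^ 2 + ε * u ^ 2 - 2 * γ * (t * u) = (γ * t - ε * u) ^ 2 / ε := by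
      field_simp
      ring
    have h5 : 0 ≤ (γ * t - ε * u) ^ 2 / ε := by positivity
    linarith
  have h5 : 2 * γ * p ≤ 2 * γ * (t * u) := by gcongr
  have h6 := mul_le_mul_of_nonneg_right (min_le_left (γ - κ - γ ^ 2 / ε) (1 + γ - ε)) (sq_nonneg t)
  have h7 := mul_le_mul_of_nonneg_right (min_le_right (γ - κ - γ ^ 2 / ε) (1 + γ - ε)) (sq_nonneg u)
  nlinarith

/-- The part `t² - p ≥ (1 - κ) t²` controls `t`. The bracket is at least `u²/2 - t²`, so a small
multiple of it controls `u`; reducing `γ` to at most `(1 - κ)/2` lets the first part pay for the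
loss. -/
lemma exists_coercive_lt {κ γ : ℝ} (hγ : 0 < γ) (hκ : κ < 1) :
    ∃ α > 0, ∀ t u p : ℝ, p ≤ t * u → p ≤ κ * t ^ 2 →
      α * (t ^ 2 + u ^ 2) ≤ γ * (t ^ 2 - 2 * p + u ^ 2) + t ^ 2 - p := by
  set γ' := min γ ((1 - κ) / 2) with hγ'
  have h0 : 0 < γ' := lt_min hγ (by linarith)
  refine ⟨γ' / 2, by positivity, fun t u p hp hpκ => ?_⟩
  have h1 : 0 ≤ t ^ 2 - 2 * p + u ^ 2 := by nlinarith [sq_nonneg (t - u)]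
  have h2 := mul_le_mul_of_nonneg_right (min_le_left γ ((1 - κ) / 2)) h1
  have h3 := mul_le_mul_of_nonneg_right (min_le_right γ ((1 - κ) / 2)) (sq_nonneg t)
  rw [← hγ'] at h2 h3
  have h4 : γ' * (u ^ 2 / 2 - t ^ 2) ≤ γ' * (t ^ 2 - 2 * p + u ^ 2) := by
    refine mul_le_mul_of_nonneg_left ?_ h0.le
    nlinarith [sq_nonneg (2 * t - u)]
  nlinarith

/-- The map `(u, c, t) ↦ m (t - k² u)`. -/
noncomputable def fluxOp {Ω : Opens R3} {m : R3 → ℝ}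
    (hm : MemLp m ⊤ (volume.restrict (Ω : Set R3))) (k : ℝ) : Triple Ω →L[ℝ] RealL2 Ω :=
  (mulOp hm).comp (PiLp.proj 2 (fun _ : Fin 3 => RealL2 Ω) 2 -
    k ^ 2 • PiLp.proj 2 (fun _ : Fin 3 => RealL2 Ω) 0)

lemma fluxOp_apply {Ω : Opens R3} {m : R3 → ℝ} (hm : MemLp m ⊤ (volume.restrict (Ω : Set R3)))
    (k : ℝ) (x : Triple Ω) : fluxOp hm k x = mulOp hm (x 2 - k ^ 2 • x 0) := rfl

/-- The form `⟨m (t - k² u), s⟩ - k² ⟨n m (t - k² u), v⟩` at `(u, c, t)` and `(v, d, s)`. -/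
noncomputable def transmissionForm {Ω : Opens R3} {n m : R3 → ℝ}
    (hn : MemLp n ⊤ (volume.restrict (Ω : Set R3)))
    (hm : MemLp m ⊤ (volume.restrict (Ω : Set R3))) (k : ℝ) : Triple Ω →L[ℝ] Triple Ω →L[ℝ] ℝ :=
  (innerSL ℝ).bilinearComp (fluxOp hm k) (PiLp.proj 2 (fun _ : Fin 3 => RealL2 Ω) 2) -
    k ^ 2 • (innerSL ℝ).bilinearComp ((mulOp hn).comp (fluxOp hm k))
      (PiLp.proj 2 (fun _ : Fin 3 => RealL2 Ω) 0)

lemma transmissionForm_apply {Ω : Opens R3} {n m : R3 → ℝ}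
    (hn : MemLp n ⊤ (volume.restrict (Ω : Set R3)))
    (hm : MemLp m ⊤ (volume.restrict (Ω : Set R3))) (k : ℝ) (x y : Triple Ω) :
    transmissionForm hn hm k x y = inner ℝ (fluxOp hm k x) (y 2) -
      k ^ 2 * inner ℝ (mulOp hn (fluxOp hm k x)) (y 0) := rfl

/-- `n m = 1 + m`, which removes `n` from the form. -/
lemma mulOp_mulOp {Ω : Opens R3} {n m : R3 → ℝ}
    (hn : MemLp n ⊤ (volume.restrict (Ω : Set R3))) (hm : MemLp m ⊤ (volume.restrict (Ω : Set R3)))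
    (hnm : ∀ᵐ x ∂(volume.restrict (Ω : Set R3)), m x * (n x - 1) = 1) (u : RealL2 Ω) :
    mulOp hn (mulOp hm u) = u + mulOp hm u := by
  refine Lp.ext ?_
  filter_upwards [coeFn_mulOp hn (mulOp hm u), coeFn_mulOp hm u, Lp.coeFn_add u (mulOp hm u), hnm]
    with x h1 h2 h3 h4
  rw [h1, h3, Pi.add_apply, h2, smul_smul]
  nth_rewrite 2 [← one_smul ℝ (u x)]
  rw [← add_smul]
  congr 1
  linarith

lemma mulOp_mulOp_sub {Ω : Opens R3} {n m : R3 → ℝ}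
    (hn : MemLp n ⊤ (volume.restrict (Ω : Set R3))) (hm : MemLp m ⊤ (volume.restrict (Ω : Set R3)))
    (hnm : ∀ᵐ x ∂(volume.restrict (Ω : Set R3)), m x * (n x - 1) = 1) (u : RealL2 Ω) :
    mulOp hm (mulOp hn u - u) = u := by
  refine Lp.ext ?_
  filter_upwards [coeFn_mulOp hm (mulOp hn u - u), coeFn_mulOp hn u, Lp.coeFn_sub (mulOp hn u) u,
    hnm] with x h1 h2 h3 h4
  rw [h1, h3, Pi.sub_apply, h2]
  nth_rewrite 2 [← one_smul ℝ (u x)]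
  rw [← sub_smul, smul_smul, h4, one_smul]

/-- The value of the form on the diagonal, in terms of `m`. -/
lemma transmissionForm_self {Ω : Opens R3} {n m : R3 → ℝ}
    (hn : MemLp n ⊤ (volume.restrict (Ω : Set R3))) (hm : MemLp m ⊤ (volume.restrict (Ω : Set R3)))
    (hnm : ∀ᵐ x ∂(volume.restrict (Ω : Set R3)), m x * (n x - 1) = 1) (k : ℝ) (x : Triple Ω) :
    transmissionForm hn hm k x x =
      inner ℝ (mulOp hm (x 2 - k ^ 2 • x 0)) (x 2 - k ^ 2 • x 0) -
        k ^ 2 * inner ℝ (x 0) (x 2) + (k ^ 2 * ‖x 0‖) ^ 2 := by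
  rw [transmissionForm_apply, fluxOp_apply, mulOp_mulOp hn hm hnm, inner_sub_right, inner_add_left,
    inner_sub_left (x 2), real_inner_smul_right, real_inner_smul_left, real_inner_self_eq_norm_sq,
    real_inner_comm (x 2) (x 0)]
  ring

lemma norm_sub_smul_sq {Ω : Opens R3} (k : ℝ) (x : Triple Ω) :
    ‖x 2 - k ^ 2 • x 0‖ ^ 2 =
      ‖x 2‖ ^ 2 - 2 * (k ^ 2 * inner ℝ (x 0) (x 2)) + (k ^ 2 * ‖x 0‖) ^ 2 := by
  rw [norm_sub_sq_real, real_inner_smul_right, real_inner_comm, norm_smul, Real.norm_eq_abs,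
    abs_of_nonneg (sq_nonneg k)]

/-- Lower bounds in terms of `‖t‖` and `k² ‖u‖` give lower bounds in terms of the norm. -/
lemma exists_coercive_of_bound {Ω : Opens R3} (hb : Bornology.IsBounded (Ω : Set R3))
    (hne : (Ω : Set R3).Nonempty) (hΩ : HasC2Boundary Ω) {k : ℝ} (hk : 0 < k)
    (hl : 0 < firstDirichletEigenvalue Ω) {α : ℝ} (hα : 0 < α) {Q : Triple Ω → ℝ}
    (hQ : ∀ x ∈ zeroTrace Ω, k ^ 2 * inner ℝ (x 0) (x 2) ≤ ‖x 2‖ * (k ^ 2 * ‖x 0‖) →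
      k ^ 2 * inner ℝ (x 0) (x 2) ≤ k ^ 2 / firstDirichletEigenvalue Ω * ‖x 2‖ ^ 2 →
      α * (‖x 2‖ ^ 2 + (k ^ 2 * ‖x 0‖) ^ 2) ≤ Q x) :
    ∃ β > 0, ∀ x ∈ zeroTrace Ω, β * ‖x‖ * ‖x‖ ≤ Q x := by
  set l := firstDirichletEigenvalue Ω with hldef
  -- The summands bound the parts of `‖x‖²`: `‖x 1‖²` by `‖x 2‖² / l`, and `‖x 0‖²` by `k⁻⁴ (k² ‖x
  -- 0‖)²`.
  have hK : 0 < 1 + 1 / l + 1 / k ^ 4 := by positivity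
  refine ⟨α / (1 + 1 / l + 1 / k ^ 4), by positivity, fun x hx => ?_⟩
  have h1 := zeroTrace_norm_sq hb hΩ hx
  have h2 := zeroTrace_eigenvalue_mul_le hb hne hΩ hx
  rw [← hldef] at h2
  have h3 := real_inner_le_norm (x 0) (x 2)
  have h2' : ‖x 1‖ ^ 2 ≤ 1 / l * ‖x 2‖ ^ 2 := by
    rw [one_div, ← div_eq_inv_mul, le_div_iff₀ hl]; linarith
  have h4 := hQ x hx (by nlinarith [sq_pos_of_pos hk]) (by
    rw [← h1]
    calc k ^ 2 * ‖x 1‖ ^ 2 ≤ k ^ 2 * (1 / l * ‖x 2‖ ^ 2) := by gcongr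
      _ = _ := by ring)
  refine le_trans ?_ h4
  rw [mul_assoc, ← sq, PiLp.norm_sq_eq_of_L2, Fin.sum_univ_three, div_mul_eq_mul_div, div_le_iff₀ hK,
    mul_assoc]
  refine mul_le_mul_of_nonneg_left ?_ hα.le
  have h5 : ‖x 0‖ ^ 2 = 1 / k ^ 4 * (k ^ 2 * ‖x 0‖) ^ 2 := by
    field_simp
  have h6 : 0 ≤ 1 / k ^ 4 * ‖x 2‖ ^ 2 := by positivity
  have h7 : 0 ≤ 1 / l * (k ^ 2 * ‖x 0‖) ^ 2 := by positivity
  nlinarith [sq_nonneg (k ^ 2 * ‖x 0‖), sq_nonneg ‖x 2‖]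

/-- For `κ = k²/λ₁` and `γ = 1/(S - 1)` the condition `κ (1 + γ) < γ` reads `k² S < λ₁`. -/
lemma transmissionForm_coercive_of_gt {Ω : Opens R3} (hb : Bornology.IsBounded (Ω : Set R3))
    (hne : (Ω : Set R3).Nonempty) (hΩ : HasC2Boundary Ω) {k : ℝ} (hk : 0 < k) {n m : R3 → ℝ}
    (hn : MemLp n ⊤ (volume.restrict (Ω : Set R3))) (hm : MemLp m ⊤ (volume.restrict (Ω : Set R3)))
    (hnm : ∀ᵐ x ∂(volume.restrict (Ω : Set R3)), m x * (n x - 1) = 1) {S : ℝ} (hS : 1 < S)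
    (hmS : ∀ᵐ x ∂(volume.restrict (Ω : Set R3)), 1 / (S - 1) ≤ m x)
    (hkS : k ^ 2 < firstDirichletEigenvalue Ω / S) :
    ∃ β > 0, ∀ x ∈ zeroTrace Ω, β * ‖x‖ * ‖x‖ ≤ transmissionForm hn hm k x x := by
  have hS0 : 0 < S - 1 := by linarith
  rw [lt_div_iff₀ (by linarith)] at hkS
  have hl : 0 < firstDirichletEigenvalue Ω := lt_of_le_of_lt (by positivity) hkS
  obtain ⟨α, hα, h⟩ := exists_coercive_gt (κ := k ^ 2 / firstDirichletEigenvalue Ω)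
    (γ := 1 / (S - 1)) (by positivity) (by positivity) (by
      rw [div_mul_eq_mul_div, div_lt_iff₀ hl]
      have : k ^ 2 * (1 + 1 / (S - 1)) = 1 / (S - 1) * (k ^ 2 * S) := by field_simp; ring
      rw [this]
      gcongr)
  refine exists_coercive_of_bound hb hne hΩ hk hl hα fun x hx h1 h2 => ?_
  refine (h _ _ _ h1 h2).trans ?_
  have h3 := mul_norm_sq_le_inner_mulOp hm hmS (x 2 - k ^ 2 • x 0)
  rw [norm_sub_smul_sq] at h3
  rw [transmissionForm_self hn hm hnm]
  linarith

/-- In `-m ≥ 1 + γ` the `1` compensates the term `k⁴ ‖u‖²`, which has the wrong sign after negation;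
only `k² < λ₁` is then needed. -/
lemma transmissionForm_coercive_of_lt {Ω : Opens R3} (hb : Bornology.IsBounded (Ω : Set R3))
    (hne : (Ω : Set R3).Nonempty) (hΩ : HasC2Boundary Ω) {k : ℝ} (hk : 0 < k) {n m : R3 → ℝ}
    (hn : MemLp n ⊤ (volume.restrict (Ω : Set R3))) (hm : MemLp m ⊤ (volume.restrict (Ω : Set R3)))
    (hnm : ∀ᵐ x ∂(volume.restrict (Ω : Set R3)), m x * (n x - 1) = 1) {γ : ℝ} (hγ : 0 < γ)
    (hmγ : ∀ᵐ x ∂(volume.restrict (Ω : Set R3)), m x ≤ -(1 + γ))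
    (hkl : k ^ 2 < firstDirichletEigenvalue Ω) :
    ∃ β > 0, ∀ x ∈ zeroTrace Ω, β * ‖x‖ * ‖x‖ ≤ -transmissionForm hn hm k x x := by
  have hl : 0 < firstDirichletEigenvalue Ω := lt_of_le_of_lt (by positivity) hkl
  obtain ⟨α, hα, h⟩ := exists_coercive_lt (κ := k ^ 2 / firstDirichletEigenvalue Ω) hγ
    ((div_lt_one hl).2 hkl)
  refine exists_coercive_of_bound hb hne hΩ hk hl hα fun x hx h1 h2 => ?_
  refine (h _ _ _ h1 h2).trans ?_
  have hneg (v : RealL2 Ω) : mulOp hm.neg v = -mulOp hm v := by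
    refine Lp.ext ?_
    filter_upwards [coeFn_mulOp hm.neg v, coeFn_mulOp hm v, Lp.coeFn_neg (mulOp hm v)]
      with y h1 h2 h3
    rw [h1, h3, Pi.neg_apply, Pi.neg_apply, h2, neg_smul]
  have h3 := mul_norm_sq_le_inner_mulOp hm.neg (γ := 1 + γ)
    (hmγ.mono fun y hy => by rw [Pi.neg_apply]; linarith) (x 2 - k ^ 2 • x 0)
  rw [norm_sub_smul_sq, hneg, inner_neg_left] at h3
  rw [transmissionForm_self hn hm hnm]
  linarith

end Form

/-! ### Solution of the real transmission problem -/

section RealSolution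

open Filter Topology

/-- `curl curl E - k² g E = 0` in the sense of distributions, for real fields. -/
def RealMaxwell {Ω : Opens R3} (k : ℝ) {g : R3 → ℝ}
    (hg : MemLp g ⊤ (volume.restrict (Ω : Set R3))) (E : RealL2 Ω) : Prop :=
  ∀ f : R3 → R3, ∀ hf : IsTest f, tsupport f ⊆ Ω →
    inner ℝ E (hf.curl.curl.toL2 Ω) = k ^ 2 * inner ℝ (mulOp hg E) (hf.toL2 Ω)

lemma RealWeakCurl.inner_curl_curl {Ω : Opens R3} {u c t : RealL2 Ω} (h : RealWeakCurl Ω u c)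
    (h' : RealWeakCurl Ω c t) {f : R3 → R3} (hf : IsTest f) (hfs : tsupport f ⊆ Ω) :
    inner ℝ u (hf.curl.curl.toL2 Ω) = inner ℝ t (hf.toL2 Ω) := by
  rw [h' f hf hfs, h _ hf.curl ((tsupport_curl_subset f).trans hfs)]

/-- The a priori bound that coercivity gives after division by `N`; the `+ 1` only makes the
constant strictly positive. -/
lemma le_of_mul_mul_le {b N s f w : ℝ} (hb : 0 < b) (hN : 0 ≤ N) (hs : 0 ≤ s) (hf : 0 ≤ f)
    (hw : 0 ≤ w) (h : b * N * N ≤ s * (f * w * N)) : N ≤ (b⁻¹ * (s * f) + 1) * w := by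
  rcases hN.eq_or_lt with rfl | h3
  · positivity
  · have h4 : b * N ≤ s * f * w := by
      refine le_of_mul_le_mul_right ?_ h3
      linarith
    have h5 : N ≤ b⁻¹ * (s * f * w) := by
      rw [← div_eq_inv_mul, le_div_iff₀ hb]
      linarith
    linarith

/-- The data of the real problem: a coercive form of either sign. -/
structure CoerciveData (Ω : Opens R3) (k : ℝ) (n : R3 → ℝ) where
  m : R3 → ℝ
  memLp_index : MemLp n ⊤ (volume.restrict (Ω : Set R3))
  memLp_inv : MemLp m ⊤ (volume.restrict (Ω : Set R3))
  mul_eq : ∀ᵐ x ∂(volume.restrict (Ω : Set R3)), m x * (n x - 1) = 1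
  sign : ℝ
  bound : ℝ
  bound_pos : 0 < bound
  coercive : ∀ x ∈ zeroTrace Ω,
    bound * ‖x‖ * ‖x‖ ≤ sign * transmissionForm memLp_index memLp_inv k x x

namespace CoerciveData

variable {Ω : Opens R3} {k : ℝ} {n : R3 → ℝ} (D : CoerciveData Ω k n)

/-- The form of the problem. -/
noncomputable def form : Triple Ω →L[ℝ] Triple Ω →L[ℝ] ℝ :=
  transmissionForm D.memLp_index D.memLp_inv k

lemma eq_zero_of_form_self {x : Triple Ω} (hx : x ∈ zeroTrace Ω) (h : D.form x x = 0) : x = 0 := by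
  have h1 := D.coercive x hx
  change _ ≤ D.sign * D.form x x at h1
  rw [h, mul_zero, mul_assoc] at h1
  have h2 := D.bound_pos
  by_contra h3
  have h4 : 0 < ‖x‖ := norm_pos_iff.2 h3
  have : 0 < D.bound * (‖x‖ * ‖x‖) := by positivity
  linarith

/-- Solution of the variational problem with bounds. -/
lemma exists_form_eq (hk : D.sign ≠ 0) : ∃ C > 0, ∀ w : Triple Ω, ∃ u ∈ zeroTrace Ω,
    (∀ v ∈ zeroTrace Ω, D.form (w + u) v = 0) ∧ ‖u‖ ≤ C * ‖w‖ := by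
  have hcl : IsComplete (zeroTrace Ω : Set (Triple Ω)) := (isClosed_zeroTrace Ω).isComplete
  have : CompleteSpace (zeroTrace Ω) := hcl.completeSpace_coe
  set B : zeroTrace Ω →L[ℝ] zeroTrace Ω →L[ℝ] ℝ :=
    D.sign • D.form.bilinearComp (zeroTrace Ω).subtypeL (zeroTrace Ω).subtypeL with hB
  have hco : IsCoercive B := ⟨D.bound, D.bound_pos, fun x => D.coercive x x.2⟩
  refine ⟨D.bound⁻¹ * (|D.sign| * ‖D.form‖) + 1, by
    have := D.bound_pos
    positivity, fun w => ?_⟩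
  -- The Riesz representative of `v ↦ -form w v`, multiplied by the sign that makes the form
  -- coercive.
  set r : zeroTrace Ω := (InnerProductSpace.toDual ℝ (zeroTrace Ω)).symm
    ((-D.sign) • (D.form w).comp (zeroTrace Ω).subtypeL) with hr
  set u : zeroTrace Ω := hco.continuousLinearEquivOfBilin.symm r with hu
  have hBu (v : zeroTrace Ω) : D.sign * D.form u v = -D.sign * D.form w v := by
    have h1 := hco.continuousLinearEquivOfBilin_apply u v
    rw [hu, ContinuousLinearEquiv.apply_symm_apply, hr, InnerProductSpace.toDual_symm_apply] at h1
    exact h1.symm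
  have hform (v : zeroTrace Ω) : D.form u v = -D.form w v := by
    have := hBu v
    rw [neg_mul, ← mul_neg] at this
    exact mul_left_cancel₀ hk this
  refine ⟨u, u.2, fun v hv => ?_, ?_⟩
  · rw [map_add, add_apply, hform ⟨v, hv⟩, add_neg_cancel]
  · have h1 := D.coercive u u.2
    change _ ≤ D.sign * D.form u u at h1
    rw [hBu u] at h1
    have h2 : -D.sign * D.form w u ≤ |D.sign| * (‖D.form‖ * ‖w‖ * ‖(u : Triple Ω)‖) := by
      refine (le_abs_self _).trans ?_
      rw [abs_mul, abs_neg]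
      gcongr
      exact D.form.le_opNorm₂ w u
    exact le_of_mul_mul_le D.bound_pos (norm_nonneg _) (abs_nonneg _) (norm_nonneg D.form)
      (norm_nonneg w) (h1.trans h2)

/-- A pair of solutions of the Maxwell equations whose difference has vanishing traces is zero. -/
lemma eq_zero (hb : Bornology.IsBounded (Ω : Set R3)) (hΩ : HasC2Boundary Ω) (hk : 0 < k)
    {E F : RealL2 Ω} (hE : RealMaxwell k (memLp_top_const (1 : ℝ)) E)
    (hF : RealMaxwell k D.memLp_index F) {x : Triple Ω} (hx : x ∈ zeroTrace Ω)
    (h0 : x 0 = F - E) : E = 0 ∧ F = 0 := by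
  -- This is `curl curl u - k² u = k² (n - 1) F`, read off from the distributional equations because
  -- test fields are total.
  have h2 : x 2 - k ^ 2 • x 0 = k ^ 2 • (mulOp D.memLp_index F - F) := by
    rw [← sub_eq_zero]
    refine realL2_eq_zero fun f hf hfs => ?_
    have h3 := hx.1.realWeakCurl.inner_curl_curl hx.2.realWeakCurl hf hfs
    have h4 := hE f hf hfs
    have h5 := hF f hf hfs
    rw [mulOp_one] at h4
    rw [h0, inner_sub_left, h4, h5] at h3
    simp only [h0, inner_sub_left, real_inner_smul_left, ← h3]
    ring
  have h6 : fluxOp D.memLp_inv k x = k ^ 2 • F := by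
    rw [fluxOp_apply, h2, map_smul, mulOp_mulOp_sub D.memLp_index D.memLp_inv D.mul_eq]
  -- The equation for `F` only admits test fields in `Ω`; density allows every `v` with vanishing
  -- traces, in particular `v = x`.
  have h7 : ∀ v ∈ zeroTrace Ω, D.form x v = 0 := by
    intro v hv
    refine zeroTrace_induction hb hΩ (P := fun v => D.form x v = 0)
      (isClosed_eq (by fun_prop) (by fun_prop)) (fun f hf hfs => ?_) hv
    rw [form, transmissionForm_apply, h6, map_smul, real_inner_smul_left, real_inner_smul_left]
    change k ^ 2 * inner ℝ F (hf.curl.curl.toL2 Ω) - k ^ 2 * (k ^ 2 *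
      inner ℝ (mulOp D.memLp_index F) (hf.toL2 Ω)) = 0
    rw [hF f hf hfs, sub_self]
  have h8 : x = 0 := D.eq_zero_of_form_self hx (h7 x hx)
  rw [h8, map_zero] at h6
  have h9 : F = 0 := by
    rcases smul_eq_zero.1 h6.symm with h | h
    · exact absurd h (by positivity)
    · exact h
  refine ⟨?_, h9⟩
  rw [h8, h9, PiLp.zero_apply, zero_sub] at h0
  exact neg_eq_zero.1 h0.symm

/-- Existence of solutions with bounds. -/
lemma exists_solution (hs : D.sign ≠ 0) (hk : 0 < k) : ∃ C > 0, ∀ w : Triple Ω,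
    RealWeakCurl Ω (w 0) (w 1) → RealWeakCurl Ω (w 1) (w 2) → ∃ u ∈ zeroTrace Ω,
      ∃ E F : RealL2 Ω, RealMaxwell k (memLp_top_const (1 : ℝ)) E ∧
        RealMaxwell k D.memLp_index F ∧ w 0 + u 0 = F - E ∧ ‖E‖ + ‖F‖ ≤ C * ‖w‖ := by
  obtain ⟨C, hC, h⟩ := D.exists_form_eq hs
  refine ⟨(2 * ((k ^ 2)⁻¹ * ‖fluxOp D.memLp_inv k‖) + 1) * (1 + C), by positivity,
    fun w hw1 hw2 => ?_⟩
  obtain ⟨u, hu, huv, hun⟩ := h w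
  set x := w + u with hx
  have hx1 : RealWeakCurl Ω (x 0) (x 1) := fun f hf hfs => by
    rw [hx, PiLp.add_apply, PiLp.add_apply, inner_add_left, inner_add_left, hw1 f hf hfs,
      hu.1 f hf]
  have hx2 : RealWeakCurl Ω (x 1) (x 2) := fun f hf hfs => by
    rw [hx, PiLp.add_apply, PiLp.add_apply, inner_add_left, inner_add_left, hw2 f hf hfs,
      hu.2 f hf]
  have hk2 : k ^ 2 ≠ 0 := by positivity
  -- The identity `k² (n - 1) F = curl curl u - k² u` dictates `F`, and then `E = F - u`; the
  -- variational equation is the equation for `F`.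
  obtain ⟨F, hFdef⟩ : ∃ F : RealL2 Ω, F = (k ^ 2)⁻¹ • fluxOp D.memLp_inv k x := ⟨_, rfl⟩
  have hkF : fluxOp D.memLp_inv k x = k ^ 2 • F := by
    rw [hFdef, smul_smul, mul_inv_cancel₀ hk2, one_smul]
  have hF : RealMaxwell k D.memLp_index F := fun f hf hfs => by
    have h1 := huv _ (hf.triple_mem hfs)
    rw [form, transmissionForm_apply, hkF, map_smul, real_inner_smul_left,
      real_inner_smul_left] at h1
    change k ^ 2 * inner ℝ F (hf.curl.curl.toL2 Ω) - k ^ 2 * (k ^ 2 *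
      inner ℝ (mulOp D.memLp_index F) (hf.toL2 Ω)) = 0 at h1
    rw [← mul_sub] at h1
    linarith [(mul_eq_zero.1 h1).resolve_left hk2]
  -- By `n m = 1 + m`, this says `k² n F - curl curl u = k² (F - u)`, which is what turns the
  -- equation for `F` into that for `E`.
  have hnF : k ^ 2 • mulOp D.memLp_index F = x 2 - k ^ 2 • x 0 + k ^ 2 • F := by
    rw [← map_smul, ← hkF, fluxOp_apply, mulOp_mulOp D.memLp_index D.memLp_inv D.mul_eq]
  refine ⟨u, hu, F - x 0, F, fun f hf hfs => ?_, hF, by rw [sub_sub_cancel]; rfl, ?_⟩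
  · rw [mulOp_one, inner_sub_left, hF f hf hfs, hx1.inner_curl_curl hx2 hf hfs,
      ← real_inner_smul_left, hnF, inner_add_left, inner_sub_left, real_inner_smul_left,
      real_inner_smul_left, inner_sub_left]
    ring
  · have h1 : ‖x‖ ≤ (1 + C) * ‖w‖ := by
      rw [hx, add_mul, one_mul]
      exact (norm_add_le _ _).trans (by gcongr)
    have h2 : ‖F‖ ≤ (k ^ 2)⁻¹ * ‖fluxOp D.memLp_inv k‖ * ‖x‖ := by
      rw [hFdef, norm_smul, Real.norm_eq_abs, abs_of_nonneg (by positivity), mul_assoc]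
      gcongr
      exact ContinuousLinearMap.le_opNorm _ _
    have h3 : ‖x 0‖ ≤ ‖x‖ := PiLp.norm_apply_le x 0
    calc ‖F - x 0‖ + ‖F‖ ≤ ‖F‖ + ‖x 0‖ + ‖F‖ := by gcongr; exact norm_sub_le _ _
      _ ≤ (2 * ((k ^ 2)⁻¹ * ‖fluxOp D.memLp_inv k‖) + 1) * ‖x‖ := by linarith
      _ ≤ (2 * ((k ^ 2)⁻¹ * ‖fluxOp D.memLp_inv k‖) + 1) * ((1 + C) * ‖w‖) := by gcongr
      _ = _ := by ring

end CoerciveData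

end RealSolution

/-! ### Admissible indices -/

section Index

open Filter Topology

lemma ae_restrict_neBot {Ω : Opens R3} (hne : (Ω : Set R3).Nonempty) :
    (ae (volume.restrict (Ω : Set R3))).NeBot := by
  rw [ae_neBot, Ne, Measure.restrict_eq_zero]
  exact (Ω.2.measure_pos volume hne).ne'

lemma IsC2Domain.nonempty {Ω : Opens R3} (h : IsC2Domain Ω) : (Ω : Set R3).Nonempty := by
  have := h.simplyConnected
  obtain ⟨x⟩ := (inferInstance : Nonempty Ω)
  exact ⟨x, x.2⟩

lemma ae_le_indexSup {Ω : Opens R3} {n : R3 → ℝ}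
    (hn : MemLp n ⊤ (volume.restrict (Ω : Set R3))) :
    ∀ᵐ x ∂(volume.restrict (Ω : Set R3)), n x ≤ indexSup Ω n := by
  refine ae_le_essSup ⟨(eLpNormEssSup n (volume.restrict (Ω : Set R3))).toReal, ?_⟩
  rw [eventually_map]
  have htop : eLpNormEssSup n (volume.restrict (Ω : Set R3)) ≠ ⊤ := by
    rw [← eLpNorm_exponent_top]
    exact hn.2.ne
  filter_upwards [ae_le_eLpNormEssSup (f := n) (μ := volume.restrict (Ω : Set R3))] with x hx
  refine (le_abs_self _).trans ?_
  rw [← Real.norm_eq_abs, ← toReal_enorm]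
  exact ENNReal.toReal_mono htop hx

lemma IsAdmissibleIndex.indexSup_pos {Ω : Opens R3} {n : R3 → ℝ} (h : IsAdmissibleIndex Ω n)
    (hne : (Ω : Set R3).Nonempty) : 0 < indexSup Ω n := by
  have := ae_restrict_neBot hne
  have h1 := ae_le_indexSup h.1
  rcases h.2 with ⟨r, hr, h2⟩ | ⟨c, hc, r, hr, h2⟩
  · obtain ⟨x, hx1, hx2⟩ := (h1.and h2).exists
    linarith
  · obtain ⟨x, hx1, hx2, -⟩ := (h1.and h2).exists
    linarith

lemma memLp_inv_sub_one {Ω : Opens R3} {n : R3 → ℝ}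
    (hn : MemLp n ⊤ (volume.restrict (Ω : Set R3))) {r : ℝ} (hr : 0 < r)
    (h : ∀ᵐ x ∂(volume.restrict (Ω : Set R3)), r ≤ |n x - 1|) :
    MemLp (fun x => (n x - 1)⁻¹) ⊤ (volume.restrict (Ω : Set R3)) := by
  refine memLp_top_of_bound (hn.1.aemeasurable.sub_const 1).inv.aestronglyMeasurable r⁻¹ ?_
  filter_upwards [h] with x hx
  rw [Real.norm_eq_abs, abs_inv]
  exact inv_anti₀ hr hx

/-- Under the eigenvalue condition the form of an admissible index is coercive. -/
lemma exists_coerciveData {Ω : Opens R3} {n : R3 → ℝ} {k : ℝ} (hk : 0 < k) (hΩ : IsC2Domain Ω)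
    (hn : IsAdmissibleIndex Ω n) (hkl : k ^ 2 < firstDirichletEigenvalue Ω)
    (hkS : k ^ 2 < firstDirichletEigenvalue Ω / indexSup Ω n) :
    ∃ D : CoerciveData Ω k n, D.sign ≠ 0 := by
  have hne := hΩ.nonempty
  have := ae_restrict_neBot hne
  have hS := ae_le_indexSup hn.1
  rcases hn.2 with ⟨r, hr, h⟩ | ⟨c, hc, r, hr, h⟩
  · have h1 : ∀ᵐ x ∂(volume.restrict (Ω : Set R3)), r ≤ |n x - 1| := by
      filter_upwards [h] with x hx
      rw [abs_of_pos (by linarith)]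
      linarith
    have h2 : ∀ᵐ x ∂(volume.restrict (Ω : Set R3)), (n x - 1)⁻¹ * (n x - 1) = 1 := by
      filter_upwards [h] with x hx
      exact inv_mul_cancel₀ (by linarith)
    have hS1 : 1 < indexSup Ω n := by
      obtain ⟨x, hx1, hx2⟩ := (hS.and h).exists
      linarith
    -- From `1 < n ≤ sup n` one gets `1/(n - 1) ≥ 1/(sup n - 1)`.
    obtain ⟨β, hβ, hβ'⟩ := transmissionForm_coercive_of_gt hΩ.bounded hne hΩ.boundary hk hn.1
      (memLp_inv_sub_one hn.1 hr h1) h2 hS1 (by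
        filter_upwards [h, hS] with x hx hxS
        rw [one_div]
        exact inv_anti₀ (by linarith) (by linarith)) hkS
    exact ⟨⟨_, hn.1, memLp_inv_sub_one hn.1 hr h1, h2, 1, β, hβ, fun x hx => by
      rw [one_mul]
      exact hβ' x hx⟩, one_ne_zero⟩
  · have h1 : ∀ᵐ x ∂(volume.restrict (Ω : Set R3)), r ≤ |n x - 1| := by
      filter_upwards [h] with x hx
      rw [abs_of_neg (by linarith)]
      linarith
    have h2 : ∀ᵐ x ∂(volume.restrict (Ω : Set R3)), (n x - 1)⁻¹ * (n x - 1) = 1 := by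
      filter_upwards [h] with x hx
      exact inv_mul_cancel₀ (by linarith)
    have hc1 : 0 < 1 - c := by
      obtain ⟨x, hx1, hx2⟩ := h.exists
      linarith
    -- The choice of `γ` makes `1 + γ = 1/(1 - c)`, and `c < n < 1` gives `1/(1 - n) ≥ 1/(1 - c)`.
    obtain ⟨β, hβ, hβ'⟩ := transmissionForm_coercive_of_lt hΩ.bounded hne hΩ.boundary hk hn.1
      (memLp_inv_sub_one hn.1 hr h1) h2 (γ := c / (1 - c)) (by positivity) (by
        filter_upwards [h] with x hx
        have e1 : 1 + c / (1 - c) = (1 - c)⁻¹ := by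
          field_simp
          ring
        have e2 : (n x - 1)⁻¹ = -(1 - n x)⁻¹ := by rw [← inv_neg, neg_sub]
        rw [e1, e2, neg_le_neg_iff]
        exact inv_anti₀ (by linarith) (by linarith)) hkl
    exact ⟨⟨_, hn.1, memLp_inv_sub_one hn.1 hr h1, h2, -1, β, hβ, fun x hx => by
      rw [neg_one_mul]
      exact hβ' x hx⟩, by norm_num⟩

/-- The eigenvalue condition holds on domains of small diameter. -/
lemma exists_diam_bound {k : ℝ} (hk : 0 < k) (N : ℝ) : ∃ δ > 0, ∀ (Ω : Opens R3) (n : R3 → ℝ),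
    IsC2Domain Ω → IsAdmissibleIndex Ω n → indexSup Ω n ≤ N → Metric.diam (Ω : Set R3) < δ →
      k ^ 2 < min (firstDirichletEigenvalue Ω) (firstDirichletEigenvalue Ω / indexSup Ω n) := by
  have hM : 0 < max 1 N := lt_of_lt_of_le one_pos (le_max_left _ _)
  -- From `q diam² < 1` and `1 ≤ 4 λ₁ diam²` follows `λ₁ > k² max(1, N)`. The `1` serves the bound
  -- for `λ₁`, the `N` that for `λ₁ / sup n`.
  set q : ℝ := k ^ 2 * max 1 N * 4 with hq
  have hq0 : 0 < q := by positivity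
  refine ⟨√(1 / q), by positivity, fun Ω n hΩ hn hN hd => ?_⟩
  have h1 := (firstDirichletEigenvalue_spec hΩ.bounded hΩ.nonempty).2
  have hS := hn.indexSup_pos hΩ.nonempty
  have h2 : Metric.diam (Ω : Set R3) ^ 2 < 1 / q := by
    rw [← Real.sq_sqrt (show 0 ≤ 1 / q by positivity)]
    exact pow_lt_pow_left₀ hd Metric.diam_nonneg two_ne_zero
  rw [lt_div_iff₀ hq0] at h2
  set d := Metric.diam (Ω : Set R3) ^ 2 with hdd
  have hd0 : 0 ≤ d := sq_nonneg _
  have key : k ^ 2 * max 1 N < firstDirichletEigenvalue Ω := by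
    by_contra h3
    rw [not_lt] at h3
    have : firstDirichletEigenvalue Ω * (4 * d) ≤ k ^ 2 * max 1 N * (4 * d) :=
      mul_le_mul_of_nonneg_right h3 (by positivity)
    rw [hq] at h2
    linarith
  have hk2 : 0 < k ^ 2 := by positivity
  refine lt_min ?_ ?_
  · nlinarith [le_max_left 1 N]
  · rw [lt_div_iff₀ hS]
    nlinarith [le_max_right 1 N]

end Index

/-! ### Real and imaginary parts of complex fields -/

section Complex

open Filter Topology

/-- The real part of a vector, coordinatewise. -/
noncomputable def reVec : C3 →L[ℝ] R3 :=
  LinearMap.mkContinuous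
    { toFun := fun z => WithLp.toLp 2 fun j => (z j).re
      map_add' := fun z w => by ext j; simp
      map_smul' := fun a z => by ext j; simp } 1 fun z => by
    rw [one_mul, EuclideanSpace.norm_eq, EuclideanSpace.norm_eq]
    refine Real.sqrt_le_sqrt (Finset.sum_le_sum fun j _ => ?_)
    exact pow_le_pow_left₀ (norm_nonneg _) (Complex.abs_re_le_norm (z j)) 2

/-- The imaginary part of a vector, coordinatewise. -/
noncomputable def imVec : C3 →L[ℝ] R3 :=
  LinearMap.mkContinuous
    { toFun := fun z => WithLp.toLp 2 fun j => (z j).im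
      map_add' := fun z w => by ext j; simp
      map_smul' := fun a z => by ext j; simp } 1 fun z => by
    rw [one_mul, EuclideanSpace.norm_eq, EuclideanSpace.norm_eq]
    refine Real.sqrt_le_sqrt (Finset.sum_le_sum fun j _ => ?_)
    exact pow_le_pow_left₀ (norm_nonneg _) (Complex.abs_im_le_norm (z j)) 2

/-- Multiplication of a real vector by a complex number. -/
noncomputable def complexVec (a : ℂ) : R3 →L[ℝ] C3 :=
  LinearMap.mkContinuous
    { toFun := fun v => WithLp.toLp 2 fun j => (v j : ℂ) * a
      map_add' := fun z w => by ext j; simp [add_mul]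
      map_smul' := fun b z => by ext j; simp [mul_assoc] } ‖a‖ fun v => by
    rw [EuclideanSpace.norm_eq, EuclideanSpace.norm_eq, ← Real.sqrt_sq (norm_nonneg a),
      ← Real.sqrt_mul (sq_nonneg _), Finset.mul_sum]
    refine Real.sqrt_le_sqrt (Finset.sum_le_sum fun j _ => le_of_eq ?_)
    simp [mul_pow, mul_comm]

@[simp] lemma reVec_apply (z : C3) (j : Fin 3) : reVec z j = (z j).re := rfl
@[simp] lemma imVec_apply (z : C3) (j : Fin 3) : imVec z j = (z j).im := rfl
@[simp] lemma complexVec_apply (a : ℂ) (v : R3) (j : Fin 3) : complexVec a v j = (v j : ℂ) * a := rfl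

lemma dotC_eq (z : C3) (v : R3) :
    dotC z v = (inner ℝ (reVec z) v : ℂ) + (inner ℝ (imVec z) v : ℂ) * Complex.I := by
  rw [dotC, inner_eq_sum, inner_eq_sum, Fin.sum_univ_three]
  apply Complex.ext <;> simp

variable {Ω : Opens R3}

/-- The real part of a complex field. -/
noncomputable def reField : L2Field Ω →L[ℝ] RealL2 Ω := reVec.compLpL 2 _

/-- The imaginary part of a complex field. -/
noncomputable def imField : L2Field Ω →L[ℝ] RealL2 Ω := imVec.compLpL 2 _

/-- The complex field `v a`, for a real field `v` and a complex number `a`. -/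
noncomputable def complexField (a : ℂ) : RealL2 Ω →L[ℝ] L2Field Ω := (complexVec a).compLpL 2 _

lemma coeFn_reField (u : L2Field Ω) :
    reField u =ᵐ[volume.restrict (Ω : Set R3)] fun x => reVec (u x) :=
  ContinuousLinearMap.coeFn_compLpL _ _

lemma coeFn_imField (u : L2Field Ω) :
    imField u =ᵐ[volume.restrict (Ω : Set R3)] fun x => imVec (u x) :=
  ContinuousLinearMap.coeFn_compLpL _ _

lemma coeFn_complexField (a : ℂ) (u : RealL2 Ω) :
    complexField a u =ᵐ[volume.restrict (Ω : Set R3)] fun x => complexVec a (u x) :=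
  ContinuousLinearMap.coeFn_compLpL _ _

/-- The complex field with given real and imaginary parts. -/
noncomputable def joinField (a b : RealL2 Ω) : L2Field Ω :=
  complexField 1 a + complexField Complex.I b

lemma coeFn_joinField (a b : RealL2 Ω) : joinField a b =ᵐ[volume.restrict (Ω : Set R3)]
    fun x => complexVec 1 (a x) + complexVec Complex.I (b x) := by
  filter_upwards [Lp.coeFn_add (complexField 1 a) (complexField Complex.I b),
    coeFn_complexField 1 a, coeFn_complexField Complex.I b] with x h1 h2 h3
  rw [joinField, h1, Pi.add_apply, h2, h3]

@[simp] lemma reField_joinField (a b : RealL2 Ω) : reField (joinField a b) = a := by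
  refine Lp.ext ?_
  filter_upwards [coeFn_reField (joinField a b), coeFn_joinField a b] with x h1 h2
  rw [h1, h2]
  ext j
  simp

@[simp] lemma imField_joinField (a b : RealL2 Ω) : imField (joinField a b) = b := by
  refine Lp.ext ?_
  filter_upwards [coeFn_imField (joinField a b), coeFn_joinField a b] with x h1 h2
  rw [h1, h2]
  ext j
  simp

@[simp] lemma joinField_re_im (u : L2Field Ω) : joinField (reField u) (imField u) = u := by
  refine Lp.ext ?_
  filter_upwards [coeFn_reField u, coeFn_imField u, coeFn_joinField (reField u) (imField u)]
    with x h1 h2 h3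
  rw [h3, h1, h2]
  ext j
  simp [Complex.re_add_im]

lemma joinField_sub (a b c d : RealL2 Ω) :
    joinField (a - c) (b - d) = joinField a b - joinField c d := by
  simp only [joinField, map_sub]
  abel

lemma norm_joinField_le (a b : RealL2 Ω) : ‖joinField a b‖ ≤
    (‖complexField (Ω := Ω) 1‖ + ‖complexField (Ω := Ω) Complex.I‖) * (‖a‖ + ‖b‖) := by
  have h (p q r s : ℝ) (hp : 0 ≤ p) (hq : 0 ≤ q) (hr : 0 ≤ r) (hs : 0 ≤ s) :
      p * r + q * s ≤ (p + q) * (r + s) := by nlinarith [mul_nonneg hp hs, mul_nonneg hq hr]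
  refine (norm_add_le _ _).trans ((add_le_add (ContinuousLinearMap.le_opNorm _ a)
    (ContinuousLinearMap.le_opNorm _ b)).trans ?_)
  exact h _ _ _ _ (norm_nonneg _) (norm_nonneg _) (norm_nonneg a) (norm_nonneg b)

lemma field_eq_zero {u : L2Field Ω} (h1 : reField u = 0) (h2 : imField u = 0) : u = 0 := by
  rw [← joinField_re_im u, h1, h2, joinField, map_zero, map_zero, add_zero]

/-- The pairing of the complex field `a + i b` with a test field. -/
noncomputable def pairing (a b : RealL2 Ω) {f : R3 → R3} (hf : IsTest f) : ℂ :=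
  (inner ℝ a (hf.toL2 Ω) : ℂ) + (inner ℝ b (hf.toL2 Ω) : ℂ) * Complex.I

lemma pairing_re (a b : RealL2 Ω) {f : R3 → R3} (hf : IsTest f) :
    (pairing a b hf).re = inner ℝ a (hf.toL2 Ω) := by simp [pairing]

lemma pairing_im (a b : RealL2 Ω) {f : R3 → R3} (hf : IsTest f) :
    (pairing a b hf).im = inner ℝ b (hf.toL2 Ω) := by simp [pairing]

lemma integrable_inner_test (a : RealL2 Ω) {f : R3 → R3} (hf : IsTest f) :
    Integrable (fun x => inner ℝ (a x) (f x)) (volume.restrict (Ω : Set R3)) := by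
  refine (L2.integrable_inner a (hf.toL2 Ω)).congr ?_
  filter_upwards [hf.coeFn_toL2 Ω] with x hx
  rw [hx]

lemma hasIntegral_pairing (a b : RealL2 Ω) {f : R3 → R3} (hf : IsTest f) :
    Integrable (fun x => (inner ℝ (a x) (f x) : ℂ) + (inner ℝ (b x) (f x) : ℂ) * Complex.I)
      (volume.restrict (Ω : Set R3)) ∧
    ∫ x in (Ω : Set R3), ((inner ℝ (a x) (f x) : ℂ) + (inner ℝ (b x) (f x) : ℂ) * Complex.I) =
      pairing a b hf := by
  have h1 := (integrable_inner_test a hf).ofReal (𝕜 := ℂ)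
  have h2 := ((integrable_inner_test b hf).ofReal (𝕜 := ℂ)).mul_const Complex.I
  refine ⟨h1.add h2, ?_⟩
  refine (integral_add h1 h2).trans ?_
  rw [pairing, inner_toL2, inner_toL2, integral_mul_const]
  congr 1
  · exact integral_ofReal
  · congr 1
    exact integral_ofReal

lemma dotC_ae_eq (u : L2Field Ω) (f : R3 → R3) :
    (fun x => dotC (u x) (f x)) =ᵐ[volume.restrict (Ω : Set R3)] fun x =>
      (inner ℝ (reField u x) (f x) : ℂ) + (inner ℝ (imField u x) (f x) : ℂ) * Complex.I := by
  filter_upwards [coeFn_reField u, coeFn_imField u] with x h1 h2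
  rw [dotC_eq, h1, h2]

lemma integrable_dotC (u : L2Field Ω) {f : R3 → R3} (hf : IsTest f) :
    Integrable (fun x => dotC (u x) (f x)) (volume.restrict (Ω : Set R3)) :=
  (hasIntegral_pairing (reField u) (imField u) hf).1.congr (dotC_ae_eq u f).symm

lemma integral_dotC (u : L2Field Ω) {f : R3 → R3} (hf : IsTest f) :
    ∫ x in (Ω : Set R3), dotC (u x) (f x) = pairing (reField u) (imField u) hf := by
  rw [integral_congr_ae (dotC_ae_eq u f), (hasIntegral_pairing _ _ hf).2]

/-- Test fields are real, so a complex identity is a pair of real ones. -/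
lemma isWeakCurl_iff {u c : L2Field Ω} : IsWeakCurl Ω u c ↔
    RealWeakCurl Ω (reField u) (reField c) ∧ RealWeakCurl Ω (imField u) (imField c) := by
  constructor
  · intro h
    have key (f : R3 → R3) (hf : IsTest f) (hfs : tsupport f ⊆ Ω) :
        pairing (reField c) (imField c) hf = pairing (reField u) (imField u) hf.curl := by
      rw [← integral_dotC, ← integral_dotC]
      exact h ⟨f, hf.smooth, hf.compact, hfs⟩
    refine ⟨fun f hf hfs => ?_, fun f hf hfs => ?_⟩
    · simpa only [pairing_re] using congrArg Complex.re (key f hf hfs)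
    · simpa only [pairing_im] using congrArg Complex.im (key f hf hfs)
  · intro h ψ
    rw [integral_dotC c ψ.isTest, integral_dotC u ψ.isTest.curl, pairing, pairing,
      h.1 _ ψ.isTest ψ.tsupport_subset, h.2 _ ψ.isTest ψ.tsupport_subset]

lemma hasTangentialTrace_iff {u c : L2Field Ω} {h : VectorDistribution} :
    HasTangentialTrace Ω u c h ↔ ∀ ψ : 𝓓((⊤ : Opens R3), R3),
      h ψ = pairing (reField u) (imField u) ψ.isTest.curl -
        pairing (reField c) (imField c) ψ.isTest := by
  refine forall_congr' fun ψ => ?_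
  rw [integral_sub (integrable_dotC u ψ.isTest.curl) (integrable_dotC c ψ.isTest),
    integral_dotC u ψ.isTest.curl, integral_dotC c ψ.isTest]

lemma integral_maxwell {m : R3 → ℝ} (hm : MemLp m ⊤ (volume.restrict (Ω : Set R3))) (k : ℝ)
    (E : L2Field Ω) {f : R3 → R3} (hf : IsTest f) :
    ∫ x in (Ω : Set R3), (dotC (E x) (curl (curl f) x)
      - (k : ℂ) ^ 2 * (m x : ℂ) * dotC (E x) (f x)) =
    pairing (reField E) (imField E) hf.curl.curl -
      (k : ℂ) ^ 2 * pairing (mulOp hm (reField E)) (mulOp hm (imField E)) hf := by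
  have h1 := hasIntegral_pairing (mulOp hm (reField E)) (mulOp hm (imField E)) hf
  rw [← integral_dotC, ← h1.2, ← integral_const_mul,
    ← integral_sub (integrable_dotC E hf.curl.curl) (h1.1.const_mul _)]
  refine integral_congr_ae ?_
  filter_upwards [coeFn_mulOp hm (reField E), coeFn_mulOp hm (imField E), dotC_ae_eq E f]
    with x h2 h3 h4
  simp only [h2, h3, h4, real_inner_smul_left]
  push_cast
  ring

/-- Since `k` and `m` are real, the equation commutes with taking real and imaginary parts and the
problem decouples into two real ones. -/
lemma solvesMaxwell_iff {m : R3 → ℝ} (hm : MemLp m ⊤ (volume.restrict (Ω : Set R3))) {k : ℝ}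
    {E : L2Field Ω} : SolvesMaxwell Ω k m E ↔
      RealMaxwell k hm (reField E) ∧ RealMaxwell k hm (imField E) := by
  have hre (z w : ℂ) : (z - (k : ℂ) ^ 2 * w).re = z.re - k ^ 2 * w.re := by
    rw [← Complex.ofReal_pow, Complex.sub_re, Complex.re_ofReal_mul]
  have him (z w : ℂ) : (z - (k : ℂ) ^ 2 * w).im = z.im - k ^ 2 * w.im := by
    rw [← Complex.ofReal_pow, Complex.sub_im, Complex.im_ofReal_mul]
  constructor
  · intro h
    have key (f : R3 → R3) (hf : IsTest f) (hfs : tsupport f ⊆ Ω) :=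
      (integral_maxwell hm k E hf).symm.trans (h ⟨f, hf.smooth, hf.compact, hfs⟩)
    refine ⟨fun f hf hfs => ?_, fun f hf hfs => ?_⟩
    · have := congrArg Complex.re (key f hf hfs)
      rw [hre, pairing_re, pairing_re, Complex.zero_re] at this
      linarith
    · have := congrArg Complex.im (key f hf hfs)
      rw [him, pairing_im, pairing_im, Complex.zero_im] at this
      linarith
  · intro h ψ
    rw [integral_maxwell hm k E ψ.isTest]
    apply Complex.ext
    · rw [hre, pairing_re, pairing_re, Complex.zero_re, h.1 _ ψ.isTest ψ.tsupport_subset, sub_self]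
    · rw [him, pairing_im, pairing_im, Complex.zero_im, h.2 _ ψ.isTest ψ.tsupport_subset, sub_self]

end Complex

/-! ### The interior transmission problem -/

section Main

open Filter Topology

variable {Ω : Opens R3}

/-- The triple of real parts. -/
noncomputable def UField.reTriple (w : UField Ω) : Triple Ω :=
  WithLp.toLp 2 ![reField w.field, reField w.curlField, reField w.curlCurlField]

/-- The triple of imaginary parts. -/
noncomputable def UField.imTriple (w : UField Ω) : Triple Ω :=
  WithLp.toLp 2 ![imField w.field, imField w.curlField, imField w.curlCurlField]

lemma norm_triple_le (T : L2Field Ω →L[ℝ] RealL2 Ω) (w : UField Ω) {x : Triple Ω}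
    (h0 : x 0 = T w.field) (h1 : x 1 = T w.curlField) (h2 : x 2 = T w.curlCurlField) :
    ‖x‖ ≤ ‖T‖ * w.norm := by
  have b (v : L2Field Ω) : ‖T v‖ ^ 2 ≤ ‖T‖ ^ 2 * ‖v‖ ^ 2 := by
    rw [← mul_pow]
    exact pow_le_pow_left₀ (norm_nonneg _) (T.le_opNorm v) 2
  rw [UField.norm, ← Real.sqrt_sq (norm_nonneg x), ← Real.sqrt_sq (norm_nonneg T),
    ← Real.sqrt_mul (sq_nonneg _)]
  refine Real.sqrt_le_sqrt ?_
  rw [PiLp.norm_sq_eq_of_L2, Fin.sum_univ_three, h0, h1, h2]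
  have b0 := b w.field
  have b1 := b w.curlField
  have b2 := b w.curlCurlField
  have b3 : 0 ≤ ‖T‖ ^ 2 * ‖w.curlField‖ ^ 2 := mul_nonneg (sq_nonneg _) (sq_nonneg _)
  linarith

lemma UField.norm_nonneg (w : UField Ω) : 0 ≤ w.norm := Real.sqrt_nonneg _

/-- The difference of two fields with equal traces has vanishing traces. -/
lemma UField.sub_mem_zeroTrace {w w' : UField Ω} {h : VectorDistribution × VectorDistribution}
    (hw : w.HasTraces h) (hw' : w'.HasTraces h) :
    w.reTriple - w'.reTriple ∈ zeroTrace Ω ∧ w.imTriple - w'.imTriple ∈ zeroTrace Ω := by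
  have key {u c u' c' : L2Field Ω} {g : VectorDistribution} (h1 : HasTangentialTrace Ω u c g)
      (h2 : HasTangentialTrace Ω u' c' g) :
      RealWeakCurlZero Ω (reField u - reField u') (reField c - reField c') ∧
        RealWeakCurlZero Ω (imField u - imField u') (imField c - imField c') := by
    rw [hasTangentialTrace_iff] at h1 h2
    have e (f : R3 → R3) (hf : IsTest f) :=
      (h1 ⟨f, hf.smooth, hf.compact, Set.subset_univ _⟩).symm.trans
        (h2 ⟨f, hf.smooth, hf.compact, Set.subset_univ _⟩)
    refine ⟨fun f hf => ?_, fun f hf => ?_⟩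
    · have h3 := congrArg Complex.re (e f hf)
      rw [Complex.sub_re, Complex.sub_re, pairing_re, pairing_re, pairing_re, pairing_re] at h3
      rw [inner_sub_left, inner_sub_left]
      change inner ℝ (reField u) (hf.curl.toL2 Ω) - inner ℝ (reField c) (hf.toL2 Ω) =
        inner ℝ (reField u') (hf.curl.toL2 Ω) - inner ℝ (reField c') (hf.toL2 Ω) at h3
      linarith
    · have h3 := congrArg Complex.im (e f hf)
      rw [Complex.sub_im, Complex.sub_im, pairing_im, pairing_im, pairing_im, pairing_im] at h3
      rw [inner_sub_left, inner_sub_left]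
      change inner ℝ (imField u) (hf.curl.toL2 Ω) - inner ℝ (imField c) (hf.toL2 Ω) =
        inner ℝ (imField u') (hf.curl.toL2 Ω) - inner ℝ (imField c') (hf.toL2 Ω) at h3
      linarith
  have k1 := key hw.1 hw'.1
  have k2 := key hw.2 hw'.2
  exact ⟨⟨k1.1, k2.1⟩, ⟨k1.2, k2.2⟩⟩

lemma RealMaxwell.sub {k : ℝ} {g : R3 → ℝ} {hg : MemLp g ⊤ (volume.restrict (Ω : Set R3))}
    {E E' : RealL2 Ω} (h : RealMaxwell k hg E) (h' : RealMaxwell k hg E') :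
    RealMaxwell k hg (E - E') := fun f hf hfs => by
  rw [inner_sub_left, h f hf hfs, h' f hf hfs, map_sub, inner_sub_left, mul_sub]

lemma isWeakSolution_unique {k : ℝ} {n : R3 → ℝ} (D : CoerciveData Ω k n)
    (hb : Bornology.IsBounded (Ω : Set R3)) (hΩ : HasC2Boundary Ω) (hk : 0 < k)
    {h : VectorDistribution × VectorDistribution} {p q : L2Field Ω × L2Field Ω}
    (hp : IsWeakSolution Ω k n h p) (hq : IsWeakSolution Ω k n h q) : p = q := by
  obtain ⟨p1, p2, u, hu, hut⟩ := hp
  obtain ⟨q1, q2, v, hv, hvt⟩ := hq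
  rw [solvesMaxwell_iff (memLp_top_const (1 : ℝ))] at p1 q1
  rw [solvesMaxwell_iff D.memLp_index] at p2 q2
  obtain ⟨m1, m2⟩ := UField.sub_mem_zeroTrace hut hvt
  have r := D.eq_zero hb hΩ hk (p1.1.sub q1.1) (p2.1.sub q2.1) m1 (by
    change reField u.field - reField v.field = _
    rw [hu, hv, map_sub, map_sub]
    abel)
  have i := D.eq_zero hb hΩ hk (p1.2.sub q1.2) (p2.2.sub q2.2) m2 (by
    change imField u.field - imField v.field = _
    rw [hu, hv, map_sub, map_sub]
    abel)
  simp only [← map_sub] at r i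
  exact Prod.ext (sub_eq_zero.1 (field_eq_zero r.1 i.1)) (sub_eq_zero.1 (field_eq_zero r.2 i.2))

/-- The bound uses an arbitrary lift `w` of the data, with a constant independent of `w`; taking the
infimum over lifts is left to the end. -/
lemma exists_isWeakSolution {k : ℝ} {n : R3 → ℝ} (D : CoerciveData Ω k n) (hs : D.sign ≠ 0)
    (hk : 0 < k) : ∃ C > 0, ∀ (h : VectorDistribution × VectorDistribution) (w : UField Ω),
      w.HasTraces h → ∃ p, IsWeakSolution Ω k n h p ∧ ‖p.1‖ + ‖p.2‖ ≤ C * w.norm := by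
  obtain ⟨C, hC, H⟩ := D.exists_solution hs hk
  obtain ⟨K, hK⟩ : ∃ K, K = ‖complexField (Ω := Ω) 1‖ + ‖complexField (Ω := Ω) Complex.I‖ :=
    ⟨_, rfl⟩
  have hK0 : 0 ≤ K := hK ▸ add_nonneg (norm_nonneg _) (norm_nonneg _)
  obtain ⟨R, hR⟩ : ∃ R, R = ‖reField (Ω := Ω)‖ + ‖imField (Ω := Ω)‖ := ⟨_, rfl⟩
  have hR0 : 0 ≤ R := hR ▸ add_nonneg (norm_nonneg _) (norm_nonneg _)
  -- `R` accounts for taking real and imaginary parts, `C` for the real solution, `K` for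
  -- recombining; `+ 1` ensures positivity.
  refine ⟨K * (C * R) + 1, by positivity, fun h w hw => ?_⟩
  have c1 := isWeakCurl_iff.1 w.isCurl
  have c2 := isWeakCurl_iff.1 w.isCurlCurl
  obtain ⟨u, hu, E, F, hE, hF, huEF, hb⟩ := H w.reTriple c1.1 c2.1
  obtain ⟨u', hu', E', F', hE', hF', huEF', hb'⟩ := H w.imTriple c1.2 c2.2
  have curl_add {a b a' b' : RealL2 Ω} (h1 : RealWeakCurl Ω a b) (h2 : RealWeakCurlZero Ω a' b') :
      RealWeakCurl Ω (a + a') (b + b') := fun f hf hfs => by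
    rw [inner_add_left, inner_add_left, h1 f hf hfs, h2 f hf]
  have trace_add {a c : L2Field Ω} {g : VectorDistribution} (h1 : HasTangentialTrace Ω a c g)
      {a₁ a₂ c₁ c₂ : RealL2 Ω} (h2 : RealWeakCurlZero Ω a₁ c₁) (h3 : RealWeakCurlZero Ω a₂ c₂) :
      HasTangentialTrace Ω (joinField (reField a + a₁) (imField a + a₂))
        (joinField (reField c + c₁) (imField c + c₂)) g := by
    rw [hasTangentialTrace_iff] at h1 ⊢
    intro ψ
    rw [h1 ψ]
    simp only [reField_joinField, imField_joinField, pairing, inner_add_left, h2 _ ψ.isTest,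
      h3 _ ψ.isTest]
    push_cast
    ring
  refine ⟨(joinField E E', joinField F F'), ⟨?_, ?_, ⟨joinField (reField w.field + u 0)
    (imField w.field + u' 0), joinField (reField w.curlField + u 1) (imField w.curlField + u' 1),
    joinField (reField w.curlCurlField + u 2) (imField w.curlCurlField + u' 2), ?_, ?_⟩, ?_, ?_, ?_⟩,
    ?_⟩
  · rw [solvesMaxwell_iff (memLp_top_const (1 : ℝ))]
    simpa only [reField_joinField, imField_joinField] using ⟨hE, hE'⟩
  · rw [solvesMaxwell_iff D.memLp_index]
    simpa only [reField_joinField, imField_joinField] using ⟨hF, hF'⟩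
  · rw [isWeakCurl_iff]
    simp only [reField_joinField, imField_joinField]
    exact ⟨curl_add c1.1 hu.1, curl_add c1.2 hu'.1⟩
  · rw [isWeakCurl_iff]
    simp only [reField_joinField, imField_joinField]
    exact ⟨curl_add c2.1 hu.2, curl_add c2.2 hu'.2⟩
  · change joinField _ _ = joinField F F' - joinField E E'
    rw [← joinField_sub, ← huEF, ← huEF']
    rfl
  · exact trace_add hw.1 hu.1 hu'.1
  · exact trace_add hw.2 hu.2 hu'.2
  · have n1 := norm_joinField_le E E'
    have n2 := norm_joinField_le F F'
    rw [← hK] at n1 n2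
    have n3 : ‖w.reTriple‖ ≤ ‖reField (Ω := Ω)‖ * w.norm := norm_triple_le _ w rfl rfl rfl
    have n4 : ‖w.imTriple‖ ≤ ‖imField (Ω := Ω)‖ * w.norm := norm_triple_le _ w rfl rfl rfl
    have n5 : ‖w.reTriple‖ + ‖w.imTriple‖ ≤ R * w.norm := by
      rw [hR, add_mul]
      exact add_le_add n3 n4
    have n6 := w.norm_nonneg
    change ‖joinField E E'‖ + ‖joinField F F'‖ ≤ _
    calc ‖joinField E E'‖ + ‖joinField F F'‖
        ≤ K * ((‖E‖ + ‖F‖) + (‖E'‖ + ‖F'‖)) := by linarith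
      _ ≤ K * (C * (‖w.reTriple‖ + ‖w.imTriple‖)) := by
        refine mul_le_mul_of_nonneg_left ?_ hK0
        rw [mul_add]
        exact add_le_add hb hb'
      _ ≤ K * (C * (R * w.norm)) :=
        mul_le_mul_of_nonneg_left (mul_le_mul_of_nonneg_left n5 hC.le) hK0
      _ ≤ (K * (C * R) + 1) * w.norm := by linarith

end Main

/-- For fixed `k > 0`: (i) if the diameter of `Ω` is small, depending only on `k` and an upper bound
of the index, then `k² < min {λ₁(Ω), λ₁(Ω) / sup n}`; (ii) under this inequality the interior
transmission problem is uniquely solvable, with a bound that is uniform in the data. -/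
theorem corollary3p1 (k : ℝ) (hk : 0 < k) :
    (∀ N : ℝ, ∃ δ > 0, ∀ (Ω : Opens R3) (n : R3 → ℝ),
      IsC2Domain Ω → IsAdmissibleIndex Ω n → indexSup Ω n ≤ N →
      Metric.diam (Ω : Set R3) < δ →
      k ^ 2 < min (firstDirichletEigenvalue Ω) (firstDirichletEigenvalue Ω / indexSup Ω n)) ∧
    (∀ (Ω : Opens R3) (n : R3 → ℝ),
      IsC2Domain Ω → IsAdmissibleIndex Ω n →
      k ^ 2 < min (firstDirichletEigenvalue Ω) (firstDirichletEigenvalue Ω / indexSup Ω n) →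
      ∃ C > 0, ∀ h ∈ traceSpace Ω,
        (∃! p : L2Field Ω × L2Field Ω, IsWeakSolution Ω k n h p) ∧
        ∀ p : L2Field Ω × L2Field Ω, IsWeakSolution Ω k n h p →
          ‖p.1‖ + ‖p.2‖ ≤ C * traceNorm Ω h) := by
  refine ⟨fun N => exists_diam_bound hk N, fun Ω n hΩ hn hkl => ?_⟩
  obtain ⟨hl, hS⟩ := lt_min_iff.1 hkl
  obtain ⟨D, hs⟩ := exists_coerciveData hk hΩ hn hl hS
  obtain ⟨C, hC, H⟩ := exists_isWeakSolution D hs hk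
  refine ⟨C, hC, fun h ⟨w₀, hw₀⟩ => ⟨?_, fun p hp => ?_⟩⟩
  · obtain ⟨p, hp, -⟩ := H h w₀ hw₀
    exact ⟨p, hp, fun q hq => isWeakSolution_unique D hΩ.bounded hΩ.boundary hk hq hp⟩
  -- By uniqueness `p` is the solution built from any lift of `h`, so the bound holds for every lift
  -- and hence for the infimum.
  · rw [← div_le_iff₀' hC]
    refine le_csInf ⟨_, w₀, hw₀, rfl⟩ ?_
    rintro r ⟨w, hw, rfl⟩
    obtain ⟨q, hq, hqn⟩ := H h w hw
    rw [div_le_iff₀' hC, isWeakSolution_unique D hΩ.bounded hΩ.boundary hk hp hq]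
    exact hqn
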